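/- All $C^*$-algebras and $*$-homomorphisms are unital. For a discrete group $G$ let $C^*(G)$ be its universal group $C^*$-algebra; let $\mathbb F_k$ be the free group on $k$ generators ($\mathbb F_\infty$: countably many) and $\mathbb F(k,n)$ the free product of $k$ copies of $\mathbb Z_n$. A pair $(\mathcal A,\mathcal B)$ of $C^*$-algebras is a nuclear pair if the minimal and the maximal $C^*$-norm on the algebraic tensor product $\mathcal A\odot\mathcal B$ coincide. $\mathcal A$ has the WEP if for every $C^*$-algebra $\mathcal B\supseteq\mathcal A$ there is a unital completely positive (ucp) map $\mathcal B\to\mathcal A^{**}$ that is the identity on $\mathcal A$, and $\mathcal A$ has the QWEP if it is a quotient of a $C^*$-algebra with the WEP. Kirchberg's QWEP problem has a positive answer if one of the following (equivalent) statements holds: $C^*(\mathbb F_\infty)$ has the WEP; $(C^*(\mathbb F_k),C^*(\mathbb F_k))$ is a nuclear pair for some $k\in\{2,3,\dots\}\cup\{\infty\}$; every separable $C^*$-algebra has the QWEP. A nonlocal game $\mathfrak G=(\pi,D)$ with $k$ questions and $n$ answers is a probability distribution $\pi$ on $[k]\times[k]$ with a function $D:[k]^2\times[n]^2\to\{0,1\}$,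 and $\operatorname{val}(\mathfrak G,p)=\sum_{x,y}\pi(x,y)\sum_{a,b}D(x,y,a,b)\,p(a,b|x,y)$. Let $C_q(k,n)$ be the set of all $p(a,b|x,y)=\langle (A^x_a\otimes B^y_b)\psi,\psi\rangle$ with $n$-outcome POVMs $A^x$, $B^y$ ($x,y\in[k]$) on finite-dimensional Hilbert spaces $H_A$, $H_B$ and a unit vector $\psi\in H_A\otimes H_B$; let $C_{qa}(k,n)=\overline{C_q(k,n)}$; let $C_{qc}(k,n)$ be the set of all $p(a,b|x,y)=\langle A^x_aB^y_b\xi,\xi\rangle$ with $n$-outcome POVMs on one Hilbert space $H$ satisfying $A^x_aB^y_b=B^y_bA^x_a$ for all $x,y,a,b$ and a unit vector $\xi\in H$. Put $\operatorname{val}^*(\mathfrak G)=\sup_{p\in C_q(k,n)}\operatorname{val}(\mathfrak G,p)$ and $\operatorname{val}^{co}(\mathfrak G)=\sup_{p\in C_{qc}(k,n)}\operatorname{val}(\mathfrak G,p)$. 1. For all $k,n\ge2$: if $(C^*(\mathbb F(k,n)),C^*(\mathbb F(k,n)))$ is a nuclear pair, then $C_{qa}(k,n)=C_{qc}(k,n)$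 and $\operatorname{val}^*(\mathfrak G)=\operatorname{val}^{co}(\mathfrak G)$ for all nonlocal games $\mathfrak G$ with $k$ questions and $n$ answers. 2. For all $k,n\ge2$: the canonical $*$-homomorphism $q:C^*(\mathbb F_k)\to C^*(\mathbb F(k,n))$, induced by the quotient map $\mathbb Z\to\mathbb Z_n$ on each generator, has a ucp lift, that is, there is a ucp map $\Phi:C^*(\mathbb F(k,n))\to C^*(\mathbb F_k)$ with $q\circ\Phi=\mathrm{id}$; and if $(C^*(\mathbb F_k),C^*(\mathbb F_k))$ is a nuclear pair, then so is $(C^*(\mathbb F(k,n)),C^*(\mathbb F(k,n)))$. 3. If Kirchberg's QWEP problem has a positive answer, then Tsirelson's problem has a positive answer: for all $k,n$ one has $C_{qa}(k,n)=C_{qc}(k,n)$, and $\operatorname{val}^*(\mathfrak G)=\operatorname{val}^{co}(\mathfrak G)$ for all nonlocal games $\mathfrak G$ with $k$ questions and $n$ answers. -/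

import Mathlib

noncomputable section

open scoped TensorProduct ComplexOrder

namespace QWEPTsirelson

universe u

/-! ### The universal C⋆-algebra of a discrete group -/

/-- The complex group algebra `ℂ[G]`, as a type of its own: it will carry the involution and the
universal norm. -/
def GroupAlg (G : Type u) [Group G] : Type u := MonoidAlgebra ℂ G

namespace GroupAlg

variable {G : Type u} [Group G]

instance : Ring (GroupAlg G) := inferInstanceAs (Ring (MonoidAlgebra ℂ G))
instance : Algebra ℂ (GroupAlg G) := inferInstanceAs (Algebra ℂ (MonoidAlgebra ℂ G))

/-- The element `c · u_g` of `ℂ[G]`. -/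
def single (g : G) (c : ℂ) : GroupAlg G := MonoidAlgebra.single g c

@[elab_as_elim]
theorem induction {P : GroupAlg G → Prop} (x : GroupAlg G) (h0 : P 0)
    (hadd : ∀ x y, P x → P y → P (x + y)) (hs : ∀ g c, P (single g c)) : P x :=
  MonoidAlgebra.induction_linear (motive := P) x h0 hadd hs

theorem single_mul_single (g h : G) (c d : ℂ) :
    single g c * single h d = single (g * h) (c * d) :=
  MonoidAlgebra.single_mul_single ..

theorem smul_single (a : ℂ) (g : G) (c : ℂ) : a • single g c = single g (a * c) :=
  MonoidAlgebra.smul_single ..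

/-- The canonical extension `∑ c_g u_g ↦ ∑ c_g π(g)` of a unitary representation `π` of `G` in the
C⋆-algebra `A` to the group algebra. -/
def rep {A : Type u} [CStarAlgebra A] (π : G →* unitary A) : GroupAlg G →ₐ[ℂ] A :=
  MonoidAlgebra.lift ℂ A G ((unitary A).subtype.comp π)

theorem rep_single {A : Type u} [CStarAlgebra A] (π : G →* unitary A) (g : G) (c : ℂ) :
    rep π (single g c) = c • (π g : A) :=
  MonoidAlgebra.lift_single ..

/-- The involution `∑ c_g u_g ↦ ∑ conj(c_g) u_{g⁻¹}` as an additive map. -/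
def starHom : GroupAlg G →+ GroupAlg G :=
  MonoidAlgebra.liftNC (k := ℂ) (G := G) (R := MonoidAlgebra ℂ G)
    ((MonoidAlgebra.singleAddHom 1).comp (starRingEnd ℂ : ℂ →+ ℂ))
    (fun g => MonoidAlgebra.single g⁻¹ 1)

theorem starHom_single (g : G) (c : ℂ) :
    starHom (single g c) = single g⁻¹ (starRingEnd ℂ c) := by
  refine (MonoidAlgebra.liftNC_single _ _ _ _).trans ?_
  refine (MonoidAlgebra.single_mul_single ..).trans ?_
  rw [one_mul, mul_one]; rfl

instance : StarRing (GroupAlg G) where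
  star := starHom
  star_involutive x := by
    refine induction x ?_ ?_ ?_
    · rw [map_zero, map_zero]
    · intro x y hx hy
      rw [map_add, map_add, hx, hy]
    · intro g c
      rw [starHom_single, starHom_single, inv_inv, Complex.conj_conj]
  star_mul x y := by
    change starHom (x * y) = starHom y * starHom x
    refine induction x ?_ ?_ ?_
    · rw [zero_mul, map_zero, mul_zero]
    · intro x x' hx hx'
      rw [add_mul, map_add, map_add, mul_add, hx, hx']
    · intro g c
      refine induction y ?_ ?_ ?_
      · rw [mul_zero, map_zero, zero_mul]
      · intro y y' hy hy'
        rw [mul_add, map_add, map_add, add_mul, hy, hy']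
      · intro h d
        rw [single_mul_single, starHom_single, starHom_single, starHom_single, single_mul_single,
          mul_inv_rev, map_mul, mul_comm (starRingEnd ℂ d)]
  star_add := map_add starHom

theorem star_single (g : G) (c : ℂ) : star (single g c) = single g⁻¹ (starRingEnd ℂ c) :=
  starHom_single g c

instance : StarModule ℂ (GroupAlg G) where
  star_smul c x := by
    refine induction x ?_ ?_ ?_
    · rw [smul_zero, star_zero, smul_zero]
    · intro x y hx hy
      rw [smul_add, star_add, star_add, smul_add, hx, hy]
    · intro g d
      rw [smul_single, star_single, star_single, smul_single, map_mul]; rfl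

theorem rep_star {A : Type u} [CStarAlgebra A] (π : G →* unitary A) (x : GroupAlg G) :
    rep π (star x) = star (rep π x) := by
  refine induction x ?_ ?_ ?_
  · rw [star_zero, map_zero, star_zero]
  · intro x y hx hy
    rw [star_add, map_add, map_add, star_add, hx, hy]
  · intro g c
    rw [star_single, rep_single, rep_single, map_inv, star_smul]; rfl

/-- The set of norms `‖∑ c_g π(g)‖` of the images of `x = ∑ c_g u_g` under the unitary
representations `π : G → U(A)` of `G` in unital C⋆-algebras `A`. -/
def repNorms (x : GroupAlg G) : Set ℝ :=
  {r | ∃ (A : Type u) (_ : CStarAlgebra A) (π : G →* unitary A), r = ‖rep π x‖}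

theorem repNorms_nonempty (x : GroupAlg G) : (repNorms x).Nonempty :=
  ⟨_, lp (fun _ : G => ℂ) ⊤, inferInstance, 1, rfl⟩

theorem norm_unitary_le {A : Type u} [CStarAlgebra A] (U : unitary A) : ‖(U : A)‖ ≤ 1 := by
  rcases subsingleton_or_nontrivial A with h | h
  · rw [Subsingleton.elim (U : A) 0, norm_zero]; exact zero_le_one
  · exact (CStarRing.norm_coe_unitary U).le

theorem repNorms_bddAbove (x : GroupAlg G) : BddAbove (repNorms x) := by
  refine induction (P := fun x => BddAbove (repNorms x)) x ?_ ?_ ?_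
  · refine ⟨0, ?_⟩
    rintro _ ⟨A, _, π, rfl⟩
    rw [map_zero, norm_zero]
  · rintro x y ⟨a, ha⟩ ⟨b, hb⟩
    refine ⟨a + b, ?_⟩
    rintro _ ⟨A, _, π, rfl⟩
    rw [map_add]
    exact (norm_add_le _ _).trans (add_le_add (ha ⟨A, _, π, rfl⟩) (hb ⟨A, _, π, rfl⟩))
  · intro g c
    refine ⟨‖c‖, ?_⟩
    rintro _ ⟨A, _, π, rfl⟩
    rw [rep_single, norm_smul]
    exact mul_le_of_le_one_right (norm_nonneg c) (norm_unitary_le _)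

/-- The universal norm `‖x‖ = sup {‖∑ c_g π(g)‖ : π a unitary representation of G}` on `ℂ[G]`. -/
def univNorm (x : GroupAlg G) : ℝ := sSup (repNorms x)

theorem norm_rep_le {A : Type u} [CStarAlgebra A] (π : G →* unitary A) (x : GroupAlg G) :
    ‖rep π x‖ ≤ univNorm x :=
  le_csSup (repNorms_bddAbove x) ⟨A, _, π, rfl⟩

theorem univNorm_le {x : GroupAlg G} {C : ℝ}
    (h : ∀ (A : Type u) (_ : CStarAlgebra A) (π : G →* unitary A), ‖rep π x‖ ≤ C) :
    univNorm x ≤ C := by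
  refine csSup_le (repNorms_nonempty x) ?_
  rintro _ ⟨A, _, π, rfl⟩
  exact h A _ π

theorem univNorm_nonneg (x : GroupAlg G) : 0 ≤ univNorm x :=
  (norm_nonneg _).trans (norm_rep_le (A := lp (fun _ : G => ℂ) ⊤) 1 x)

theorem univNorm_zero : univNorm (0 : GroupAlg G) = 0 :=
  le_antisymm (univNorm_le fun A _ π => by rw [map_zero, norm_zero]) (univNorm_nonneg 0)

theorem univNorm_add_le (x y : GroupAlg G) : univNorm (x + y) ≤ univNorm x + univNorm y :=
  univNorm_le fun A _ π => by
    rw [map_add]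
    exact (norm_add_le _ _).trans (add_le_add (norm_rep_le π x) (norm_rep_le π y))

theorem univNorm_neg (x : GroupAlg G) : univNorm (-x) = univNorm x := by
  have h : ∀ x : GroupAlg G, univNorm (-x) ≤ univNorm x := fun x =>
    univNorm_le fun A _ π => by rw [map_neg, norm_neg]; exact norm_rep_le π x
  exact le_antisymm (h x) (by simpa using h (-x))

theorem univNorm_mul_le (x y : GroupAlg G) : univNorm (x * y) ≤ univNorm x * univNorm y :=
  univNorm_le fun A _ π => by
    rw [map_mul]
    exact (norm_mul_le _ _).trans
      (mul_le_mul (norm_rep_le π x) (norm_rep_le π y) (norm_nonneg _) (univNorm_nonneg x))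

instance : SeminormedRing (GroupAlg G) :=
  RingSeminorm.toSeminormedRing
    { toFun := univNorm
      map_zero' := univNorm_zero
      add_le' := univNorm_add_le
      neg' := univNorm_neg
      mul_le' := univNorm_mul_le }

theorem norm_def (x : GroupAlg G) : ‖x‖ = univNorm x := rfl

instance : NormedAlgebra ℂ (GroupAlg G) where
  norm_smul_le c x := univNorm_le fun A _ π => by
    rw [map_smul, norm_smul]
    exact mul_le_mul_of_nonneg_left (norm_rep_le π x) (norm_nonneg c)

theorem norm_star (x : GroupAlg G) : ‖star x‖ = ‖x‖ := by
  have h : ∀ x : GroupAlg G, ‖star x‖ ≤ ‖x‖ := fun x => univNorm_le fun A _ π => by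
    rw [rep_star, _root_.norm_star]; exact norm_rep_le π x
  exact le_antisymm (h x) (by simpa using h (star x))

instance : NormedStarGroup (GroupAlg G) where
  norm_star_le x := (norm_star x).le

theorem norm_mul_self_le (x : GroupAlg G) : ‖x‖ * ‖x‖ ≤ ‖star x * x‖ := by
  have h : ‖x‖ ≤ Real.sqrt ‖star x * x‖ := univNorm_le fun A _ π => by
    refine Real.le_sqrt_of_sq_le ?_
    rw [sq, ← CStarRing.norm_star_mul_self, ← rep_star, ← map_mul]
    exact norm_rep_le π _
  calc ‖x‖ * ‖x‖ ≤ Real.sqrt ‖star x * x‖ * Real.sqrt ‖star x * x‖ :=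
        mul_self_le_mul_self (univNorm_nonneg x) h
    _ = ‖star x * x‖ := Real.mul_self_sqrt (univNorm_nonneg _)

end GroupAlg

/-- The universal (maximal) group C⋆-algebra `C⋆(G)`: the completion of `ℂ[G]` for the universal
norm. -/
def GroupCStar (G : Type u) [Group G] : Type u := UniformSpace.Completion (GroupAlg G)

namespace GroupCStar

open UniformSpace

variable {G : Type u} [Group G]

instance : NormedRing (GroupCStar G) :=
  inferInstanceAs (NormedRing (Completion (GroupAlg G)))

instance : CompleteSpace (GroupCStar G) :=
  inferInstanceAs (CompleteSpace (Completion (GroupAlg G)))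

instance : Algebra ℂ (GroupCStar G) :=
  inferInstanceAs (Algebra ℂ (Completion (GroupAlg G)))

/-- The canonical map `ℂ[G] → C⋆(G)`. -/
def coe (x : GroupAlg G) : GroupCStar G := (x : Completion (GroupAlg G))

theorem continuous_coe : Continuous (coe : GroupAlg G → GroupCStar G) :=
  Completion.continuous_coe _

theorem coe_add (x y : GroupAlg G) : coe (x + y) = coe x + coe y := Completion.coe_add x y

theorem coe_mul (x y : GroupAlg G) : coe (x * y) = coe x * coe y := Completion.coe_mul x y

theorem coe_one : coe (1 : GroupAlg G) = 1 := Completion.coe_one _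

theorem coe_smul (c : ℂ) (x : GroupAlg G) : coe (c • x) = c • coe x := Completion.coe_smul c x

theorem norm_coe (x : GroupAlg G) : ‖coe x‖ = ‖x‖ := Completion.norm_coe x

@[elab_as_elim]
theorem induction_on {P : GroupCStar G → Prop} (x : GroupCStar G) (hp : IsClosed {x | P x})
    (ih : ∀ y, P (coe y)) : P x :=
  Completion.induction_on x hp ih

@[elab_as_elim]
theorem induction_on₂ {P : GroupCStar G → GroupCStar G → Prop} (x y : GroupCStar G)
    (hp : IsClosed {p : GroupCStar G × GroupCStar G | P p.1 p.2})
    (ih : ∀ a b, P (coe a) (coe b)) : P x y :=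
  Completion.induction_on₂ x y hp ih

instance : Star (GroupCStar G) where
  star := Completion.map (star : GroupAlg G → GroupAlg G)

theorem continuous_star : Continuous (star : GroupCStar G → GroupCStar G) :=
  Completion.continuous_map

theorem star_coe (x : GroupAlg G) : star (coe x) = coe (star x) :=
  Completion.map_coe (star_isometry (E := GroupAlg G)).uniformContinuous x

instance : StarRing (GroupCStar G) where
  star_involutive x := by
    refine induction_on x (isClosed_eq (continuous_star.comp continuous_star) continuous_id) ?_
    intro x
    rw [star_coe, star_coe, star_star]
  star_mul x y := by
    refine induction_on₂ x y (isClosed_eq (continuous_star.comp continuous_mul)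
      ((continuous_star.comp continuous_snd).mul (continuous_star.comp continuous_fst))) ?_
    intro x y
    rw [← coe_mul, star_coe, star_mul, coe_mul, star_coe, star_coe]
  star_add x y := by
    refine induction_on₂ x y (isClosed_eq (continuous_star.comp continuous_add)
      ((continuous_star.comp continuous_fst).add (continuous_star.comp continuous_snd))) ?_
    intro x y
    rw [← coe_add, star_coe, star_add, coe_add, star_coe, star_coe]

instance : CStarRing (GroupCStar G) where
  norm_mul_self_le x := by
    refine induction_on x (isClosed_le (continuous_norm.mul continuous_norm)
      (continuous_norm.comp (continuous_star.mul continuous_id))) ?_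
    intro x
    change ‖coe x‖ * ‖coe x‖ ≤ ‖star (coe x) * coe x‖
    rw [star_coe, ← coe_mul, norm_coe, norm_coe]
    exact GroupAlg.norm_mul_self_le x

theorem norm_smul_le' (c : ℂ) (x : GroupCStar G) : ‖c • x‖ ≤ ‖c‖ * ‖x‖ :=
  norm_smul_le (β := Completion (GroupAlg G)) c x

instance : NormedAlgebra ℂ (GroupCStar G) where
  norm_smul_le := norm_smul_le'

instance : StarModule ℂ (GroupCStar G) where
  star_smul c x := by
    refine induction_on x (isClosed_eq (continuous_star.comp (continuous_const_smul c))
      ((continuous_const_smul _).comp continuous_star)) ?_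
    intro x
    rw [← coe_smul, star_coe, star_coe, star_smul, coe_smul]

instance : CStarAlgebra (GroupCStar G) where

instance : PartialOrder (GroupCStar G) := CStarAlgebra.spectralOrder _

instance : StarOrderedRing (GroupCStar G) := CStarAlgebra.spectralOrderedRing _

/-- The canonical unitary `u_g` of `C⋆(G)`. -/
def of (g : G) : GroupCStar G := coe (GroupAlg.single g 1)

/-- The extension of a unitary representation `π : G → U(A)` to `C⋆(G)`, as a map. -/
def liftFun {A : Type u} [CStarAlgebra A] (π : G →* unitary A) : GroupCStar G → A :=
  Completion.extension (GroupAlg.rep π)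

theorem continuous_liftFun {A : Type u} [CStarAlgebra A] (π : G →* unitary A) :
    Continuous (liftFun π) :=
  Completion.continuous_extension

theorem liftFun_coe {A : Type u} [CStarAlgebra A] (π : G →* unitary A) (x : GroupAlg G) :
    liftFun π (coe x) = GroupAlg.rep π x :=
  Completion.extension_coe
    (AddMonoidHomClass.lipschitz_of_bound (GroupAlg.rep π) 1 fun x => by
      rw [one_mul]; exact GroupAlg.norm_rep_le π x).uniformContinuous x

/-- The extension of a unitary representation `π : G → U(A)` to a ⋆-homomorphism `C⋆(G) → A`. -/
def lift {A : Type u} [CStarAlgebra A] (π : G →* unitary A) : GroupCStar G →⋆ₐ[ℂ] A where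
  toFun := liftFun π
  map_one' := by rw [← coe_one, liftFun_coe, map_one]
  map_zero' := by
    have h := liftFun_coe π 0
    rw [map_zero] at h
    exact h
  map_mul' x y := by
    refine induction_on₂ x y (isClosed_eq ((continuous_liftFun π).comp continuous_mul)
      (((continuous_liftFun π).comp continuous_fst).mul
        ((continuous_liftFun π).comp continuous_snd))) ?_
    intro x y
    rw [← coe_mul, liftFun_coe, liftFun_coe, liftFun_coe, map_mul]
  map_add' x y := by
    refine induction_on₂ x y (isClosed_eq ((continuous_liftFun π).comp continuous_add)
      (((continuous_liftFun π).comp continuous_fst).add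
        ((continuous_liftFun π).comp continuous_snd))) ?_
    intro x y
    rw [← coe_add, liftFun_coe, liftFun_coe, liftFun_coe, map_add]
  commutes' c := (liftFun_coe π (algebraMap ℂ (GroupAlg G) c)).trans ((GroupAlg.rep π).commutes c)
  map_star' x := by
    refine induction_on x (isClosed_eq ((continuous_liftFun π).comp continuous_star)
      ((ContinuousStar.continuous_star (R := A)).comp (continuous_liftFun π))) ?_
    intro x
    rw [star_coe, liftFun_coe, liftFun_coe, GroupAlg.rep_star]

theorem lift_coe {A : Type u} [CStarAlgebra A] (π : G →* unitary A) (x : GroupAlg G) :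
    lift π (coe x) = GroupAlg.rep π x :=
  liftFun_coe π x

theorem lift_of {A : Type u} [CStarAlgebra A] (π : G →* unitary A) (g : G) :
    lift π (of g) = (π g : A) := by
  rw [of, lift_coe, GroupAlg.rep_single, one_smul]

/-- The canonical homomorphism `g ↦ u_g` of `G` into the unitary group of `C⋆(G)`. -/
def unitaryOf : G →* unitary (GroupCStar G) where
  toFun g := ⟨of g, by
    rw [Unitary.mem_iff, of, star_coe, GroupAlg.star_single, ← coe_mul, ← coe_mul,
      GroupAlg.single_mul_single, GroupAlg.single_mul_single]
    simp only [inv_mul_cancel, mul_inv_cancel, map_one, mul_one]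
    exact ⟨coe_one, coe_one⟩⟩
  map_one' := Subtype.ext coe_one
  map_mul' g h := Subtype.ext <| by
    change coe _ = coe _ * coe _
    rw [← coe_mul, GroupAlg.single_mul_single, mul_one]

/-- The ⋆-homomorphism `C⋆(f) : C⋆(G) → C⋆(H)`, `u_g ↦ u_{f(g)}`, induced by a group homomorphism
`f : G → H`. -/
def map {H : Type u} [Group H] (f : G →* H) : GroupCStar G →⋆ₐ[ℂ] GroupCStar H :=
  lift (unitaryOf.comp f)

end GroupCStar

/-! ### Hilbert space tensor products -/

section HilbertTensor

variable {H K : Type*} [NormedAddCommGroup H] [InnerProductSpace ℂ H] [CompleteSpace H]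
  [NormedAddCommGroup K] [InnerProductSpace ℂ K] [CompleteSpace K]

theorem inner_tensorMap (T : H →L[ℂ] H) (S : K →L[ℂ] K) (ξ η : H ⊗[ℂ] K) :
    inner ℂ (TensorProduct.map (T : H →ₗ[ℂ] H) (S : K →ₗ[ℂ] K) ξ) η
      = inner ℂ ξ (TensorProduct.map (star T : H →L[ℂ] H).toLinearMap
          (star S : K →L[ℂ] K).toLinearMap η) := by
  induction ξ using TensorProduct.induction_on with
  | zero => simp
  | add x y hx hy => rw [map_add, inner_add_left, inner_add_left, hx, hy]
  | tmul x y =>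
    induction η using TensorProduct.induction_on with
    | zero => simp
    | add x y hx hy => rw [map_add, inner_add_right, inner_add_right, hx, hy]
    | tmul z w =>
      simp [TensorProduct.inner_tmul, ContinuousLinearMap.star_eq_adjoint,
        ContinuousLinearMap.adjoint_inner_right]

theorem norm_tensorMap_left_le (T : H →L[ℂ] H) (ξ : H ⊗[ℂ] K) :
    ‖TensorProduct.map (T : H →ₗ[ℂ] H) (LinearMap.id : K →ₗ[ℂ] K) ξ‖ ≤ ‖T‖ * ‖ξ‖ := by
  have key : ∀ R : H →L[ℂ] H,
      inner ℂ (TensorProduct.map (R : H →ₗ[ℂ] H) (LinearMap.id : K →ₗ[ℂ] K) ξ)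
          (TensorProduct.map (R : H →ₗ[ℂ] H) (LinearMap.id : K →ₗ[ℂ] K) ξ)
        = inner ℂ ξ (TensorProduct.map ((star R * R : H →L[ℂ] H) : H →ₗ[ℂ] H)
          (LinearMap.id : K →ₗ[ℂ] K) ξ) := fun R => by
    have h := inner_tensorMap R (1 : K →L[ℂ] K) ξ
      (TensorProduct.map (R : H →ₗ[ℂ] H) (LinearMap.id : K →ₗ[ℂ] K) ξ)
    rw [star_one] at h
    refine h.trans ?_
    congr 1
    rw [← LinearMap.comp_apply, ← TensorProduct.map_comp, LinearMap.comp_id]; rfl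
  have hpos : (0 : H →L[ℂ] H) ≤ algebraMap ℝ (H →L[ℂ] H) (‖T‖ ^ 2) - star T * T :=
    sub_nonneg.2 CStarAlgebra.star_mul_le_algebraMap_norm_sq
  obtain ⟨R, hR⟩ := CStarAlgebra.nonneg_iff_eq_star_mul_self.1 hpos
  have hsum : star T * T + star R * R = ((‖T‖ ^ 2 : ℝ) : ℂ) • (1 : H →L[ℂ] H) := by
    rw [← hR, add_sub_cancel, Algebra.algebraMap_eq_smul_one, Complex.coe_smul]
  have h2 : (‖TensorProduct.map (T : H →ₗ[ℂ] H) (LinearMap.id : K →ₗ[ℂ] K) ξ‖ : ℂ) ^ 2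
      + (‖TensorProduct.map (R : H →ₗ[ℂ] H) (LinearMap.id : K →ₗ[ℂ] K) ξ‖ : ℂ) ^ 2
      = ((‖T‖ ^ 2 : ℝ) : ℂ) * (‖ξ‖ : ℂ) ^ 2 := by
    have e : ∀ v : H ⊗[ℂ] K, (‖v‖ : ℂ) ^ 2 = inner ℂ v v := fun v =>
      (inner_self_eq_norm_sq_to_K v).symm
    rw [e, e, e, key, key, ← inner_add_right (𝕜 := ℂ) (E := H ⊗[ℂ] K), ← LinearMap.add_apply, ← TensorProduct.map_add_left,
      ← ContinuousLinearMap.toLinearMap_add, hsum, ContinuousLinearMap.toLinearMap_smul,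
      TensorProduct.map_smul_left, LinearMap.smul_apply, inner_smul_right]
    congr 2
    exact LinearMap.congr_fun (TensorProduct.map_id (R := ℂ) (M := H) (N := K)) ξ
  have h3 : ‖TensorProduct.map (T : H →ₗ[ℂ] H) (LinearMap.id : K →ₗ[ℂ] K) ξ‖ ^ 2
      + ‖TensorProduct.map (R : H →ₗ[ℂ] H) (LinearMap.id : K →ₗ[ℂ] K) ξ‖ ^ 2
      = ‖T‖ ^ 2 * ‖ξ‖ ^ 2 := by exact_mod_cast h2
  refine (sq_le_sq₀ (norm_nonneg _) (by positivity)).1 ?_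
  rw [mul_pow, ← h3]
  exact le_add_of_nonneg_right (sq_nonneg _)

theorem norm_tensorMap_le (T : H →L[ℂ] H) (S : K →L[ℂ] K) (ξ : H ⊗[ℂ] K) :
    ‖TensorProduct.map (T : H →ₗ[ℂ] H) (S : K →ₗ[ℂ] K) ξ‖ ≤ ‖T‖ * ‖S‖ * ‖ξ‖ := by
  have h1 : TensorProduct.map (T : H →ₗ[ℂ] H) (S : K →ₗ[ℂ] K) ξ
      = TensorProduct.map (T : H →ₗ[ℂ] H) (LinearMap.id : K →ₗ[ℂ] K)
        (TensorProduct.map (LinearMap.id : H →ₗ[ℂ] H) (S : K →ₗ[ℂ] K) ξ) := by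
    rw [← LinearMap.comp_apply, ← TensorProduct.map_comp, LinearMap.comp_id, LinearMap.id_comp]
  have h2 : ‖TensorProduct.map (LinearMap.id : H →ₗ[ℂ] H) (S : K →ₗ[ℂ] K) ξ‖ ≤ ‖S‖ * ‖ξ‖ := by
    rw [← TensorProduct.norm_comm, ← TensorProduct.map_comm, ← TensorProduct.norm_comm ξ]
    exact norm_tensorMap_left_le S _
  rw [h1, mul_assoc]
  exact (norm_tensorMap_left_le T _).trans (mul_le_mul_of_nonneg_left h2 (norm_nonneg T))

variable (H K) in
/-- The Hilbert space tensor product `H ⊗ K`: the completion of the algebraic tensor product for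
the inner product with `⟨ξ₁ ⊗ η₁, ξ₂ ⊗ η₂⟩ = ⟨ξ₁, ξ₂⟩ ⟨η₁, η₂⟩`. -/
abbrev HilbertTensor : Type _ := UniformSpace.Completion (H ⊗[ℂ] K)

/-- The bounded operator `T ⊗ S` on `H ⊗ K`. -/
def tensorOp (T : H →L[ℂ] H) (S : K →L[ℂ] K) : HilbertTensor H K →L[ℂ] HilbertTensor H K :=
  ((TensorProduct.map (T : H →ₗ[ℂ] H) (S : K →ₗ[ℂ] K)).mkContinuous (‖T‖ * ‖S‖)
    (norm_tensorMap_le T S)).completion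

theorem tensorOp_coe (T : H →L[ℂ] H) (S : K →L[ℂ] K) (ξ : H ⊗[ℂ] K) :
    tensorOp T S (ξ : HilbertTensor H K)
      = (TensorProduct.map (T : H →ₗ[ℂ] H) (S : K →ₗ[ℂ] K) ξ : H ⊗[ℂ] K) :=
  ContinuousLinearMap.completion_apply_coe _ ξ

end HilbertTensor

/-- Operators on `H ⊗ K` that agree on the algebraic tensor product are equal. -/
theorem HilbertTensor.ext_op {H K : Type*} [NormedAddCommGroup H] [InnerProductSpace ℂ H]
    [NormedAddCommGroup K] [InnerProductSpace ℂ K] {T S : HilbertTensor H K →L[ℂ] HilbertTensor H K}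
    (h : ∀ ξ : H ⊗[ℂ] K, T ξ = S ξ) : T = S := by
  ext x
  exact UniformSpace.Completion.induction_on x (isClosed_eq T.continuous S.continuous) h

/-! ### Representations, C⋆-norms on the algebraic tensor product, nuclear pairs -/

/-- The representation `π ⊗ ρ : A ⊙ B → B(H ⊗ K)`, `a ⊗ b ↦ π(a) ⊗ ρ(b)`, of the algebraic tensor
product. -/
def tensorRep {A B : Type*} [CStarAlgebra A] [CStarAlgebra B]
    {H K : Type*} [NormedAddCommGroup H] [InnerProductSpace ℂ H] [CompleteSpace H]
    [NormedAddCommGroup K] [InnerProductSpace ℂ K] [CompleteSpace K]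
    (π : A →⋆ₐ[ℂ] (H →L[ℂ] H)) (ρ : B →⋆ₐ[ℂ] (K →L[ℂ] K)) :
    A ⊗[ℂ] B →ₗ[ℂ] (HilbertTensor H K →L[ℂ] HilbertTensor H K) :=
  TensorProduct.lift <| LinearMap.mk₂ ℂ (fun a b => tensorOp (π a) (ρ b))
    (fun a a' b => HilbertTensor.ext_op fun ξ => by
      rw [add_apply, tensorOp_coe, tensorOp_coe, tensorOp_coe, map_add,
        ContinuousLinearMap.toLinearMap_add, TensorProduct.map_add_left, LinearMap.add_apply,
        UniformSpace.Completion.coe_add])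
    (fun c a b => HilbertTensor.ext_op fun ξ => by
      rw [smul_apply, tensorOp_coe, tensorOp_coe, map_smul,
        ContinuousLinearMap.toLinearMap_smul, TensorProduct.map_smul_left, LinearMap.smul_apply,
        UniformSpace.Completion.coe_smul])
    (fun a b b' => HilbertTensor.ext_op fun ξ => by
      rw [add_apply, tensorOp_coe, tensorOp_coe, tensorOp_coe, map_add,
        ContinuousLinearMap.toLinearMap_add, TensorProduct.map_add_right, LinearMap.add_apply,
        UniformSpace.Completion.coe_add])
    (fun c a b => HilbertTensor.ext_op fun ξ => by
      rw [smul_apply, tensorOp_coe, tensorOp_coe, map_smul,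
        ContinuousLinearMap.toLinearMap_smul, TensorProduct.map_smul_right, LinearMap.smul_apply,
        UniformSpace.Completion.coe_smul])

section Norms

variable {A B : Type u} [CStarAlgebra A] [CStarAlgebra B]

/-- The minimal (spatial) C⋆-norm on `A ⊙ B`: the supremum of the operator norms
`‖(π ⊗ ρ)(x)‖` on `H ⊗ K` over the representations `π : A → B(H)` and `ρ : B → B(K)`.
The supremum is attained at every pair of faithful representations. -/
def minNorm (x : A ⊗[ℂ] B) : ℝ :=
  sSup {r | ∃ (H : Type u) (_ : NormedAddCommGroup H) (_ : InnerProductSpace ℂ H)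
    (_ : CompleteSpace H) (K : Type u) (_ : NormedAddCommGroup K) (_ : InnerProductSpace ℂ K)
    (_ : CompleteSpace K) (π : A →⋆ₐ[ℂ] (H →L[ℂ] H)) (ρ : B →⋆ₐ[ℂ] (K →L[ℂ] K)),
    r = ‖tensorRep π ρ x‖}

/-- The maximal C⋆-norm on `A ⊙ B`: the supremum of the norms `‖π(x)‖` over the ⋆-homomorphisms
`π : A ⊙ B → B(H)`. -/
def maxNorm (x : A ⊗[ℂ] B) : ℝ :=
  sSup {r | ∃ (H : Type u) (_ : NormedAddCommGroup H) (_ : InnerProductSpace ℂ H)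
    (_ : CompleteSpace H) (π : A ⊗[ℂ] B →⋆ₐ[ℂ] (H →L[ℂ] H)), r = ‖π x‖}

variable (A B) in
/-- `(A, B)` is a nuclear pair if the minimal and maximal C⋆-norms on `A ⊙ B` coincide. -/
def IsNuclearPair : Prop := ∀ x : A ⊗[ℂ] B, minNorm x = maxNorm x

end Norms

/-! ### The universal representation, the bidual, WEP and QWEP -/

section UniversalRep

variable (A : Type u) [CStarAlgebra A] [PartialOrder A] [StarOrderedRing A]

/-- The states of the unital C⋆-algebra `A`. -/
def StateSpace : Type u := {φ : A →ₚ[ℂ] ℂ // φ 1 = 1}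

/-- The Hilbert space `⨁_φ L²(A, φ)` of the universal representation, the sum running over all
states `φ` of `A` and `L²(A, φ)` being the GNS space of `φ`. -/
abbrev UniversalSpace : Type u := lp (fun φ : StateSpace A => φ.1.GNS) 2

variable {A}

theorem norm_gns_le (φ : A →ₚ[ℂ] ℂ) (a : A) : ‖φ.gnsStarAlgHom a‖ ≤ ‖a‖ :=
  NonUnitalStarAlgHom.norm_apply_le φ.gnsStarAlgHom a

theorem norm_gns_apply_le (φ : A →ₚ[ℂ] ℂ) (a : A) (v : φ.GNS) :
    ‖φ.gnsStarAlgHom a v‖ ≤ ‖a‖ * ‖v‖ :=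
  ((φ.gnsStarAlgHom a).le_opNorm v).trans
    (mul_le_mul_of_nonneg_right (norm_gns_le φ a) (norm_nonneg v))

theorem memℓp_universal (a : A) (ξ : UniversalSpace A) :
    Memℓp (fun φ : StateSpace A => φ.1.gnsStarAlgHom a (ξ φ)) 2 := by
  have h2 : (0 : ℝ) < (2 : ENNReal).toReal := by norm_num
  refine memℓp_gen (Summable.of_nonneg_of_le (fun φ => Real.rpow_nonneg (norm_nonneg _) _)
    (fun φ => ?_) (((lp.memℓp ξ).summable h2).mul_left (‖a‖ ^ (2 : ENNReal).toReal)))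
  rw [← Real.mul_rpow (norm_nonneg _) (norm_nonneg _)]
  exact Real.rpow_le_rpow (norm_nonneg _) (norm_gns_apply_le _ _ _) h2.le

/-- The operator `⨁_φ π_φ(a)`. -/
def universalOp (a : A) : UniversalSpace A →L[ℂ] UniversalSpace A :=
  LinearMap.mkContinuous
    { toFun := fun ξ => ⟨fun φ => φ.1.gnsStarAlgHom a (ξ φ), memℓp_universal a ξ⟩
      map_add' := fun ξ η => Subtype.ext <| funext fun φ => map_add (φ.1.gnsStarAlgHom a) _ _
      map_smul' := fun c ξ => Subtype.ext <| funext fun φ => map_smul (φ.1.gnsStarAlgHom a) _ _ }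
    ‖a‖ fun ξ => by
      have h2 : (0 : ℝ) < (2 : ENNReal).toReal := by norm_num
      refine lp.norm_le_of_tsum_le h2 (by positivity) ?_
      rw [Real.mul_rpow (norm_nonneg _) (norm_nonneg _), lp.norm_rpow_eq_tsum h2, ← tsum_mul_left]
      refine Summable.tsum_le_tsum (fun φ => ?_) ((lp.memℓp _).summable h2)
        (((lp.memℓp ξ).summable h2).mul_left _)
      rw [← Real.mul_rpow (norm_nonneg _) (norm_nonneg _)]
      exact Real.rpow_le_rpow (norm_nonneg _) (norm_gns_apply_le _ _ _) h2.le

theorem universalOp_apply (a : A) (ξ : UniversalSpace A) (φ : StateSpace A) :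
    universalOp a ξ φ = φ.1.gnsStarAlgHom a (ξ φ) := rfl

theorem universalOp_ext {T S : UniversalSpace A →L[ℂ] UniversalSpace A}
    (h : ∀ ξ φ, T ξ φ = S ξ φ) : T = S :=
  ContinuousLinearMap.ext fun ξ => lp.ext (funext fun φ => h ξ φ)

/-- The universal representation `π_u = ⨁_φ π_φ` of `A`, the direct sum of the GNS representations
of all its states. -/
def universalRep : A →⋆ₐ[ℂ] (UniversalSpace A →L[ℂ] UniversalSpace A) where
  toFun := universalOp
  map_one' := universalOp_ext fun ξ φ => by rw [universalOp_apply, map_one]; rfl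
  map_mul' a b := universalOp_ext fun ξ φ => by rw [universalOp_apply, map_mul]; rfl
  map_zero' := universalOp_ext fun ξ φ => by rw [universalOp_apply, map_zero]; rfl
  map_add' a b := universalOp_ext fun ξ φ => by rw [universalOp_apply, map_add]; rfl
  commutes' c := universalOp_ext fun ξ φ => by
    rw [universalOp_apply, Algebra.algebraMap_eq_smul_one, map_smul, map_one,
      Algebra.algebraMap_eq_smul_one]; rfl
  map_star' a := by
    rw [ContinuousLinearMap.star_eq_adjoint, ContinuousLinearMap.eq_adjoint_iff]
    intro ξ η
    rw [lp.inner_eq_tsum, lp.inner_eq_tsum]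
    refine tsum_congr fun φ => ?_
    rw [universalOp_apply, universalOp_apply, map_star, ContinuousLinearMap.star_eq_adjoint,
      ContinuousLinearMap.adjoint_inner_left]

theorem universalRep_apply (a : A) (ξ : UniversalSpace A) (φ : StateSpace A) :
    universalRep a ξ φ = φ.1.gnsStarAlgHom a (ξ φ) := rfl

variable (A) in
/-- The bidual `A** = π_u(A)''`: the von Neumann algebra generated by `A` in its universal
representation. -/
def bidual : Set (UniversalSpace A →L[ℂ] UniversalSpace A) :=
  Set.centralizer (Set.centralizer (Set.range (universalRep : A → _)))

end UniversalRep

open scoped CStarAlgebra in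
/-- `A`, embedded in `B` by `ι`, is weakly cp-complemented in `B`: there is a ucp map
`Φ : B → A**` with `Φ(a) = a` for `a ∈ A`. (The last condition makes `Φ` unital, as `ι 1 = 1`.) -/
def IsWeaklyCPComplemented {A B : Type u} [CStarAlgebra A] [PartialOrder A] [StarOrderedRing A]
    [CStarAlgebra B] [PartialOrder B] [StarOrderedRing B] (ι : A →⋆ₐ[ℂ] B) : Prop :=
  ∃ Φ : B →CP (UniversalSpace A →L[ℂ] UniversalSpace A),
    (∀ b, Φ b ∈ bidual A) ∧ ∀ a, Φ (ι a) = universalRep a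

/-- `A` has the weak expectation property: it is weakly cp-complemented in every C⋆-algebra that
contains it (unitally). -/
def HasWEP (A : Type u) [CStarAlgebra A] [PartialOrder A] [StarOrderedRing A] : Prop :=
  ∀ (B : Type u) [CStarAlgebra B] [PartialOrder B] [StarOrderedRing B] (ι : A →⋆ₐ[ℂ] B),
    Function.Injective ι → IsWeaklyCPComplemented ι

/-- `A` is QWEP: it is a quotient of a C⋆-algebra with the weak expectation property. -/
def HasQWEP (A : Type u) [CStarAlgebra A] : Prop :=
  ∃ (B : Type u) (_ : CStarAlgebra B) (_ : PartialOrder B) (_ : StarOrderedRing B)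
    (q : B →⋆ₐ[ℂ] A), HasWEP B ∧ Function.Surjective q

/-- A positive answer to Kirchberg's QWEP problem, in any one of its three customary forms:
`C⋆(𝔽_∞)` has the WEP; for some `k ∈ {2, 3, …} ∪ {∞}`, `(C⋆(𝔽_k), C⋆(𝔽_k))` is a nuclear pair;
every separable C⋆-algebra is QWEP. -/
def QWEPPositive : Prop :=
  HasWEP (GroupCStar (FreeGroup ℕ)) ∨
  ((∃ k : ℕ, 2 ≤ k ∧
      IsNuclearPair (GroupCStar (FreeGroup (Fin k))) (GroupCStar (FreeGroup (Fin k)))) ∨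
    IsNuclearPair (GroupCStar (FreeGroup ℕ)) (GroupCStar (FreeGroup ℕ))) ∨
  ∀ (A : Type) [CStarAlgebra A] [TopologicalSpace.SeparableSpace A], HasQWEP A

/-! ### The groups `𝔽(k, n)` -/

/-- `𝔽(k, n)`, the free product of `k` copies of the cyclic group `ℤ_n`. -/
abbrev FreeCyc (k n : ℕ) : Type := Monoid.CoprodI fun _ : Fin k => Multiplicative (ZMod n)

/-- The quotient map `𝔽_k → 𝔽(k, n)`, sending the `x`-th free generator to the canonical generator
of the `x`-th copy of `ℤ_n`. -/
def freeToFreeCyc (k n : ℕ) : FreeGroup (Fin k) →* FreeCyc k n :=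
  FreeGroup.lift fun x =>
    Monoid.CoprodI.of (M := fun _ : Fin k => Multiplicative (ZMod n)) (i := x)
      (Multiplicative.ofAdd 1)

/-! ### Strategies, correlation sets, nonlocal games -/

/-- Conditional probabilities `p(a,b|x,y)`, written `p a b x y`, with questions `x, y ∈ [k]` and
answers `a, b ∈ [n]`. -/
abbrev Correlation (k n : ℕ) : Type := Fin n → Fin n → Fin k → Fin k → ℝ

/-- A POVM with `n` outcomes on the Hilbert space `H`. -/
structure IsPOVM {n : ℕ} {H : Type*} [NormedAddCommGroup H] [InnerProductSpace ℂ H]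
    [CompleteSpace H] (P : Fin n → H →L[ℂ] H) : Prop where
  isPositive : ∀ a, (P a).IsPositive
  sum_eq_one : ∑ a, P a = 1

/-- The set `C_q(k, n)` of quantum strategies `p(a,b|x,y) = ⟨(A^x_a ⊗ B^y_b) ψ, ψ⟩`, with POVMs
`A^x` and `B^y` on finite-dimensional Hilbert spaces `H_A` and `H_B` and a unit vector
`ψ ∈ H_A ⊗ H_B`. (For finite-dimensional spaces the algebraic tensor product is complete. Mathlib's
inner product is linear in the second variable.) -/
def Cq (k n : ℕ) : Set (Correlation k n) :=
  {p | ∃ (HA : Type) (_ : NormedAddCommGroup HA) (_ : InnerProductSpace ℂ HA)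
    (_ : CompleteSpace HA) (_ : FiniteDimensional ℂ HA)
    (HB : Type) (_ : NormedAddCommGroup HB) (_ : InnerProductSpace ℂ HB)
    (_ : CompleteSpace HB) (_ : FiniteDimensional ℂ HB)
    (A : Fin k → Fin n → HA →L[ℂ] HA) (B : Fin k → Fin n → HB →L[ℂ] HB) (ψ : HA ⊗[ℂ] HB),
    (∀ x, IsPOVM (A x)) ∧ (∀ y, IsPOVM (B y)) ∧ ‖ψ‖ = 1 ∧
    ∀ a b x y, (p a b x y : ℂ)
      = inner ℂ ψ (TensorProduct.map (A x a : HA →ₗ[ℂ] HA) (B y b : HB →ₗ[ℂ] HB) ψ)}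

/-- `C_qa(k, n)`, the closure of `C_q(k, n)`. -/
def Cqa (k n : ℕ) : Set (Correlation k n) := closure (Cq k n)

/-- The set `C_qc(k, n)` of quantum commuting strategies `p(a,b|x,y) = ⟨A^x_a B^y_b ξ, ξ⟩`, with
commuting POVMs `A^x` and `B^y` on one Hilbert space `H` and a unit vector `ξ ∈ H`. -/
def Cqc (k n : ℕ) : Set (Correlation k n) :=
  {p | ∃ (H : Type) (_ : NormedAddCommGroup H) (_ : InnerProductSpace ℂ H) (_ : CompleteSpace H)
    (A B : Fin k → Fin n → H →L[ℂ] H) (ξ : H),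
    (∀ x, IsPOVM (A x)) ∧ (∀ y, IsPOVM (B y)) ∧ (∀ x y a b, Commute (A x a) (B y b)) ∧ ‖ξ‖ = 1 ∧
    ∀ a b x y, (p a b x y : ℂ) = inner ℂ ξ ((A x a * B y b) ξ)}

/-- A nonlocal game with `k` questions and `n` answers: a probability distribution `π` on
`[k] × [k]` and a decision predicate `D : [k] × [k] × [n] × [n] → {0, 1}`. -/
structure NonlocalGame (k n : ℕ) where
  /-- the distribution of the questions -/
  π : PMF (Fin k × Fin k)
  /-- the decision predicate -/
  D : Fin k → Fin k → Fin n → Fin n → Fin 2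

namespace NonlocalGame

variable {k n : ℕ} (G : NonlocalGame k n)

/-- The value `val(G, p)` of the game `G` with respect to the strategy `p`. -/
def val (p : Correlation k n) : ℝ :=
  ∑ x, ∑ y, (G.π (x, y)).toReal * ∑ a, ∑ b, ((G.D x y a b : ℕ) : ℝ) * p a b x y

/-- The entangled value `val*(G)`. -/
def entangledValue : ℝ := sSup (G.val '' Cq k n)

/-- The commuting value `val^co(G)`. -/
def commutingValue : ℝ := sSup (G.val '' Cqc k n)

end NonlocalGame

/-- Tsirelson's problem has a positive answer for `k` questions and `n` answers:
`C_qa(k, n) = C_qc(k, n)`, and `val*(G) = val^co(G)` for every game `G`. -/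
def TsirelsonPositive (k n : ℕ) : Prop :=
  Cqa k n = Cqc k n ∧ ∀ G : NonlocalGame k n, G.entangledValue = G.commutingValue

end QWEPTsirelson

end

open QWEPTsirelson
open scoped CStarAlgebra

/-! The passage between measurements and group C⋆-algebras is a dilation. By Naimark, a POVM with
`n` outcomes is a corner of a projection valued measure in matrices over the algebra; such a measure
is the spectral measure of a unitary of order `n`; and the unitaries of the different questions
assemble freely into one representation of `𝔽(k, n)`. The entries of the dilation are built from the
POVM by functional calculus, so everything that commutes with the POVM commutes, as a diagonal
matrix, with the dilation. Hence the two commuting sides of a strategy can be dilated one after the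
other (`exists_dilation_of_mem_Cqc`). This property of a family of POVMs in `C⋆(G)` is
`IsUniversalPOVM`. Free groups with two distinct generators have such a family as well
(`exists_isUniversalPOVM_freeGroup`), because one shift and one diagonal unitary encode any finite
family of unitaries.

For a nuclear pair, Hahn–Banach in the space of correlations suffices: `C_q` is convex, so `p` lies
in `C_qa` once it satisfies each linear inequality valid on `C_q`. Such an inequality is a norm
bound in the minimal tensor product; nuclearity makes it a bound in the maximal one, where `p` lives
(`Cqc_subset_Cqa_of_isNuclearPair`). In the other direction `C_qc` is a continuous image of the
state space of `C⋆(G₁ × G₂)`, hence compact, so it contains `C_qa`, and the values of games agree by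
continuity.

The ucp lift comes from the same dilation: spectral projections in `C⋆(𝔽(k, n))` lift to POVMs in
`C⋆(𝔽_k)` (`exists_povm_lift`), and the corner of their dilation is a section of `q`
(`exists_corner_section`). Tensor squares of corner maps are contractive for the minimal norm, so
nuclearity descends along `q`.

The WEP and QWEP hypotheses are used directly, without the equivalence with nuclearity. A weak
expectation on `B(K)` turns a commuting strategy into POVMs on `K` paired with positive functionals
on `B(K)` whose sum over the answers does not depend on the question. Such data give points of
`C_qa` (`mem_Cqa_of_functionals`). In finite dimensions they are obtained by steering an entangled
vector; convex duality (`exists_dominating`) rewrites this as operator inequalities, which survive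
weak limits and so hold on every `K`. A quotient of an algebra with the WEP is enough because POVMs
lift along quotient maps. -/

noncomputable section

open scoped TensorProduct ComplexOrder CStarAlgebra

namespace QWEPTsirelson

universe u v

/-! ### Separation by positive functionals; faithfulness of the universal representation -/

section States

variable {A : Type u} [CStarAlgebra A]

open scoped ComplexStarModule in
/-- The complex-linear functional `x ↦ f(ℜ x) + i f(ℑ x)` attached to a real-linear one. -/
def complexify (f : A →ₗ[ℝ] ℝ) : A →ₗ[ℂ] ℂ where
  toFun x := ⟨f (ℜ x : A), f (ℑ x : A)⟩
  map_add' x y := by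
    apply Complex.ext <;> simp
  map_smul' c x := by
    apply Complex.ext <;> simp [realPart_smul, imaginaryPart_smul]

open scoped ComplexStarModule in
theorem complexify_apply_of_isSelfAdjoint (f : A →ₗ[ℝ] ℝ) {x : A} (hx : IsSelfAdjoint x) :
    complexify f x = f x := by
  apply Complex.ext
  · change f (ℜ x : A) = _
    rw [hx.coe_realPart, Complex.ofReal_re]
  · change f (ℑ x : A) = _
    rw [hx.imaginaryPart, ZeroMemClass.coe_zero, map_zero, Complex.ofReal_im]

variable [PartialOrder A] [StarOrderedRing A]

/-- Hahn–Banach separates `a` from the closed convex cone of positive elements. A functional bounded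
below on a cone is nonnegative on it, so the complexified separator is positive. -/
theorem exists_positive_apply_neg {a : A} (ha : IsSelfAdjoint a) (hn : ¬ 0 ≤ a) :
    ∃ f : A →ₚ[ℂ] ℂ, (f a).re < 0 := by
  have hconv : Convex ℝ {x : A | 0 ≤ x} := by
    intro x hx y hy s t hs ht _
    exact add_nonneg (smul_nonneg hs hx) (smul_nonneg ht hy)
  obtain ⟨f, u, hfa, hf⟩ := geometric_hahn_banach_point_closed hconv
    CStarAlgebra.isClosed_nonneg (x := a) hn
  have hu : u < 0 := by simpa using hf 0 le_rfl
  have hpos : ∀ x : A, 0 ≤ x → 0 ≤ f x := by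
    intro x hx
    by_contra! h
    -- This positive multiple of `x` has `f`-value exactly `u`, contradicting the strict bound `u <
    -- f`.
    have h1 := hf ((u / f x) • x) (smul_nonneg (div_nonneg_of_nonpos hu.le h.le) hx)
    rw [map_smul, smul_eq_mul, div_mul_cancel₀ _ h.ne] at h1
    exact lt_irrefl _ h1
  refine ⟨PositiveLinearMap.mk₀ (complexify f.toLinearMap) fun x hx => ?_, ?_⟩
  · rw [complexify_apply_of_isSelfAdjoint _ (IsSelfAdjoint.of_nonneg hx)]
    exact_mod_cast hpos x hx
  · change (complexify f.toLinearMap a).re < 0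
    rw [complexify_apply_of_isSelfAdjoint _ ha, Complex.ofReal_re]
    exact hfa.trans hu

theorem PositiveLinearMap.apply_eq_zero_of_apply_one (f : A →ₚ[ℂ] ℂ) (h1 : f 1 = 0) {x : A}
    (hx : 0 ≤ x) : f x = 0 := by
  refine le_antisymm ?_ (map_nonneg f hx)
  have h := OrderHomClass.mono f (IsSelfAdjoint.le_algebraMap_norm_self (IsSelfAdjoint.of_nonneg hx))
  rwa [Algebra.algebraMap_eq_smul_one, ← Complex.coe_smul, map_smul, h1, smul_zero] at h

/-- Separating `-x⋆x` from the positive cone gives a positive `f` with `f(x⋆x) > 0`. Since `0 ≤ x⋆x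
≤ ‖x⋆x‖ · 1`, the number `f 1` cannot vanish, and `f / f 1` is a state. -/
theorem exists_state_apply_pos {x : A} (hx : x ≠ 0) :
    ∃ φ : StateSpace A, 0 < (φ.1 (star x * x)).re := by
  have hne : ¬ (0 : A) ≤ -(star x * x) := fun h => hx <|
    CStarRing.star_mul_self_eq_zero_iff x |>.1
      (le_antisymm (neg_nonneg.1 h) (star_mul_self_nonneg x))
  obtain ⟨f, hf⟩ := exists_positive_apply_neg (IsSelfAdjoint.star_mul_self x).neg hne
  rw [map_neg, Complex.neg_re, neg_lt_zero] at hf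
  have hone : 0 ≤ f 1 := map_nonneg f zero_le_one
  have hone' : f 1 ≠ 0 := fun h => by
    rw [PositiveLinearMap.apply_eq_zero_of_apply_one f h (star_mul_self_nonneg x)] at hf
    exact lt_irrefl _ hf
  have hr : ((f 1).re : ℂ) = f 1 := 
    Complex.ext rfl (by rw [Complex.ofReal_im]; exact (Complex.nonneg_iff.1 hone).2)
  have hr0 : 0 < (f 1).re := lt_of_le_of_ne (Complex.nonneg_iff.1 hone).1 fun h => hone' (by
    rw [← hr, ← h, Complex.ofReal_zero])
  have hinv : (0 : ℂ) ≤ (((f 1).re)⁻¹ : ℝ) := by exact_mod_cast (inv_pos.2 hr0).le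
  refine ⟨⟨PositiveLinearMap.mk₀ ((((f 1).re)⁻¹ : ℝ) • f.toLinearMap) fun y hy => ?_, ?_⟩, ?_⟩
  · change 0 ≤ ((((f 1).re)⁻¹ : ℝ)) • f y
    rw [← Complex.coe_smul]
    exact mul_nonneg hinv (map_nonneg f hy)
  · change ((((f 1).re)⁻¹ : ℝ)) • f 1 = 1
    rw [← hr, ← Complex.coe_smul, smul_eq_mul, ← Complex.ofReal_mul, Complex.ofReal_re, inv_mul_cancel₀ hr0.ne', Complex.ofReal_one]
  · change 0 < (((((f 1).re)⁻¹ : ℝ)) • f (star x * x)).re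
    rw [Complex.smul_re]
    exact mul_pos (inv_pos.2 hr0) hf

/-- The vector of the GNS space of `φ` given by `a`. -/
def gnsVector (φ : A →ₚ[ℂ] ℂ) (a : A) : φ.GNS := ((φ.toPreGNS a : φ.PreGNS) : φ.GNS)

theorem gnsStarAlgHom_gnsVector (φ : A →ₚ[ℂ] ℂ) (a b : A) :
    φ.gnsStarAlgHom a (gnsVector φ b) = gnsVector φ (a * b) :=
  φ.gnsNonUnitalStarAlgHom_apply_coe

theorem inner_gnsVector (φ : A →ₚ[ℂ] ℂ) (a b : A) :
    inner ℂ (gnsVector φ a) (gnsVector φ b) = φ (star a * b) :=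
  (UniformSpace.Completion.inner_coe (𝕜 := ℂ) (E := φ.PreGNS) _ _).trans
    (PositiveLinearMap.preGNS_inner_def _ _ _)

/-- On the cyclic vector of a single summand `φ`, the element `x` has squared norm `φ(x⋆x)`, which
is positive for a suitable state. -/
theorem universalRep_injective : Function.Injective (universalRep : A →⋆ₐ[ℂ] _) := by
  rw [injective_iff_map_eq_zero]
  intro x hx
  by_contra hne
  obtain ⟨φ, hφ⟩ := exists_state_apply_pos hne
  classical
  have h1 := universalRep_apply x (lp.single 2 φ (gnsVector φ.1 1)) φ
  rw [hx, lp.single_apply_self, gnsStarAlgHom_gnsVector, mul_one] at h1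
  have h2 := inner_gnsVector φ.1 x x
  rw [← h1] at h2
  change inner ℂ (0 : φ.1.GNS) (0 : φ.1.GNS) = _ at h2
  rw [inner_zero_left] at h2
  rw [← h2] at hφ
  exact lt_irrefl _ hφ

theorem norm_universalRep (x : A) : ‖universalRep x‖ = ‖x‖ :=
  NonUnitalStarAlgHom.norm_map (universalRep : A →⋆ₐ[ℂ] _) universalRep_injective x

end States

/-! ### The minimal and maximal norms -/

section Norms

variable {A B : Type u} [CStarAlgebra A] [CStarAlgebra B]

theorem tensorRep_tmul {A B : Type*} [CStarAlgebra A] [CStarAlgebra B]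
    {H K : Type*} [NormedAddCommGroup H] [InnerProductSpace ℂ H] [CompleteSpace H]
    [NormedAddCommGroup K] [InnerProductSpace ℂ K] [CompleteSpace K]
    (π : A →⋆ₐ[ℂ] (H →L[ℂ] H)) (ρ : B →⋆ₐ[ℂ] (K →L[ℂ] K)) (a : A) (b : B) :
    tensorRep π ρ (a ⊗ₜ b) = tensorOp (π a) (ρ b) := rfl

section TensorOp

variable {H K : Type*} [NormedAddCommGroup H] [InnerProductSpace ℂ H] [CompleteSpace H]
  [NormedAddCommGroup K] [InnerProductSpace ℂ K] [CompleteSpace K]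

theorem tensorOp_mul (T T' : H →L[ℂ] H) (S S' : K →L[ℂ] K) :
    tensorOp T S * tensorOp T' S' = tensorOp (T * T') (S * S') :=
  HilbertTensor.ext_op fun ξ => by
    rw [mul_apply_eq_comp, tensorOp_coe, tensorOp_coe, tensorOp_coe,
      ← LinearMap.comp_apply, ← TensorProduct.map_comp]; rfl

theorem tensorOp_one : tensorOp (1 : H →L[ℂ] H) (1 : K →L[ℂ] K) = 1 :=
  HilbertTensor.ext_op fun ξ => by
    rw [tensorOp_coe]
    exact congrArg _ (LinearMap.congr_fun (TensorProduct.map_id (R := ℂ) (M := H) (N := K)) ξ)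

theorem star_tensorOp (T : H →L[ℂ] H) (S : K →L[ℂ] K) :
    star (tensorOp T S) = tensorOp (star T) (star S) := by
  symm
  rw [ContinuousLinearMap.star_eq_adjoint (tensorOp T S), ContinuousLinearMap.eq_adjoint_iff]
  intro x y
  induction x, y using UniformSpace.Completion.induction_on₂ with
  | hp => apply isClosed_eq <;> fun_prop
  | ih x y =>
    rw [tensorOp_coe, tensorOp_coe, UniformSpace.Completion.inner_coe,
      UniformSpace.Completion.inner_coe, inner_tensorMap, star_star, star_star]

end TensorOp

theorem tensorRep_star {H K : Type*} [NormedAddCommGroup H] [InnerProductSpace ℂ H]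
    [CompleteSpace H] [NormedAddCommGroup K] [InnerProductSpace ℂ K] [CompleteSpace K]
    (π : A →⋆ₐ[ℂ] (H →L[ℂ] H)) (ρ : B →⋆ₐ[ℂ] (K →L[ℂ] K)) (x : A ⊗[ℂ] B) :
    tensorRep π ρ (star x) = star (tensorRep π ρ x) := by
  rw [ContinuousLinearMap.star_eq_adjoint]
  induction x using TensorProduct.induction_on with
  | zero => rw [star_zero, map_zero, map_zero]
  | add x y hx hy => rw [star_add, map_add, map_add, map_add, hx, hy]
  | tmul a b =>
    rw [TensorProduct.star_tmul, tensorRep_tmul, tensorRep_tmul, map_star, map_star,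
      ← star_tensorOp, ContinuousLinearMap.star_eq_adjoint]

/-- `π ⊗ ρ` as a ⋆-homomorphism. -/
def tensorStarHom {H K : Type*} [NormedAddCommGroup H] [InnerProductSpace ℂ H] [CompleteSpace H]
    [NormedAddCommGroup K] [InnerProductSpace ℂ K] [CompleteSpace K]
    (π : A →⋆ₐ[ℂ] (H →L[ℂ] H)) (ρ : B →⋆ₐ[ℂ] (K →L[ℂ] K)) :
    A ⊗[ℂ] B →⋆ₐ[ℂ] (HilbertTensor H K →L[ℂ] HilbertTensor H K) :=
  { Algebra.TensorProduct.algHomOfLinearMapTensorProduct (tensorRep π ρ)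
      (fun a a' b b' => by
        rw [tensorRep_tmul, tensorRep_tmul, tensorRep_tmul, tensorOp_mul, map_mul, map_mul])
      (by rw [tensorRep_tmul, map_one, map_one, tensorOp_one]) with
    map_star' := tensorRep_star π ρ }

theorem tensorStarHom_apply {H K : Type*} [NormedAddCommGroup H] [InnerProductSpace ℂ H]
    [CompleteSpace H] [NormedAddCommGroup K] [InnerProductSpace ℂ K] [CompleteSpace K]
    (π : A →⋆ₐ[ℂ] (H →L[ℂ] H)) (ρ : B →⋆ₐ[ℂ] (K →L[ℂ] K)) (x : A ⊗[ℂ] B) :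
    tensorStarHom π ρ x = tensorRep π ρ x := rfl

/-- The ⋆-homomorphism `a ⊗ b ↦ π(a) ρ(b)` defined by ⋆-homomorphisms with commuting ranges. -/
def commStarHom {D : Type*} [CStarAlgebra D] (π : A →⋆ₐ[ℂ] D) (ρ : B →⋆ₐ[ℂ] D)
    (h : ∀ a b, Commute (π a) (ρ b)) : A ⊗[ℂ] B →⋆ₐ[ℂ] D :=
  { Algebra.TensorProduct.lift (π : A →ₐ[ℂ] D) (ρ : B →ₐ[ℂ] D) h with
    map_star' := fun x => by
      change Algebra.TensorProduct.lift (π : A →ₐ[ℂ] D) (ρ : B →ₐ[ℂ] D) h (star x)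
        = star (Algebra.TensorProduct.lift (π : A →ₐ[ℂ] D) (ρ : B →ₐ[ℂ] D) h x)
      induction x using TensorProduct.induction_on with
      | zero => rw [star_zero, map_zero, star_zero]
      | add x y hx hy => rw [star_add, map_add, map_add, star_add, hx, hy]
      | tmul a b =>
        rw [TensorProduct.star_tmul, Algebra.TensorProduct.lift_tmul,
          Algebra.TensorProduct.lift_tmul, star_mul]
        change π (star a) * ρ (star b) = star (ρ b) * star (π a)
        rw [(h _ _).eq, map_star, map_star] }

/-- Representations of `A ⊙ B` are uniformly bounded at each element. -/
theorem exists_norm_starHom_le (x : A ⊗[ℂ] B) :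
    ∃ C : ℝ, ∀ (D : Type u) [CStarAlgebra D] (π : A ⊗[ℂ] B →⋆ₐ[ℂ] D), ‖π x‖ ≤ C := by
  induction x using TensorProduct.induction_on with
  | zero => exact ⟨0, fun D _ π => by rw [map_zero, norm_zero]⟩
  | add x y hx hy =>
    obtain ⟨c, hc⟩ := hx
    obtain ⟨d, hd⟩ := hy
    exact ⟨c + d, fun D _ π => by
      rw [map_add]; exact (norm_add_le _ _).trans (add_le_add (hc D π) (hd D π))⟩
  | tmul a b =>
    refine ⟨‖a‖ * ‖b‖, fun D _ π => ?_⟩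
    -- The restriction of `π` to each tensor factor is a ⋆-homomorphism of C⋆-algebras, hence
    -- contractive; the bound `‖a‖ ‖b‖` therefore does not depend on the target.
    have e : a ⊗ₜ[ℂ] b = (a ⊗ₜ[ℂ] (1 : B)) * ((1 : A) ⊗ₜ[ℂ] b) := by
      rw [Algebra.TensorProduct.tmul_mul_tmul, mul_one, one_mul]
    rw [e, map_mul]
    let πA : A →⋆ₐ[ℂ] D :=
      { (π : A ⊗[ℂ] B →ₐ[ℂ] D).comp Algebra.TensorProduct.includeLeft with
        map_star' := fun a => by
          change π (star a ⊗ₜ[ℂ] (1 : B)) = star (π (a ⊗ₜ[ℂ] (1 : B)))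
          rw [← map_star, TensorProduct.star_tmul, star_one] }
    let πB : B →⋆ₐ[ℂ] D :=
      { (π : A ⊗[ℂ] B →ₐ[ℂ] D).comp Algebra.TensorProduct.includeRight with
        map_star' := fun b => by
          change π ((1 : A) ⊗ₜ[ℂ] star b) = star (π ((1 : A) ⊗ₜ[ℂ] b))
          rw [← map_star, TensorProduct.star_tmul, star_one] }
    exact (norm_mul_le _ _).trans (mul_le_mul (NonUnitalStarAlgHom.norm_apply_le πA a)
      (NonUnitalStarAlgHom.norm_apply_le πB b) (norm_nonneg _) (norm_nonneg _))

theorem norm_le_maxNorm_of_hilbert {H : Type u} [NormedAddCommGroup H] [InnerProductSpace ℂ H]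
    [CompleteSpace H] (π : A ⊗[ℂ] B →⋆ₐ[ℂ] (H →L[ℂ] H)) (x : A ⊗[ℂ] B) : ‖π x‖ ≤ maxNorm x := by
  obtain ⟨C, hC⟩ := exists_norm_starHom_le x
  refine le_csSup ⟨C, ?_⟩ ⟨H, _, _, _, π, rfl⟩
  rintro _ ⟨H, _, _, _, π, rfl⟩
  exact hC _ π

/-- The maximal norm only ranges over operators on Hilbert spaces; an abstract target is reached
through its isometric universal representation. -/
theorem norm_le_maxNorm {D : Type u} [CStarAlgebra D] (π : A ⊗[ℂ] B →⋆ₐ[ℂ] D) (x : A ⊗[ℂ] B) :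
    ‖π x‖ ≤ maxNorm x := by
  let _ : PartialOrder D := CStarAlgebra.spectralOrder D
  have : StarOrderedRing D := CStarAlgebra.spectralOrderedRing D
  rw [← norm_universalRep (π x)]
  exact norm_le_maxNorm_of_hilbert ((universalRep : D →⋆ₐ[ℂ] _).comp π) x

theorem norm_tensorRep_le_maxNorm {H K : Type u} [NormedAddCommGroup H] [InnerProductSpace ℂ H]
    [CompleteSpace H] [NormedAddCommGroup K] [InnerProductSpace ℂ K] [CompleteSpace K]
    (π : A →⋆ₐ[ℂ] (H →L[ℂ] H)) (ρ : B →⋆ₐ[ℂ] (K →L[ℂ] K)) (x : A ⊗[ℂ] B) :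
    ‖tensorRep π ρ x‖ ≤ maxNorm x :=
  norm_le_maxNorm_of_hilbert (tensorStarHom π ρ) x

theorem norm_tensorRep_le_minNorm {H K : Type u} [NormedAddCommGroup H] [InnerProductSpace ℂ H]
    [CompleteSpace H] [NormedAddCommGroup K] [InnerProductSpace ℂ K] [CompleteSpace K]
    (π : A →⋆ₐ[ℂ] (H →L[ℂ] H)) (ρ : B →⋆ₐ[ℂ] (K →L[ℂ] K)) (x : A ⊗[ℂ] B) :
    ‖tensorRep π ρ x‖ ≤ minNorm x := by
  refine le_csSup ⟨maxNorm x, ?_⟩ ⟨H, _, _, _, K, _, _, _, π, ρ, rfl⟩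
  rintro _ ⟨H, _, _, _, K, _, _, _, π, ρ, rfl⟩
  exact norm_tensorRep_le_maxNorm π ρ x

theorem minNorm_nonneg (x : A ⊗[ℂ] B) : 0 ≤ minNorm x := by
  refine Real.sSup_nonneg ?_
  rintro _ ⟨H, _, _, _, K, _, _, _, π, ρ, rfl⟩
  exact norm_nonneg (tensorRep π ρ x)

theorem minNorm_le {x : A ⊗[ℂ] B} {C : ℝ} (hC : 0 ≤ C)
    (h : ∀ (H : Type u) [NormedAddCommGroup H] [InnerProductSpace ℂ H] [CompleteSpace H]
      (K : Type u) [NormedAddCommGroup K] [InnerProductSpace ℂ K] [CompleteSpace K]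
      (π : A →⋆ₐ[ℂ] (H →L[ℂ] H)) (ρ : B →⋆ₐ[ℂ] (K →L[ℂ] K)), ‖tensorRep π ρ x‖ ≤ C) :
    minNorm x ≤ C := by
  refine Real.sSup_le ?_ hC
  rintro _ ⟨H, _, _, _, K, _, _, _, π, ρ, rfl⟩
  exact h H K π ρ

theorem maxNorm_nonneg (x : A ⊗[ℂ] B) : 0 ≤ maxNorm x := by
  refine Real.sSup_nonneg ?_
  rintro _ ⟨H, _, _, _, π, rfl⟩
  exact norm_nonneg (π x)

theorem maxNorm_le {x : A ⊗[ℂ] B} {C : ℝ} (hC : 0 ≤ C)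
    (h : ∀ (H : Type u) [NormedAddCommGroup H] [InnerProductSpace ℂ H] [CompleteSpace H]
      (π : A ⊗[ℂ] B →⋆ₐ[ℂ] (H →L[ℂ] H)), ‖π x‖ ≤ C) :
    maxNorm x ≤ C := by
  refine Real.sSup_le ?_ hC
  rintro _ ⟨H, _, _, _, π, rfl⟩
  exact h H π

theorem minNorm_le_maxNorm (x : A ⊗[ℂ] B) : minNorm x ≤ maxNorm x :=
  minNorm_le (maxNorm_nonneg x) fun H _ _ _ K _ _ _ π ρ =>
    norm_tensorRep_le_maxNorm π ρ x

end Norms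

/-! ### Positive operator valued measures in C⋆-algebras -/

/-- A POVM with `n` outcomes in a unital C⋆-algebra. -/
structure IsCStarPOVM {n : ℕ} {A : Type*} [CStarAlgebra A] [PartialOrder A] (P : Fin n → A) :
    Prop where
  nonneg : ∀ a, 0 ≤ P a
  sum_eq_one : ∑ a, P a = 1

theorem isPOVM_iff {n : ℕ} {H : Type*} [NormedAddCommGroup H] [InnerProductSpace ℂ H]
    [CompleteSpace H] {P : Fin n → H →L[ℂ] H} : IsPOVM P ↔ IsCStarPOVM P :=
  ⟨fun h => ⟨fun a => (ContinuousLinearMap.nonneg_iff_isPositive _).2 (h.1 a), h.2⟩,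
    fun h => ⟨fun a => (ContinuousLinearMap.nonneg_iff_isPositive _).1 (h.1 a), h.2⟩⟩

theorem IsCStarPOVM.map {n : ℕ} {A B : Type*} [CStarAlgebra A] [PartialOrder A] [StarOrderedRing A]
    [CStarAlgebra B] [PartialOrder B] [StarOrderedRing B] {P : Fin n → A} (hP : IsCStarPOVM P)
    (q : A →⋆ₐ[ℂ] B) : IsCStarPOVM fun a => q (P a) :=
  ⟨fun a => map_nonneg q (hP.1 a), by rw [← map_sum, hP.2, map_one]⟩

theorem IsCStarPOVM.le_one {n : ℕ} {A : Type*} [CStarAlgebra A] [PartialOrder A]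
    [StarOrderedRing A] {P : Fin n → A} (hP : IsCStarPOVM P) (a : Fin n) : P a ≤ 1 := by
  rw [← hP.2]
  exact Finset.single_le_sum (fun b _ => hP.1 b) (Finset.mem_univ a)

theorem IsCStarPOVM.norm_le_one {n : ℕ} {A : Type*} [CStarAlgebra A] [PartialOrder A]
    [StarOrderedRing A] {P : Fin n → A} (hP : IsCStarPOVM P) (a : Fin n) : ‖P a‖ ≤ 1 :=
  (CStarAlgebra.norm_le_one_iff_of_nonneg (P a) (hP.1 a)).2 (hP.le_one a)

theorem continuous_starAlgHom {A B : Type*} [CStarAlgebra A] [CStarAlgebra B] (φ : A →⋆ₐ[ℂ] B) :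
    Continuous φ :=
  AddMonoidHomClass.continuous_of_bound φ 1 fun x => by
    rw [one_mul]; exact NonUnitalStarAlgHom.norm_apply_le φ x

/-- The positive part of the real part of `h` serves all `q` at once: functional calculus commutes
with ⋆-homomorphisms, and taking the positive part leaves a positive image unchanged. This
independence of `q` is used later, when one family must serve every representation. -/
theorem exists_nonneg_lift {B : Type u} [CStarAlgebra B] [PartialOrder B] [StarOrderedRing B]
    (h : B) : ∃ p : B, 0 ≤ p ∧ ∀ (A : Type v) [CStarAlgebra A] [PartialOrder A]
      [StarOrderedRing A] (q : B →⋆ₐ[ℂ] A), 0 ≤ q h → q p = q h := by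
  have hsb : IsSelfAdjoint ((1 / 2 : ℝ) • (h + star h)) :=
    IsSelfAdjoint.smul (IsSelfAdjoint.all (1 / 2 : ℝ)) (IsSelfAdjoint.add_star_self h)
  refine ⟨cfc (fun x : ℝ => max x 0) ((1 / 2 : ℝ) • (h + star h)),
    cfc_nonneg fun x _ => le_max_right _ _, ?_⟩
  intro A _ _ _ q hq
  have hsa : IsSelfAdjoint (q h) := .of_nonneg hq
  have e : q ((1 / 2 : ℝ) • (h + star h)) = q h := by
    rw [← Complex.coe_smul, map_smul, map_add, map_star, hsa.star_eq, ← two_smul ℂ (q h),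
      smul_smul]
    norm_num
  rw [StarAlgHomClass.map_cfc (S := ℂ) q (fun x : ℝ => max x 0) ((1 / 2 : ℝ) • (h + star h))
    (by fun_prop) (continuous_starAlgHom q) hsb (by rw [e]; exact hsa), e]
  conv_rhs => rw [← cfc_id' ℝ (q h)]
  exact cfc_congr fun x hx => max_eq_left (spectrum_nonneg_of_nonneg hq hx)

/-- A substitute for `S^{-1/2}` when `S` need not be invertible: `f(x) = max(x, 1)^{-1/2}` is
continuous with `x f(x)² ≤ 1`, and `f(1) = 1` makes `F = f(S)` invisible to every `q` with `q S =
1`. -/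
theorem exists_conjugate_le_one {B : Type u} [CStarAlgebra B] [PartialOrder B] [StarOrderedRing B]
    {S : B} (hS : 0 ≤ S) : ∃ F : B, IsSelfAdjoint F ∧ F * S * F ≤ 1 ∧
      ∀ (A : Type v) [CStarAlgebra A] (q : B →⋆ₐ[ℂ] A), q S = 1 → q F = 1 := by
  have hSs : IsSelfAdjoint S := .of_nonneg hS
  obtain ⟨f, hf, hf1, hf2⟩ : ∃ f : ℝ → ℝ, Continuous f ∧ f 1 = 1 ∧ ∀ x, f x * x * f x ≤ 1 := by
    have hpos : ∀ x : ℝ, 0 < Real.sqrt (max x 1) := fun x =>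
      Real.sqrt_pos.2 (lt_max_of_lt_right one_pos)
    refine ⟨fun x => (Real.sqrt (max x 1))⁻¹, Continuous.inv₀ (by fun_prop) fun x => (hpos x).ne',
      by simp, fun x => ?_⟩
    have h2 := Real.mul_self_sqrt (zero_le_one.trans (le_max_right x 1))
    rw [mul_right_comm, ← mul_inv, h2, inv_mul_eq_div, div_le_one (lt_max_of_lt_right one_pos)]
    exact le_max_left _ _
  refine ⟨cfc f S, cfc_predicate f S, ?_, ?_⟩
  · have e : cfc f S * S * cfc f S = cfc (fun x => f x * x * f x) S := by
      rw [cfc_mul (fun x => f x * x) f S (hf.mul continuous_id).continuousOn hf.continuousOn,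
        cfc_mul f (fun x => x) S hf.continuousOn continuous_id.continuousOn, cfc_id' ℝ S]
    rw [e]
    exact cfc_le_one _ _ fun x _ => hf2 x
  · intro A _ q hq
    rw [StarAlgHomClass.map_cfc (S := ℂ) q f S hf.continuousOn (continuous_starAlgHom q) hSs
      (by rw [hq]; exact .one A), hq, cfc_apply_one, hf1, map_one]

/-- Every family `h` of `n` elements of a C⋆-algebra can be corrected to a POVM `P` such that
`q ∘ P = q ∘ h` for every ⋆-homomorphism `q` for which `q ∘ h` is a POVM. -/
theorem exists_povm_lift {n : ℕ} [NeZero n] {B : Type u} [CStarAlgebra B] [PartialOrder B]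
    [StarOrderedRing B] (h : Fin n → B) :
    ∃ P : Fin n → B, IsCStarPOVM P ∧ ∀ (A : Type v) [CStarAlgebra A] [PartialOrder A]
      [StarOrderedRing A] (q : B →⋆ₐ[ℂ] A), IsCStarPOVM (fun a => q (h a)) →
        ∀ a, q (P a) = q (h a) := by
  choose p hp hpq using fun a => exists_nonneg_lift.{u, v} (h a)
  obtain ⟨F, hF, hF1, hFq⟩ := exists_conjugate_le_one.{u, v}
    (S := ∑ a, p a) (Finset.sum_nonneg fun a _ => hp a)
  have hsum : ∑ a, F * p a * F ≤ 1 := by rwa [← Finset.sum_mul, ← Finset.mul_sum]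
  -- The positive defect of the sum is added to outcome `0`; this is where `n ≠ 0` enters. Any
  -- admissible `q` sends the defect to `0`.
  refine ⟨fun a => F * p a * F + if a = 0 then 1 - ∑ b, F * p b * F else 0, ⟨fun a => ?_, ?_⟩, ?_⟩
  · refine add_nonneg (hF.conjugate_nonneg (hp a)) ?_
    split_ifs
    · exact sub_nonneg.2 hsum
    · exact le_rfl
  · rw [Finset.sum_add_distrib, Finset.sum_ite_eq' Finset.univ (0 : Fin n),
      if_pos (Finset.mem_univ _), add_sub_cancel]
  · intro A _ _ _ q hq a
    have hqp : ∀ a, q (p a) = q (h a) := fun a => hpq a A q (hq.1 a)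
    have hqF : q F = 1 := hFq A q (by
      rw [map_sum, ← hq.2]; exact Finset.sum_congr rfl fun a _ => hqp a)
    have hqQ : ∀ a, q (F * p a * F) = q (h a) := fun a => by
      rw [map_mul, map_mul, hqF, one_mul, mul_one, hqp]
    have h0 : q (1 - ∑ b, F * p b * F) = 0 := by
      rw [map_sub, map_one, map_sum, Finset.sum_congr rfl fun b _ => hqQ b, hq.2, sub_self]
    rw [map_add, hqQ]
    split_ifs
    · rw [h0, add_zero]
    · rw [map_zero, add_zero]

/-! ### Homomorphisms out of group C⋆-algebras -/

namespace GroupCStar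

variable {G : Type u} [Group G]

/-- The span of the canonical unitaries is dense. -/
theorem induction_of {P : GroupCStar G → Prop} (hp : IsClosed {x | P x})
    (hadd : ∀ x y, P x → P y → P (x + y)) (hsmul : ∀ (c : ℂ) x, P x → P (c • x))
    (hof : ∀ g, P (of g)) (x : GroupCStar G) : P x := by
  refine induction_on x hp fun y => ?_
  refine GroupAlg.induction (P := fun y => P (coe y)) y ?_ ?_ ?_
  · have h := hsmul 0 _ (hof 1)
    rw [zero_smul] at h
    have e : coe (0 : GroupAlg G) = 0 := by
      have := coe_smul (0 : ℂ) (0 : GroupAlg G)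
      rwa [zero_smul, zero_smul] at this
    rwa [e]
  · intro x y hx hy
    rw [coe_add]; exact hadd _ _ hx hy
  · intro g c
    have e : GroupAlg.single g c = c • GroupAlg.single g 1 := by
      rw [GroupAlg.smul_single, mul_one]
    rw [e, coe_smul]; exact hsmul _ _ (hof g)

theorem continuous_hom {A : Type*} [CStarAlgebra A] (φ : GroupCStar G →⋆ₐ[ℂ] A) :
    Continuous φ :=
  continuous_starAlgHom φ

theorem hom_ext {A : Type*} [CStarAlgebra A] {φ ψ : GroupCStar G →⋆ₐ[ℂ] A}
    (h : ∀ g, φ (of g) = ψ (of g)) : φ = ψ := by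
  ext x
  refine induction_of (isClosed_eq (continuous_hom φ) (continuous_hom ψ)) ?_ ?_ h x
  · intro x y hx hy
    rw [map_add, map_add, hx, hy]
  · intro c x hx
    rw [map_smul, map_smul, hx]

theorem map_of {H : Type u} [Group H] (f : G →* H) (g : G) : map f (of g) = of (f g) :=
  lift_of _ g

theorem lift_map {H : Type u} [Group H] (f : G →* H) {A : Type u} [CStarAlgebra A]
    (π : H →* unitary A) (x : GroupCStar G) : lift π (map f x) = lift (π.comp f) x := by
  have : (lift π).comp (map f) = lift (π.comp f) :=
    hom_ext fun g => by
      rw [StarAlgHom.comp_apply, map_of, lift_of, lift_of]; rfl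
  exact DFunLike.congr_fun this x

theorem commute_lift {A : Type u} [CStarAlgebra A] {π : G →* unitary A} {c : A}
    (h : ∀ g, Commute c (π g : A)) (x : GroupCStar G) : Commute c (lift π x) := by
  refine induction_of (P := fun x => Commute c (lift π x)) ?_ ?_ ?_ ?_ x
  · exact isClosed_eq (continuous_const.mul (continuous_hom (lift π)))
      ((continuous_hom (lift π)).mul continuous_const)
  · intro x y hx hy
    rw [map_add]; exact hx.add_right hy
  · intro c x hx
    rw [map_smul]; exact hx.smul_right c
  · intro g
    rw [lift_of]; exact h g

end GroupCStar

/-! ### Matrices over a C⋆-algebra -/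

section Matrices

variable {m : Type*} [Fintype m] [DecidableEq m]
variable {A : Type*} [CStarAlgebra A] [PartialOrder A] [StarOrderedRing A]

variable (m A) in
/-- The diagonal embedding of `A` in the matrices over `A`. -/
def diagHom : A →⋆ₐ[ℂ] CStarMatrix m m A where
  toFun c := CStarMatrix.ofMatrix (Matrix.diagonal fun _ => c)
  map_one' := by ext i j; rw [CStarMatrix.one_apply]; rfl
  map_zero' := by ext i j; simp
  map_mul' a b := by
    ext i j
    simp [Matrix.diagonal_apply, CStarMatrix.mul_apply]
  map_add' a b := by
    ext i j
    by_cases h : i = j <;> simp [h]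
  commutes' c := by ext i j; simp [Matrix.diagonal_apply, CStarMatrix.algebraMap_apply]
  map_star' a := by
    ext i j
    by_cases h : i = j
    · subst h; simp [CStarMatrix.star_apply]
    · simp [CStarMatrix.star_apply, h, Ne.symm h]

theorem diagHom_apply (c : A) (i j : m) : diagHom m A c i j = if i = j then c else 0 := rfl

theorem commute_diagHom_iff {c : A} {M : CStarMatrix m m A} :
    Commute (diagHom m A c) M ↔ ∀ i j, Commute c (M i j) := by
  rw [Commute, SemiconjBy, ← CStarMatrix.ext_iff]
  refine forall₂_congr fun i j => ?_
  rw [CStarMatrix.mul_apply, CStarMatrix.mul_apply, Finset.sum_eq_single i, Finset.sum_eq_single j,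
    diagHom_apply, diagHom_apply, if_pos rfl, if_pos rfl]
  · rfl
  · intro l _ hl
    rw [diagHom_apply, if_neg hl, mul_zero]
  · simp
  · intro l _ hl
    rw [diagHom_apply, if_neg hl.symm, zero_mul]
  · simp

theorem diagHom_mul_apply (c : A) (M : CStarMatrix m m A) (i j : m) :
    (diagHom m A c * M) i j = c * M i j := by
  rw [CStarMatrix.mul_apply, Finset.sum_eq_single i, diagHom_apply, if_pos rfl]
  · intro l _ hl
    rw [diagHom_apply, if_neg hl.symm, zero_mul]
  · simp

theorem mul_diagHom_apply (c : A) (M : CStarMatrix m m A) (i j : m) :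
    (M * diagHom m A c) i j = M i j * c := by
  rw [CStarMatrix.mul_apply, Finset.sum_eq_single j, diagHom_apply, if_pos rfl]
  · intro l _ hl
    rw [diagHom_apply, if_neg hl, mul_zero]
  · simp

/-- If a corner of a unitary matrix is an isometry then the rest of its column vanishes. -/
theorem CStarMatrix.apply_eq_zero_of_corner {M : CStarMatrix m m A} (hM : star M * M = 1) {o : m}
    (ho : star (M o o) * M o o = 1) {i : m} (hi : i ≠ o) : M i o = 0 := by
  have h := congrFun (congrFun hM o) o
  rw [CStarMatrix.mul_apply, CStarMatrix.one_apply_eq,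
    ← Finset.add_sum_erase _ _ (Finset.mem_univ o), CStarMatrix.star_apply, ho,
    add_eq_left] at h
  have h' := (Finset.sum_eq_zero_iff_of_nonneg fun j _ => ?_).1 h i
    (Finset.mem_erase.2 ⟨hi, Finset.mem_univ i⟩)
  · rw [CStarMatrix.star_apply] at h'
    exact (CStarRing.star_mul_self_eq_zero_iff _).1 h'
  · rw [CStarMatrix.star_apply]
    exact star_mul_self_nonneg _

end Matrices

/-- If the `(o, o)` corners of a unitary representation by matrices agree on generators with a
unitary representation, then the `(o, o)` corner is a ⋆-homomorphism. -/
theorem lift_corner_eq {G : Type u} [Group G] {m : Type u} [Fintype m] [DecidableEq m]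
    {A : Type u} [CStarAlgebra A] [PartialOrder A] [StarOrderedRing A]
    (θ : G →* unitary (CStarMatrix m m A)) (π : G →* unitary A) (o : m) (S : Set G)
    (hS : Subgroup.closure S = ⊤)
    (h : ∀ g ∈ S, (θ g : CStarMatrix m m A) o o = π g) (z : GroupCStar G) :
    GroupCStar.lift θ z o o = GroupCStar.lift π z := by
  have hall : ∀ g, (θ g : CStarMatrix m m A) o o = π g := by
    intro g
    have hg : g ∈ Subgroup.closure S := hS ▸ Subgroup.mem_top g
    induction hg using Subgroup.closure_induction with
    | mem g hg => exact h g hg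
    | one => rw [map_one, map_one]; exact CStarMatrix.one_apply_eq o
    | inv g _ hg =>
      rw [map_inv, map_inv, ← Unitary.star_eq_inv, ← Unitary.star_eq_inv, Unitary.coe_star,
        Unitary.coe_star, CStarMatrix.star_apply, hg]
    -- Only the index `o` contributes to this entry of the product, since the rest of column `o` of
    -- `θ g'` vanishes. This is the multiplicative domain argument in matrix form.
    | mul g g' _ _ hg hg' =>
      rw [map_mul, map_mul, Submonoid.coe_mul, Submonoid.coe_mul, CStarMatrix.mul_apply,
        Finset.sum_eq_single o, hg, hg']
      · intro i _ hi
        rw [CStarMatrix.apply_eq_zero_of_corner (Unitary.coe_star_mul_self (θ g'))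
          (by rw [hg']; exact Unitary.coe_star_mul_self (π g')) hi, mul_zero]
      · simp
  refine GroupCStar.induction_of (P := fun z => GroupCStar.lift θ z o o = GroupCStar.lift π z)
    ?_ ?_ ?_ ?_ z
  · refine isClosed_eq ?_ (GroupCStar.continuous_hom _)
    have h1 : Continuous fun M : CStarMatrix m m A => M o o :=
      (continuous_apply_apply o o).comp (CStarMatrix.ofMatrixL (m := m) (n := m) (A := A)).symm.continuous
    exact h1.comp (GroupCStar.continuous_hom (GroupCStar.lift θ))
  · intro x y hx hy
    rw [map_add, map_add, CStarMatrix.add_apply, hx, hy]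
  · intro c x hx
    rw [map_smul, map_smul, CStarMatrix.smul_apply, hx]
  · intro g
    rw [GroupCStar.lift_of, GroupCStar.lift_of, hall]

/-! ### Projection valued measures and unitaries of order `n` -/

section Fourier

variable {n : ℕ} [NeZero n]

theorem sum_stdAddChar_mul (c : ZMod n) :
    ∑ z : ZMod n, ZMod.stdAddChar (z * c) = if c = 0 then (n : ℂ) else 0 := by
  have h := AddChar.sum_mulShift (R' := ℂ) c (ZMod.isPrimitive_stdAddChar n)
  rwa [ZMod.card, Nat.cast_ite, Nat.cast_zero] at h

theorem sum_stdAddChar_mul_finEquiv (z : ZMod n) :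
    ∑ a : Fin n, ZMod.stdAddChar (z * ZMod.finEquiv n a) = if z = 0 then (n : ℂ) else 0 := by
  rw [← sum_stdAddChar_mul]
  refine (Equiv.sum_comp (ZMod.finEquiv n).toEquiv fun c => ZMod.stdAddChar (z * c)).trans ?_
  exact Finset.sum_congr rfl fun c _ => by rw [mul_comm]

variable {D : Type*} [CStarAlgebra D]

/-- The spectral projections of a unitary representation of `ℤ_n`. -/
def specProj (w : Multiplicative (ZMod n) →* unitary D) (a : Fin n) : D :=
  (n : ℂ)⁻¹ • ∑ z : ZMod n,
    ZMod.stdAddChar (-(z * ZMod.finEquiv n a)) • (w (Multiplicative.ofAdd z) : D)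

/-- Fourier inversion on `ℤ_n`. The case `z = 0` says that the spectral projections sum to `1`. -/
theorem sum_smul_specProj (w : Multiplicative (ZMod n) →* unitary D) (z : ZMod n) :
    ∑ a, ZMod.stdAddChar (z * ZMod.finEquiv n a) • specProj w a
      = (w (Multiplicative.ofAdd z) : D) := by
  have hn : (n : ℂ) ≠ 0 := NeZero.ne _
  have e : ∀ a, ZMod.stdAddChar (z * ZMod.finEquiv n a) • specProj w a
      = (n : ℂ)⁻¹ • ∑ z' : ZMod n, ZMod.stdAddChar ((z - z') * ZMod.finEquiv n a) •
          (w (Multiplicative.ofAdd z') : D) := fun a => by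
    rw [specProj, smul_comm, Finset.smul_sum]
    refine congrArg _ (Finset.sum_congr rfl fun z' _ => ?_)
    rw [smul_smul, ← AddChar.map_add_eq_mul, sub_mul, sub_eq_add_neg]
  rw [Finset.sum_congr rfl fun a _ => e a, ← Finset.smul_sum, Finset.sum_comm]
  simp_rw [← Finset.sum_smul, sum_stdAddChar_mul_finEquiv]
  rw [Finset.sum_eq_single z, if_pos (sub_self z), smul_smul, inv_mul_cancel₀ hn, one_smul]
  · intro z' _ h
    rw [if_neg (sub_ne_zero.2 h.symm), zero_smul]
  · simp

/-- Translating the summation index by `z` shows that `specProj w a` maps into the eigenspace of the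
`a`-th character; idempotence follows. -/
theorem mul_specProj (w : Multiplicative (ZMod n) →* unitary D) (z : ZMod n) (a : Fin n) :
    (w (Multiplicative.ofAdd z) : D) * specProj w a
      = ZMod.stdAddChar (z * ZMod.finEquiv n a) • specProj w a := by
  rw [specProj, mul_smul_comm, smul_comm (ZMod.stdAddChar _), Finset.mul_sum,
    Finset.smul_sum (r := ZMod.stdAddChar (z * ZMod.finEquiv n a))]
  refine congrArg (fun d : D => (n : ℂ)⁻¹ • d)
    (Fintype.sum_equiv (Equiv.addLeft z) _ _ fun z' => ?_)
  rw [mul_smul_comm, ← Submonoid.coe_mul, ← map_mul, ← ofAdd_add, Equiv.coe_addLeft, smul_smul,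
    ← AddChar.map_add_eq_mul, add_mul, neg_add, add_neg_cancel_left]

theorem star_specProj (w : Multiplicative (ZMod n) →* unitary D) (a : Fin n) :
    star (specProj w a) = specProj w a := by
  rw [specProj, star_smul, star_sum, star_inv₀, star_natCast]
  refine congrArg _ (Fintype.sum_equiv (Equiv.neg _) _ _ fun z => ?_)
  rw [star_smul, Equiv.neg_apply, ofAdd_neg, map_inv, ← Unitary.star_eq_inv, Unitary.coe_star,
    neg_mul, AddChar.map_neg_eq_conj _ (-_)]
  rfl

theorem specProj_mul_self (w : Multiplicative (ZMod n) →* unitary D) (a : Fin n) :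
    specProj w a * specProj w a = specProj w a := by
  have hn : (n : ℂ) ≠ 0 := NeZero.ne _
  nth_rw 1 [specProj]
  rw [smul_mul_assoc, Finset.sum_mul]
  simp_rw [smul_mul_assoc, mul_specProj, smul_smul, ← AddChar.map_add_eq_mul, neg_add_cancel,
    AddChar.map_zero_eq_one, one_smul]
  rw [Finset.sum_const, Finset.card_univ, ZMod.card, ← Nat.cast_smul_eq_nsmul ℂ, smul_smul,
    inv_mul_cancel₀ hn, one_smul]

theorem isCStarPOVM_specProj [PartialOrder D] [StarOrderedRing D]
    (w : Multiplicative (ZMod n) →* unitary D) : IsCStarPOVM (specProj w) where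
  nonneg a := by
    rw [← specProj_mul_self]
    nth_rw 1 [← star_specProj]
    exact star_mul_self_nonneg _
  sum_eq_one := by
    have h := sum_smul_specProj w 0
    simpa using h

/-- A projection valued measure with `n` outcomes. -/
structure IsPVM (E : Fin n → D) : Prop where
  star_eq : ∀ a, star (E a) = E a
  mul_eq : ∀ a b, E a * E b = if a = b then E a else 0
  sum_eq_one : ∑ a, E a = 1

/-- The unitary representation of `ℤ_n` with given spectral projections. -/
def IsPVM.unitaryHom {E : Fin n → D} (hE : IsPVM E) : Multiplicative (ZMod n) →* unitary D :=
  let W : ZMod n → D := fun z => ∑ a, ZMod.stdAddChar (z * ZMod.finEquiv n a) • E a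
  have hW0 : W 0 = 1 := by simp [W, hE.sum_eq_one]
  have hmul : ∀ z z', W z * W z' = W (z + z') := fun z z' => by
    simp only [W, Finset.sum_mul_sum, smul_mul_smul_comm, hE.mul_eq, smul_ite, smul_zero,
      Finset.sum_ite_eq, Finset.mem_univ, if_true, add_mul, AddChar.map_add_eq_mul]
  have hstar : ∀ z, star (W z) = W (-z) := fun z => by
    simp only [W, star_sum, star_smul, hE.star_eq, neg_mul, AddChar.map_neg_eq_conj]
    rfl
  { toFun := fun z => ⟨W z.toAdd, by
      rw [Unitary.mem_iff, hstar, hmul, hmul, neg_add_cancel, add_neg_cancel, hW0]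
      exact ⟨rfl, rfl⟩⟩
    map_one' := Subtype.ext hW0
    map_mul' := fun z z' => Subtype.ext (hmul _ _).symm }

theorem IsPVM.coe_unitaryHom {E : Fin n → D} (hE : IsPVM E) (z : ZMod n) :
    (hE.unitaryHom (Multiplicative.ofAdd z) : D)
      = ∑ a, ZMod.stdAddChar (z * ZMod.finEquiv n a) • E a := rfl

/-- The other half of Fourier inversion: projection valued measures with `n` outcomes and unitary
representations of `ℤ_n` are the same data. -/
theorem IsPVM.specProj_unitaryHom {E : Fin n → D} (hE : IsPVM E) (a : Fin n) :
    specProj hE.unitaryHom a = E a := by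
  have hn : (n : ℂ) ≠ 0 := NeZero.ne _
  simp_rw [specProj, hE.coe_unitaryHom, Finset.smul_sum, smul_smul, ← AddChar.map_add_eq_mul]
  rw [Finset.sum_comm]
  simp_rw [← Finset.sum_smul, ← Finset.mul_sum, neg_add_eq_sub, ← mul_sub, sum_stdAddChar_mul]
  rw [Finset.sum_eq_single a, if_pos (sub_self _), inv_mul_cancel₀ hn, one_smul]
  · intro b _ h
    rw [if_neg, mul_zero, zero_smul]
    rw [sub_eq_zero]
    exact fun h' => h ((ZMod.finEquiv n).injective h')
  · simp

end Fourier

/-! ### Dilation of POVMs to projection valued measures -/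

section Dilation

variable {n : ℕ} {A : Type*} [CStarAlgebra A]

/-- The symmetry `[[0, V⋆], [V, 1 - V V⋆]]`, where `V` is the column with entries `s a`. -/
def dilationSymmetry (s : Fin n → A) : CStarMatrix (Option (Fin n)) (Option (Fin n)) A :=
  CStarMatrix.ofMatrix fun i j => match i, j with
    | none, none => 0
    | none, some b => s b
    | some a, none => s a
    | some a, some b => (if a = b then 1 else 0) - s a * s b

theorem star_dilationSymmetry {s : Fin n → A} (hs : ∀ a, IsSelfAdjoint (s a)) :
    star (dilationSymmetry s) = dilationSymmetry s := by
  ext i j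
  rw [CStarMatrix.star_apply]
  rcases i with _ | a <;> rcases j with _ | b
  · exact star_zero _
  · exact hs b
  · exact hs a
  · change star ((if b = a then 1 else 0) - s b * s a) = (if a = b then 1 else 0) - s a * s b
    rw [star_sub, star_mul, hs a, hs b]
    by_cases h : a = b
    · rw [if_pos h, if_pos h.symm, star_one]
    · rw [if_neg h, if_neg (Ne.symm h), star_zero]

/-- The hypothesis says that the column `V` is an isometry, `V⋆V = 1`. Then `1 - VV⋆` is a
projection annihilating `V`, so the block matrix squares to `1`. -/
theorem dilationSymmetry_mul_self {s : Fin n → A} (h1 : ∑ a, s a * s a = 1) :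
    dilationSymmetry s * dilationSymmetry s = 1 := by
  ext i j
  rw [CStarMatrix.mul_apply, Fintype.sum_option, CStarMatrix.one_apply]
  rcases i with _ | a <;> rcases j with _ | b
  · change 0 * 0 + ∑ c, s c * s c = if none = none then 1 else 0
    rw [h1, if_pos rfl, mul_zero, zero_add]
  · change 0 * s b + ∑ c, s c * ((if c = b then 1 else 0) - s c * s b)
      = if none = some b then 1 else 0
    simp_rw [mul_sub, ← mul_assoc]
    rw [Finset.sum_sub_distrib, ← Finset.sum_mul, h1]
    simp
  · change s a * 0 + ∑ c, ((if a = c then 1 else 0) - s a * s c) * s c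
      = if some a = none then 1 else 0
    simp_rw [sub_mul, mul_assoc]
    rw [Finset.sum_sub_distrib, ← Finset.mul_sum, h1]
    simp
  · change s a * s b + ∑ c, ((if a = c then 1 else 0) - s a * s c)
      * ((if c = b then 1 else 0) - s c * s b) = if some a = some b then 1 else 0
    have e : ∀ c, ((if a = c then (1 : A) else 0) - s a * s c)
        * ((if c = b then 1 else 0) - s c * s b)
        = ((if a = c then (if c = b then (1 : A) else 0) else 0)
          - if a = c then s c * s b else 0) - (if c = b then s a * s c else 0)
          + s a * (s c * s c) * s b := fun c => by
      split_ifs <;> noncomm_ring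
    simp_rw [e]
    rw [Finset.sum_add_distrib, Finset.sum_sub_distrib, Finset.sum_sub_distrib, ← Finset.sum_mul,
      ← Finset.mul_sum, h1]
    simp only [Finset.sum_ite_eq, Finset.sum_ite_eq', Finset.mem_univ, if_true, Option.some_inj]
    noncomm_ring

variable [PartialOrder A] [StarOrderedRing A] [NeZero n]

variable (A) in
/-- The diagonal projection onto the coordinate `a`, the extra coordinate being assigned to `0`. -/
def dilationProj (a : Fin n) : CStarMatrix (Option (Fin n)) (Option (Fin n)) A :=
  CStarMatrix.ofMatrix (Matrix.diagonal fun i => if i.getD 0 = a then 1 else 0)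

theorem isPVM_dilationProj : IsPVM (dilationProj A : Fin n → _) where
  star_eq a := by
    ext i j
    rw [CStarMatrix.star_apply]
    change star (Matrix.diagonal _ j i) = Matrix.diagonal _ i j
    by_cases h : i = j
    · subst h
      rw [Matrix.diagonal_apply_eq]
      split_ifs
      · exact star_one _
      · exact star_zero _
    · rw [Matrix.diagonal_apply_ne _ h, Matrix.diagonal_apply_ne' _ h, star_zero]
  mul_eq a b := by
    have h : dilationProj A a * dilationProj A b = CStarMatrix.ofMatrix (Matrix.diagonal
        fun i => (if i.getD 0 = a then 1 else 0) * if i.getD 0 = b then 1 else 0) :=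
      Matrix.diagonal_mul_diagonal _ _
    rw [h]
    split_ifs with hab
    · subst hab
      refine congrArg CStarMatrix.ofMatrix (congrArg Matrix.diagonal (funext fun i => ?_))
      split_ifs <;> simp
    · refine (congrArg CStarMatrix.ofMatrix (congrArg Matrix.diagonal (a₂ := 0)
        (funext fun i => ?_))).trans ?_
      · by_cases h : i.getD 0 = a
        · rw [if_neg (fun h' => hab (h.symm.trans h')), mul_zero]; rfl
        · rw [if_neg h, zero_mul]; rfl
      · ext i j
        exact congrFun (congrFun Matrix.diagonal_zero i) j
  sum_eq_one := by
    ext i j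
    have e : (∑ a, dilationProj A a) i j = ∑ a : Fin n, dilationProj A a i j :=
      Matrix.sum_apply i j Finset.univ _
    rw [e, CStarMatrix.one_apply]
    by_cases h : i = j
    · subst h
      change ∑ a : Fin n, Matrix.diagonal _ i i = _
      simp [Matrix.diagonal_apply_eq]
    · rw [if_neg h]
      exact Finset.sum_eq_zero fun a _ => Matrix.diagonal_apply_ne _ h

/-- Naimark dilation of a POVM to a projection valued measure in the matrices over the algebra. -/
def dilation (P : Fin n → A) (a : Fin n) : CStarMatrix (Option (Fin n)) (Option (Fin n)) A :=
  dilationSymmetry (fun b => CFC.sqrt (P b)) * dilationProj A a *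
    dilationSymmetry (fun b => CFC.sqrt (P b))

theorem isPVM_dilation {P : Fin n → A} (hP : IsCStarPOVM P) : IsPVM (dilation P) := by
  have hs := star_dilationSymmetry (s := fun b => CFC.sqrt (P b))
    fun a => .of_nonneg (CFC.sqrt_nonneg _)
  have hm := dilationSymmetry_mul_self (s := fun b => CFC.sqrt (P b)) (by
    rw [← hP.2]; exact Finset.sum_congr rfl fun a _ => CFC.sqrt_mul_sqrt_self (P a) (hP.1 a))
  refine ⟨fun a => ?_, fun a b => ?_, ?_⟩
  · rw [dilation, star_mul, star_mul, hs, isPVM_dilationProj.star_eq, mul_assoc]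
  · rw [dilation, dilation]
    set U := dilationSymmetry fun b => CFC.sqrt (P b)
    calc U * dilationProj A a * U * (U * dilationProj A b * U)
        = U * dilationProj A a * (U * U) * dilationProj A b * U := by simp only [mul_assoc]
      _ = U * (dilationProj A a * dilationProj A b) * U := by
        rw [hm, mul_one]; simp only [mul_assoc]
      _ = _ := by
        rw [isPVM_dilationProj.mul_eq]
        split_ifs
        · rfl
        · rw [mul_zero, zero_mul]
  · simp only [dilation]
    rw [← Finset.sum_mul, ← Finset.mul_sum, isPVM_dilationProj.sum_eq_one, mul_one, hm]

/-- The first row of the symmetry is `(0, √P_b)`, so compressing the conjugated diagonal projection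
leaves `√P_a √P_a`. The extra coordinate, although assigned to outcome `0`, is weighted by the zero
corner entry. -/
theorem dilation_apply_none {P : Fin n → A} (hP : IsCStarPOVM P) (a : Fin n) :
    dilation P a none none = P a := by
  rw [dilation, CStarMatrix.mul_apply, Fintype.sum_option]
  have h0 : ∀ M : CStarMatrix (Option (Fin n)) (Option (Fin n)) A, ∀ i j,
      (M * dilationProj A a) i j = M i j * if j.getD 0 = a then 1 else 0 := fun M i j =>
    Matrix.mul_diagonal _ _ _ _
  simp_rw [h0]
  change 0 * _ * 0 + ∑ b, CFC.sqrt (P b) * (if b = a then 1 else 0) * CFC.sqrt (P b) = P a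
  simp [CFC.sqrt_mul_sqrt_self (P a) (hP.1 a)]

/-- All entries of the dilation are polynomials in the square roots `√P_b`, and what commutes with
`P_b` commutes with its functional calculus. Dilating one side of a strategy thus keeps it commuting
with the other. -/
theorem commute_diagHom_dilation {P : Fin n → A} {c : A} (hc : ∀ a, Commute c (P a)) (a : Fin n) :
    Commute (diagHom _ A c) (dilation P a) := by
  have hs : ∀ a, Commute c (CFC.sqrt (P a)) := fun a => by
    rw [CFC.sqrt_eq_cfc]
    exact ((hc a).symm.cfc_nnreal _).symm
  have hU : Commute (diagHom _ A c) (dilationSymmetry fun b => CFC.sqrt (P b)) := by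
    rw [commute_diagHom_iff]
    rintro (_ | a) (_ | b)
    · exact Commute.zero_right c
    · exact hs b
    · exact hs a
    · refine Commute.sub_right ?_ ((hs a).mul_right (hs b))
      split_ifs
      · exact Commute.one_right c
      · exact Commute.zero_right c
  refine (hU.mul_right ?_).mul_right hU
  rw [commute_diagHom_iff]
  intro i j
  by_cases h : i = j
  · subst h
    change Commute c (Matrix.diagonal _ i i)
    rw [Matrix.diagonal_apply_eq]
    split_ifs
    · exact Commute.one_right c
    · exact Commute.zero_right c
  · change Commute c (Matrix.diagonal _ i j)
    rw [Matrix.diagonal_apply_ne _ h]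
    exact Commute.zero_right c

end Dilation

/-! ### Universal families of POVMs in group C⋆-algebras -/

/-- A family of POVMs in `C⋆(G)` is universal if every family of POVMs in a C⋆-algebra is the
compression to a corner of the image of the given family under a unitary representation by
matrices over the algebra, which commutes with everything that commutes with the family. -/
def IsUniversalPOVM {G : Type} [Group G] {k n : ℕ} (P : Fin k → Fin n → GroupCStar G) : Prop :=
  (∀ x, IsCStarPOVM (P x)) ∧
  ∀ (A : Type) [CStarAlgebra A] [PartialOrder A] [StarOrderedRing A] (Q : Fin k → Fin n → A),
    (∀ x, IsCStarPOVM (Q x)) →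
    ∃ (m : Type) (_ : Fintype m) (_ : DecidableEq m) (o : m)
      (θ : G →* unitary (CStarMatrix m m A)),
      (∀ x a, GroupCStar.lift θ (P x a) o o = Q x a) ∧
      ∀ c, (∀ x a, Commute c (Q x a)) → ∀ g, Commute (diagHom m A c) (θ g : CStarMatrix m m A)

/-- The spectral projections of the canonical generators of `C⋆(𝔽(k, n))`. -/
def freeCycProj (k n : ℕ) [NeZero n] (x : Fin k) : Fin n → GroupCStar (FreeCyc k n) :=
  specProj (GroupCStar.unitaryOf.comp
    (Monoid.CoprodI.of (M := fun _ : Fin k => Multiplicative (ZMod n)) (i := x)))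

theorem lift_freeCycProj {k n : ℕ} [NeZero n] {D : Type} [CStarAlgebra D]
    (θ : FreeCyc k n →* unitary D) (x : Fin k) (a : Fin n) :
    GroupCStar.lift θ (freeCycProj k n x a) = specProj (θ.comp
      (Monoid.CoprodI.of (M := fun _ : Fin k => Multiplicative (ZMod n)) (i := x))) a := by
  rw [freeCycProj, specProj, specProj, map_smul, map_sum]
  refine congrArg _ (Finset.sum_congr rfl fun z _ => ?_)
  rw [map_smul]
  exact congrArg _ (GroupCStar.lift_of _ _)

/-- Each POVM is dilated separately, but in matrices of the same size and with the same corner. The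
resulting unitaries of order `n` satisfy no prescribed relation across questions, which is exactly
what a free product can absorb. -/
theorem isUniversalPOVM_freeCycProj (k n : ℕ) [NeZero n] : IsUniversalPOVM (freeCycProj k n) := by
  refine ⟨fun x => isCStarPOVM_specProj _, ?_⟩
  intro A _ _ _ Q hQ
  let w : ∀ x : Fin k, Multiplicative (ZMod n) →*
      unitary (CStarMatrix (Option (Fin n)) (Option (Fin n)) A) :=
    fun x => (isPVM_dilation (hQ x)).unitaryHom
  refine ⟨Option (Fin n), inferInstance, inferInstance, none, Monoid.CoprodI.lift w, ?_, ?_⟩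
  · intro x a
    rw [lift_freeCycProj, Monoid.CoprodI.lift_comp_of, IsPVM.specProj_unitaryHom,
      dilation_apply_none (hQ x)]
  · intro c hc g
    induction g using Monoid.CoprodI.induction_on with
    | one => rw [map_one]; exact Commute.one_right _
    | of x z =>
      rw [Monoid.CoprodI.lift_of]
      change Commute _ (∑ a, ZMod.stdAddChar (z.toAdd * ZMod.finEquiv n a) • dilation (Q x) a)
      exact Commute.sum_right _ _ _ fun a _ =>
        (commute_diagHom_dilation (hc x) a).smul_right _
    | mul g h hg hh => rw [map_mul]; exact hg.mul_right hh

/-! ### Entries of matrices over C⋆-algebras -/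

section MatrixMaps

variable {m : Type*} [Fintype m] [DecidableEq m]
variable {A B : Type*} [CStarAlgebra A] [PartialOrder A] [StarOrderedRing A]
  [CStarAlgebra B] [PartialOrder B] [StarOrderedRing B]

/-- The `(i, j)` entry of a matrix as a linear map. -/
def entryMap (i j : m) : CStarMatrix m m A →ₗ[ℂ] A where
  toFun M := M i j
  map_add' _ _ := rfl
  map_smul' _ _ := rfl

theorem entryMap_apply (i j : m) (M : CStarMatrix m m A) : entryMap i j M = M i j := rfl

variable (m) in
/-- The entrywise extension of a ⋆-homomorphism to matrices. -/
def matHom (φ : A →⋆ₐ[ℂ] B) : CStarMatrix m m A →⋆ₐ[ℂ] CStarMatrix m m B where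
  toFun M := M.map φ
  map_one' := by
    ext i j
    rw [CStarMatrix.map_apply, CStarMatrix.one_apply, CStarMatrix.one_apply]
    split_ifs
    · exact map_one φ
    · exact map_zero φ
  map_zero' := by ext i j; exact map_zero φ
  map_mul' M N := by
    ext i j
    simp only [CStarMatrix.map_apply, CStarMatrix.mul_apply, map_sum, map_mul]
  map_add' M N := by ext i j; exact map_add φ _ _
  commutes' c := by
    ext i j
    rw [CStarMatrix.map_apply, CStarMatrix.algebraMap_apply, CStarMatrix.algebraMap_apply]
    split_ifs
    · exact AlgHomClass.commutes φ c
    · exact map_zero φ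
  map_star' M := by ext i j; exact map_star φ _

theorem matHom_apply (φ : A →⋆ₐ[ℂ] B) (M : CStarMatrix m m A) (i j : m) :
    matHom m φ M i j = φ (M i j) := rfl

/-- Complete positivity of compression to a corner: the corner of `L⋆L` is a sum of `L_r⋆ L_r`, with
one term for each inner row index `r`. -/
theorem map_corner_nonneg {k : ℕ} {N : CStarMatrix (Fin k) (Fin k) (CStarMatrix m m A)}
    (hN : 0 ≤ N) (o : m) : 0 ≤ N.map (entryMap o o) := by
  rw [StarOrderedRing.nonneg_iff] at hN
  induction hN using AddSubmonoid.closure_induction with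
  | zero => exact le_of_eq (CStarMatrix.ext fun i j => rfl)
  | add M N _ _ hM hN => exact add_nonneg hM hN
  | mem N hN =>
  obtain ⟨L, rfl⟩ := hN
  have e : (star L * L).map (entryMap o o)
      = ∑ r : m, star (CStarMatrix.ofMatrix fun l i => L l i r o : CStarMatrix (Fin k) (Fin k) A) *
          (CStarMatrix.ofMatrix fun l i => L l i r o : CStarMatrix (Fin k) (Fin k) A) := by
    ext i j
    have h1 : ∀ f : m → CStarMatrix (Fin k) (Fin k) A, (∑ r, f r) i j = ∑ r, f r i j := fun f =>
      map_sum (entryMap i j) f Finset.univ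
    rw [h1, CStarMatrix.map_apply, CStarMatrix.mul_apply, map_sum]
    simp_rw [CStarMatrix.mul_apply, entryMap_apply, CStarMatrix.star_apply, CStarMatrix.mul_apply,
      CStarMatrix.star_apply]
    exact Finset.sum_comm
  change 0 ≤ (star L * L).map (entryMap o o)
  rw [e]
  exact Finset.sum_nonneg fun r _ => star_mul_self_nonneg _

end MatrixMaps

/-- The homomorphism of unitary groups induced by a ⋆-homomorphism. -/
def unitaryMap {A B : Type*} [CStarAlgebra A] [CStarAlgebra B] (φ : A →⋆ₐ[ℂ] B) :
    unitary A →* unitary B where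
  toFun u := ⟨φ (u : A), by
    have h := Unitary.mem_iff.1 u.2
    rw [Unitary.mem_iff, ← map_star, ← map_mul, ← map_mul, h.1, h.2, map_one]
    exact ⟨rfl, rfl⟩⟩
  map_one' := Subtype.ext (map_one φ)
  map_mul' u v := Subtype.ext (map_mul φ (u : A) (v : A))

/-! ### A ucp lift of `C⋆(𝔽_k) → C⋆(𝔽(k, n))` -/

theorem GroupCStar.lift_unitaryOf {G : Type u} [Group G] (z : GroupCStar G) :
    GroupCStar.lift GroupCStar.unitaryOf z = z := by
  have h : GroupCStar.lift (GroupCStar.unitaryOf (G := G)) = StarAlgHom.id ℂ _ :=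
    GroupCStar.hom_ext fun g => GroupCStar.lift_of _ g
  exact DFunLike.congr_fun h z

theorem freeCyc_closure (k n : ℕ) : Subgroup.closure
    {g : FreeCyc k n | ∃ x z, g = Monoid.CoprodI.of
      (M := fun _ : Fin k => Multiplicative (ZMod n)) (i := x) z} = ⊤ := by
  rw [eq_top_iff]
  intro g _
  induction g using Monoid.CoprodI.induction_on with
  | one => exact one_mem _
  | of x z => exact Subgroup.subset_closure ⟨x, z, rfl⟩
  | mul g h hg hh => exact mul_mem (hg trivial) (hh trivial)

/-- The spectral projections in `C⋆(𝔽(k, n))` lift to POVMs in `C⋆(𝔽_k)`, and universality writes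
these as corners of some `θ`. Applying `q` entrywise gives a representation whose corner fixes every
generator, hence, by `lift_corner_eq`, every element. -/
theorem exists_corner_section (k n : ℕ) [NeZero n] :
    ∃ (m : Type) (_ : Fintype m) (_ : DecidableEq m) (o : m)
      (θ : FreeCyc k n →* unitary (CStarMatrix m m (GroupCStar (FreeGroup (Fin k))))),
      ∀ z, GroupCStar.map (freeToFreeCyc k n) (GroupCStar.lift θ z o o) = z := by
  let ι := fun x : Fin k => Monoid.CoprodI.of (M := fun _ : Fin k => Multiplicative (ZMod n)) (i := x)
  let q := GroupCStar.map (freeToFreeCyc k n)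
  -- The Fourier sum for the spectral projection, with the exponents represented by `0, …, n - 1`.
  -- The free generators do not have order `n`, so these need not be projections, or even positive,
  -- and must be corrected.
  let h : Fin k → Fin n → GroupCStar (FreeGroup (Fin k)) := fun x a =>
    (n : ℂ)⁻¹ • ∑ z : ZMod n, ZMod.stdAddChar (-(z * ZMod.finEquiv n a)) •
      GroupCStar.of (FreeGroup.of x ^ z.val)
  have hq : ∀ x a, q (h x a) = freeCycProj k n x a := fun x a => by
    change q ((n : ℂ)⁻¹ • ∑ z : ZMod n, _) = (n : ℂ)⁻¹ • ∑ z : ZMod n, _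
    rw [map_smul, map_sum]
    refine congrArg _ (Finset.sum_congr rfl fun z _ => ?_)
    rw [map_smul]
    refine congrArg _ ((GroupCStar.map_of _ _).trans (congrArg GroupCStar.of ?_))
    rw [map_pow, freeToFreeCyc, FreeGroup.lift_apply_of, ← map_pow, ← ofAdd_nsmul, nsmul_one,
      ZMod.natCast_zmod_val]
  choose Q hQ hQq using fun x => exists_povm_lift.{0, 0} (h x)
  have hQ' : ∀ x a, q (Q x a) = freeCycProj k n x a := fun x a => by
    rw [hQq x _ q, hq]
    simp_rw [hq]
    exact isCStarPOVM_specProj _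
  obtain ⟨m, _, _, o, θ, hθ, -⟩ := (isUniversalPOVM_freeCycProj k n).2 _ Q hQ
  refine ⟨m, inferInstance, inferInstance, o, θ, fun z => ?_⟩
  let θ' : FreeCyc k n →* unitary (CStarMatrix m m (GroupCStar (FreeCyc k n))) :=
    (unitaryMap (matHom m q)).comp θ
  have e : GroupCStar.lift θ' = (matHom m q).comp (GroupCStar.lift θ) :=
    GroupCStar.hom_ext fun g => by
      rw [StarAlgHom.comp_apply, GroupCStar.lift_of, GroupCStar.lift_of]; rfl
  have key := lift_corner_eq θ' GroupCStar.unitaryOf o _ (freeCyc_closure k n) ?_ z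
  · rwa [e, StarAlgHom.comp_apply, matHom_apply, GroupCStar.lift_unitaryOf] at key
  · rintro _ ⟨x, z, rfl⟩
    -- The corners are known on the spectral projections only; by linearity, Fourier inversion gives
    -- them on the group elements `ι x z`.
    have h1 := sum_smul_specProj (GroupCStar.unitaryOf.comp (ι x)) z.toAdd
    have h2 : (θ (ι x z) : CStarMatrix m m _) o o
        = ∑ a, ZMod.stdAddChar (z.toAdd * ZMod.finEquiv n a) • Q x a := by
      have h3 : GroupCStar.lift θ (GroupCStar.of (ι x z)) = θ (ι x z) := GroupCStar.lift_of _ _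
      have h4 : GroupCStar.of (ι x z)
        = ∑ a, ZMod.stdAddChar (z.toAdd * ZMod.finEquiv n a) • freeCycProj k n x a := h1.symm
      rw [← h3]
      change entryMap o o (GroupCStar.lift θ (GroupCStar.of (ι x z))) = _
      rw [h4, map_sum, map_sum]
      refine Finset.sum_congr rfl fun a _ => ?_
      rw [map_smul, map_smul, entryMap_apply, hθ]
    change q ((θ (ι x z) : CStarMatrix m m _) o o) = _
    rw [h2, map_sum]
    refine Eq.trans (Finset.sum_congr rfl fun a _ => ?_) h1
    rw [map_smul, hQ']
    rfl

/-- The corner of a representation by matrices, as a completely positive map. -/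
def cornerCP {G : Type} [Group G] {m : Type} [Fintype m] [DecidableEq m]
    {A : Type} [CStarAlgebra A] [PartialOrder A] [StarOrderedRing A]
    (θ : G →* unitary (CStarMatrix m m A)) (o : m) : GroupCStar G →CP A where
  toLinearMap := entryMap o o ∘ₗ (GroupCStar.lift θ).toAlgHom.toLinearMap
  map_cstarMatrix_nonneg' k M hM := by
    have h : 0 ≤ M.map (GroupCStar.lift θ) :=
      CompletelyPositiveMapClass.map_cstarMatrix_nonneg' (GroupCStar.lift θ) k M hM
    exact map_corner_nonneg h o

theorem cornerCP_apply {G : Type} [Group G] {m : Type} [Fintype m] [DecidableEq m]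
    {A : Type} [CStarAlgebra A] [PartialOrder A] [StarOrderedRing A]
    (θ : G →* unitary (CStarMatrix m m A)) (o : m) (z : GroupCStar G) :
    cornerCP θ o z = GroupCStar.lift θ z o o := rfl

theorem exists_ucp_lift (k n : ℕ) [NeZero n] :
    ∃ Φ : GroupCStar (FreeCyc k n) →CP GroupCStar (FreeGroup (Fin k)),
      Φ 1 = 1 ∧ ∀ z, GroupCStar.map (freeToFreeCyc k n) (Φ z) = z := by
  obtain ⟨m, _, _, o, θ, hθ⟩ := exists_corner_section k n
  refine ⟨cornerCP θ o, ?_, hθ⟩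
  rw [cornerCP_apply, map_one, CStarMatrix.one_apply_eq]

/-! ### Nuclear pairs and corner sections -/

section MatOp

variable {m : Type} [Fintype m] {H : Type} [NormedAddCommGroup H] [InnerProductSpace ℂ H]

/-- The operator on `H^m` given by a matrix of operators on `H`. -/
def matOpFun (M : CStarMatrix m m (H →L[ℂ] H)) :
    PiLp 2 (fun _ : m => H) →L[ℂ] PiLp 2 (fun _ : m => H) :=
  ((PiLp.continuousLinearEquiv 2 ℂ (fun _ : m => H)).symm : _ →L[ℂ] _) ∘L
    ContinuousLinearMap.pi fun i => ∑ j, (M i j) ∘L PiLp.proj 2 (fun _ : m => H) j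

theorem matOpFun_apply (M : CStarMatrix m m (H →L[ℂ] H)) (v : PiLp 2 (fun _ : m => H)) (i : m) :
    matOpFun M v i = ∑ j, M i j (v j) := by
  simp [matOpFun]

variable [DecidableEq m]

variable (m H) in
/-- The ⋆-homomorphism from matrices of operators on `H` to operators on `H^m`. -/
def matOp [CompleteSpace H] : CStarMatrix m m (H →L[ℂ] H) →⋆ₐ[ℂ]
    (PiLp 2 (fun _ : m => H) →L[ℂ] PiLp 2 (fun _ : m => H)) where
  toFun := matOpFun
  map_one' := by
    ext v i
    rw [matOpFun_apply, Finset.sum_eq_single i]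
    · rw [CStarMatrix.one_apply_eq]; rfl
    · intro j _ hj
      rw [CStarMatrix.one_apply_ne hj.symm]; rfl
    · simp
  map_zero' := by
    ext v i
    rw [matOpFun_apply]
    exact Finset.sum_eq_zero fun j _ => rfl
  map_mul' M N := by
    ext v i
    rw [mul_apply_eq_comp, matOpFun_apply, matOpFun_apply]
    simp_rw [matOpFun_apply, CStarMatrix.mul_apply, sum_apply, map_sum]
    exact Finset.sum_comm
  map_add' M N := by
    ext v i
    change matOpFun (M + N) v i = matOpFun M v i + matOpFun N v i
    simp_rw [matOpFun_apply]
    rw [← Finset.sum_add_distrib]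
    rfl
  commutes' c := by
    ext v i
    rw [matOpFun_apply, Finset.sum_eq_single i]
    · rw [CStarMatrix.algebraMap_apply, if_pos rfl]; rfl
    · intro j _ hj
      rw [CStarMatrix.algebraMap_apply, if_neg hj.symm]; rfl
    · simp
  map_star' M := by
    rw [ContinuousLinearMap.star_eq_adjoint, ContinuousLinearMap.eq_adjoint_iff]
    intro v w
    rw [PiLp.inner_apply, PiLp.inner_apply]
    simp_rw [matOpFun_apply, sum_inner, inner_sum, CStarMatrix.star_apply,
      ContinuousLinearMap.star_eq_adjoint, ContinuousLinearMap.adjoint_inner_left]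
    exact Finset.sum_comm

theorem matOp_apply [CompleteSpace H] (M : CStarMatrix m m (H →L[ℂ] H)) (v : PiLp 2 (fun _ : m => H)) (i : m) :
    matOp m H M v i = ∑ j, M i j (v j) := matOpFun_apply M v i

variable (H) in
/-- The inclusion of the `o`-th summand. -/
def inclL (o : m) : H →ₗᵢ[ℂ] PiLp 2 (fun _ : m => H) where
  toFun h := PiLp.single 2 o h
  map_add' x y := PiLp.single_add 2 o
  map_smul' c x := by
    ext i
    by_cases h : i = o
    · subst h; simp
    · simp [h]
  norm_map' x := PiLp.norm_single 2 (fun _ : m => H) o x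

theorem inclL_apply_same (o : m) (x : H) : inclL H o x o = x :=
  PiLp.single_eq_same 2 (β := fun _ : m => H) o x

theorem inclL_apply_ne {i o : m} (h : i ≠ o) (x : H) : inclL H o x i = 0 :=
  PiLp.single_eq_of_ne 2 (β := fun _ : m => H) h x

theorem inner_inclL_matOp [CompleteSpace H] (M : CStarMatrix m m (H →L[ℂ] H)) (o : m) (x y : H) :
    inner ℂ (inclL H o x) (matOp m H M (inclL H o y)) = inner ℂ x (M o o y) := by
  rw [PiLp.inner_apply, Finset.sum_eq_single o]
  · rw [matOp_apply, Finset.sum_eq_single o, inclL_apply_same, inclL_apply_same]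
    · intro j _ hj
      rw [inclL_apply_ne hj, map_zero]
    · simp
  · intro i _ hi
    rw [inclL_apply_ne hi, inner_zero_left]
  · simp

end MatOp

/-- The ⋆-homomorphism `φ ⊗ ψ` of algebraic tensor products. -/
def tensorMapHom {A B C D : Type*} [CStarAlgebra A] [CStarAlgebra B] [CStarAlgebra C]
    [CStarAlgebra D] (φ : A →⋆ₐ[ℂ] C) (ψ : B →⋆ₐ[ℂ] D) : A ⊗[ℂ] B →⋆ₐ[ℂ] C ⊗[ℂ] D :=
  { Algebra.TensorProduct.map (φ : A →ₐ[ℂ] C) (ψ : B →ₐ[ℂ] D) with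
    map_star' := fun x => by
      change Algebra.TensorProduct.map (φ : A →ₐ[ℂ] C) (ψ : B →ₐ[ℂ] D) (star x)
        = star (Algebra.TensorProduct.map (φ : A →ₐ[ℂ] C) (ψ : B →ₐ[ℂ] D) x)
      induction x using TensorProduct.induction_on with
      | zero => rw [star_zero, map_zero, star_zero]
      | add x y hx hy => rw [star_add, map_add, map_add, star_add, hx, hy]
      | tmul a b =>
        rw [TensorProduct.star_tmul, Algebra.TensorProduct.map_tmul,
          Algebra.TensorProduct.map_tmul, TensorProduct.star_tmul]
        exact congrArg₂ _ (map_star φ a) (map_star ψ b) }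

theorem norm_le_of_forall_inner_le {V : Type*} [NormedAddCommGroup V] [InnerProductSpace ℂ V]
    {X : UniformSpace.Completion V →L[ℂ] UniformSpace.Completion V} {C : ℝ} (hC : 0 ≤ C)
    (h : ∀ ξ η : V, ‖inner ℂ (η : UniformSpace.Completion V) (X ξ)‖ ≤ C * (‖η‖ * ‖ξ‖)) :
    ‖X‖ ≤ C := by
  have h' : ∀ ξ η : UniformSpace.Completion V, ‖inner ℂ η (X ξ)‖ ≤ C * (‖η‖ * ‖ξ‖) := by
    intro ξ η
    induction ξ, η using UniformSpace.Completion.induction_on₂ with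
    | hp => apply isClosed_le <;> fun_prop
    | ih ξ η => simpa using h ξ η
  refine ContinuousLinearMap.opNorm_le_bound X hC fun ξ => ?_
  by_cases h0 : ‖X ξ‖ = 0
  · rw [h0]; positivity
  · have h1 := h' ξ (X ξ)
    rw [inner_self_eq_norm_sq_to_K, norm_pow, RCLike.norm_ofReal, abs_norm] at h1
    have h2 : 0 < ‖X ξ‖ := lt_of_le_of_ne (norm_nonneg _) (Ne.symm h0)
    nlinarith

/-- With explicit Stinespring dilations, `(π ⊗ ρ)(Φ₁ ⊗ Φ₂)(x) = V⋆ (π' ⊗ ρ')(x) V`, where `π'` and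
`ρ'` act on direct sums of copies of `H` and `K` and `V` is the isometric inclusion of the summand
`(o₁, o₂)`. -/
theorem minNorm_map_corner_le {C₁ C₂ A₁ A₂ : Type} [CStarAlgebra C₁] [CStarAlgebra C₂]
    [CStarAlgebra A₁] [PartialOrder A₁] [StarOrderedRing A₁]
    [CStarAlgebra A₂] [PartialOrder A₂] [StarOrderedRing A₂]
    {m₁ m₂ : Type} [Fintype m₁] [DecidableEq m₁] [Fintype m₂] [DecidableEq m₂]
    (Θ₁ : C₁ →⋆ₐ[ℂ] CStarMatrix m₁ m₁ A₁) (Θ₂ : C₂ →⋆ₐ[ℂ] CStarMatrix m₂ m₂ A₂) (o₁ : m₁) (o₂ : m₂)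
    (x : C₁ ⊗[ℂ] C₂) :
    minNorm (TensorProduct.map (entryMap o₁ o₁ ∘ₗ Θ₁.toAlgHom.toLinearMap)
      (entryMap o₂ o₂ ∘ₗ Θ₂.toAlgHom.toLinearMap) x) ≤ minNorm x := by
  refine minNorm_le (minNorm_nonneg x) ?_
  intro H _ _ _ K _ _ _ π ρ
  let π' : C₁ →⋆ₐ[ℂ] _ := (matOp m₁ H).comp ((matHom m₁ π).comp Θ₁)
  let ρ' : C₂ →⋆ₐ[ℂ] _ := (matOp m₂ K).comp ((matHom m₂ ρ).comp Θ₂)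
  refine le_trans ?_ (norm_tensorRep_le_minNorm π' ρ' x)
  refine norm_le_of_forall_inner_le (norm_nonneg (tensorRep π' ρ' x)) fun ξ η => ?_
  let V := TensorProduct.mapIsometry (inclL H o₁) (inclL K o₂)
  have key : inner ℂ (η : HilbertTensor H K) (tensorRep π ρ (TensorProduct.map
      (entryMap o₁ o₁ ∘ₗ Θ₁.toAlgHom.toLinearMap) (entryMap o₂ o₂ ∘ₗ Θ₂.toAlgHom.toLinearMap) x) ξ)
      = inner ℂ ((V η : _) : HilbertTensor (PiLp 2 fun _ : m₁ => H) (PiLp 2 fun _ : m₂ => K))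
          (tensorRep π' ρ' x (V ξ : _)) := by
    induction x using TensorProduct.induction_on with
    | zero => rw [map_zero, map_zero, map_zero, zero_apply, zero_apply, inner_zero_right,
        inner_zero_right]
    | add x y hx hy => rw [map_add, map_add, map_add, add_apply, add_apply, inner_add_right,
        inner_add_right, hx, hy]
    | tmul a b =>
      rw [TensorProduct.map_tmul, tensorRep_tmul, tensorRep_tmul, tensorOp_coe, tensorOp_coe,
        UniformSpace.Completion.inner_coe, UniformSpace.Completion.inner_coe]
      induction ξ using TensorProduct.induction_on with
      | zero => simp only [map_zero, inner_zero_right]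
      | add x y hx hy => simp only [map_add, inner_add_right, hx, hy]
      | tmul x y =>
        induction η using TensorProduct.induction_on with
        | zero => simp only [map_zero, inner_zero_left]
        | add x y hx hy => simp only [map_add, inner_add_left, hx, hy]
        | tmul z w =>
          rw [TensorProduct.mapIsometry_apply, TensorProduct.mapIsometry_apply,
            TensorProduct.map_tmul, TensorProduct.map_tmul, TensorProduct.map_tmul,
            TensorProduct.map_tmul, TensorProduct.inner_tmul, TensorProduct.inner_tmul]
          exact congrArg₂ _ (inner_inclL_matOp (matHom m₁ π (Θ₁ a)) o₁ z x).symm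
            (inner_inclL_matOp (matHom m₂ ρ (Θ₂ b)) o₂ w y).symm
  rw [key]
  refine (norm_inner_le_norm _ _).trans ?_
  rw [UniformSpace.Completion.norm_coe, V.norm_map, mul_left_comm]
  refine mul_le_mul_of_nonneg_left ((ContinuousLinearMap.le_opNorm _ _).trans ?_) (norm_nonneg _)
  rw [UniformSpace.Completion.norm_coe, V.norm_map]

/-- Nuclearity of pairs passes to quotients with sections that are corners of representations. -/
theorem IsNuclearPair.of_corner_section {C A : Type} [CStarAlgebra C] [CStarAlgebra A]
    [PartialOrder A] [StarOrderedRing A] {m : Type} [Fintype m] [DecidableEq m]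
    (Θ : C →⋆ₐ[ℂ] CStarMatrix m m A) (o : m) (q : A →⋆ₐ[ℂ] C) (h : ∀ z, q (Θ z o o) = z)
    (hA : IsNuclearPair A A) : IsNuclearPair C C := by
  intro x
  refine le_antisymm (minNorm_le_maxNorm x) ?_
  let Φ : C →ₗ[ℂ] A := entryMap o o ∘ₗ Θ.toAlgHom.toLinearMap
  have hx : tensorMapHom q q (TensorProduct.map Φ Φ x) = x := by
    induction x using TensorProduct.induction_on with
    | zero => rw [map_zero, map_zero]
    | add x y hx hy => rw [map_add, map_add, hx, hy]
    | tmul a b => exact congrArg₂ (fun a b : C => a ⊗ₜ[ℂ] b) (h a) (h b)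
  -- The chain is `‖x‖_max ≤ ‖(Φ ⊗ Φ) x‖_max = ‖(Φ ⊗ Φ) x‖_min ≤ ‖x‖_min`; the first inequality
  -- holds because `q ⊗ q` maps `(Φ ⊗ Φ) x` back to `x`.
  refine le_trans ?_ (minNorm_map_corner_le Θ Θ o o x)
  rw [hA]
  refine maxNorm_le (maxNorm_nonneg _) fun H _ _ _ π => ?_
  conv_lhs => rw [← hx]
  exact norm_le_maxNorm_of_hilbert (π.comp (tensorMapHom q q)) _

theorem isNuclearPair_freeCyc (k n : ℕ) [NeZero n]
    (h : IsNuclearPair (GroupCStar (FreeGroup (Fin k))) (GroupCStar (FreeGroup (Fin k)))) :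
    IsNuclearPair (GroupCStar (FreeCyc k n)) (GroupCStar (FreeCyc k n)) := by
  obtain ⟨m, _, _, o, θ, hθ⟩ := exists_corner_section k n
  exact .of_corner_section (GroupCStar.lift θ) o _ hθ h

/-! ### Universal families of POVMs in the C⋆-algebras of free groups -/

theorem Commute.unitarySelfAddISMul {A : Type*} [CStarAlgebra A] [PartialOrder A] [StarOrderedRing A]
    (a : selfAdjoint A) (ha : ‖a‖ ≤ 1) {c : A} (h : Commute c (a : A)) :
    Commute c (selfAdjoint.unitarySelfAddISMul a ha : A) := by
  change Commute c ((a : A) + Complex.I • CFC.sqrt (1 - (a : A) ^ 2))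
  refine h.add_right (Commute.smul_right ?_ _)
  rw [CFC.sqrt_eq_cfc]
  exact (((Commute.one_right c).sub_right (h.pow_right 2)).symm.cfc_nnreal _).symm

theorem commute_freeGroup_lift {ι A : Type*} [CStarAlgebra A] {V : ι → unitary A} {c : A}
    (h : ∀ i, Commute c (V i : A)) (g : FreeGroup ι) : Commute c (FreeGroup.lift V g : A) := by
  induction g using FreeGroup.induction_on with
  | C1 => rw [map_one]; exact Commute.one_right _
  | of i => rw [FreeGroup.lift_apply_of]; exact h i
  | inv_of i ih =>
    rw [map_inv]
    exact Commute.units_inv_right (u := Unitary.toUnits (FreeGroup.lift V (FreeGroup.of i))) ih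
  | mul g h hg hh => rw [map_mul]; exact hg.mul_right hh

/-- The unitaries of the free group on `[k] × [n]` generators parametrize all POVMs, by their real
parts. -/
theorem exists_freeGroup_povm (k n : ℕ) [NeZero n] :
    ∃ P : Fin k → Fin n → GroupCStar (FreeGroup (Fin k × Fin n)), (∀ x, IsCStarPOVM (P x)) ∧
      ∀ (A : Type) [CStarAlgebra A] [PartialOrder A] [StarOrderedRing A] (Q : Fin k → Fin n → A),
        (∀ x, IsCStarPOVM (Q x)) → ∃ V : Fin k × Fin n → unitary A,
          (∀ x a, GroupCStar.lift (FreeGroup.lift V) (P x a) = Q x a) ∧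
          ∀ c, (∀ x a, Commute c (Q x a)) → ∀ l, Commute c (V l : A) := by
  -- A self-adjoint contraction `Q` is the real part of the unitary `Q + i √(1 - Q²)`. Real parts of
  -- free unitaries need not form a POVM; the correction by `exists_povm_lift` changes nothing in
  -- representations where they do.
  let h : Fin k → Fin n → GroupCStar (FreeGroup (Fin k × Fin n)) := fun x a =>
    (2 : ℂ)⁻¹ • (GroupCStar.of (FreeGroup.of (x, a)) + star (GroupCStar.of (FreeGroup.of (x, a))))
  choose P hP hPq using fun x => exists_povm_lift.{0, 0} (h x)
  refine ⟨P, hP, fun A _ _ _ Q hQ => ?_⟩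
  let S : Fin k × Fin n → selfAdjoint A := fun l => ⟨Q l.1 l.2, ((hQ l.1).1 l.2).isSelfAdjoint⟩
  have hS : ∀ l, ‖S l‖ ≤ 1 := fun l => (hQ l.1).norm_le_one l.2
  let V : Fin k × Fin n → unitary A := fun l => selfAdjoint.unitarySelfAddISMul (S l) (hS l)
  have hV : ∀ x a, GroupCStar.lift (FreeGroup.lift V) (h x a) = Q x a := fun x a => by
    rw [map_smul, map_add, map_star, GroupCStar.lift_of, FreeGroup.lift_apply_of,
      selfAdjoint.star_coe_unitarySelfAddISMul (S (x, a)) (hS _)]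
    change (2 : ℂ)⁻¹ • ((Q x a + _) + (Q x a - _)) = _
    rw [add_add_sub_cancel, ← two_smul ℂ, smul_smul, inv_mul_cancel₀ two_ne_zero, one_smul]
  refine ⟨V, fun x a => ?_, fun c hc l => Commute.unitarySelfAddISMul _ _ (hc _ _)⟩
  rw [hPq x A, hV]
  simp_rw [hV]
  exact hQ x

/-! ### Permutation matrices and diagonal unitaries -/

section PermMatrix

variable {m A : Type*} [Fintype m] [DecidableEq m] [CStarAlgebra A] [PartialOrder A]
  [StarOrderedRing A]

/-- The permutation matrix of `σ`. -/
def permMatrix (A : Type*) [CStarAlgebra A] (σ : Equiv.Perm m) : CStarMatrix m m A :=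
  fun i j => if i = σ j then 1 else 0

theorem permMatrix_apply (σ : Equiv.Perm m) (i j : m) :
    permMatrix A σ i j = if i = σ j then 1 else 0 := rfl

theorem star_permMatrix_apply (σ : Equiv.Perm m) (i j : m) :
    star (permMatrix A σ) i j = if j = σ i then 1 else 0 := by
  rw [CStarMatrix.star_apply, permMatrix_apply, apply_ite star, star_one, star_zero]

theorem one_apply (i j : m) : (1 : CStarMatrix m m A) i j = if i = j then 1 else 0 := rfl

/-- The permutation matrices over a C⋆-algebra. -/
def permUnitary (m A : Type*) [Fintype m] [DecidableEq m] [CStarAlgebra A] [PartialOrder A]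
    [StarOrderedRing A] : Equiv.Perm m →* unitary (CStarMatrix m m A) where
  toFun σ := ⟨permMatrix A σ, by
    rw [Unitary.mem_iff]
    constructor
    · ext i j
      rw [CStarMatrix.mul_apply]
      simp [star_permMatrix_apply, permMatrix_apply, one_apply, eq_comm]
    · ext i j
      rw [CStarMatrix.mul_apply, Finset.sum_eq_single (σ⁻¹ j)]
      · simp [star_permMatrix_apply, permMatrix_apply, one_apply]
      · intro b _ hb
        rw [star_permMatrix_apply, if_neg, mul_zero]
        rintro rfl
        simp at hb
      · simp⟩
  map_one' := rfl
  map_mul' σ τ := by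
    ext i j
    rw [Submonoid.coe_mul, CStarMatrix.mul_apply]
    simp [permMatrix_apply]
    rfl

theorem permUnitary_apply (σ : Equiv.Perm m) (i j : m) :
    (permUnitary m A σ : CStarMatrix m m A) i j = if i = σ j then 1 else 0 := rfl

/-- The diagonal matrix with entries `V i`. -/
def diagMatrix (V : m → A) : CStarMatrix m m A := fun i j => if i = j then V i else 0

theorem diagMatrix_apply (V : m → A) (i j : m) :
    diagMatrix V i j = if i = j then V i else 0 := rfl

theorem star_diagMatrix_apply (V : m → A) (i j : m) :
    star (diagMatrix V) i j = if j = i then star (V j) else 0 := by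
  rw [CStarMatrix.star_apply, diagMatrix_apply, apply_ite star, star_zero]

/-- The diagonal unitary matrices over a C⋆-algebra. -/
def diagUnitary (V : m → unitary A) : unitary (CStarMatrix m m A) :=
  ⟨diagMatrix fun i => (V i : A), by
    rw [Unitary.mem_iff]
    constructor
    · ext i j
      rw [CStarMatrix.mul_apply]
      by_cases h : i = j
      · simp [star_diagMatrix_apply, diagMatrix_apply, one_apply, h]
      · simp [star_diagMatrix_apply, diagMatrix_apply, h, Ne.symm h]
    · ext i j
      rw [CStarMatrix.mul_apply]
      by_cases h : i = j <;> simp [star_diagMatrix_apply, diagMatrix_apply, one_apply, h]⟩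

theorem diagUnitary_apply (V : m → unitary A) (i j : m) :
    (diagUnitary V : CStarMatrix m m A) i j = if i = j then (V i : A) else 0 := rfl

/-- Conjugation by powers of one cyclic shift brings every entry of a diagonal unitary to a fixed
corner, so two unitaries carry a whole finite family. -/
theorem permUnitary_conj_diagUnitary (σ : Equiv.Perm m) (V : m → unitary A) (i : m) :
    (((permUnitary m A σ)⁻¹ * diagUnitary V * permUnitary m A σ : unitary _) :
      CStarMatrix m m A) i i = V (σ i) := by
  rw [← map_inv, Submonoid.coe_mul, Submonoid.coe_mul, CStarMatrix.mul_apply]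
  simp only [CStarMatrix.mul_apply, permUnitary_apply, diagUnitary_apply]
  simp

end PermMatrix

/-- The words `g₀^{-r} g₁ g₀^r` replace the `k n` free generators. Sending `g₀` to the cyclic shift
and `g₁` to the diagonal matrix of the `V l`, the corner of the `r`-th word is the unitary with
number `r`, and `lift_corner_eq` extends this from words to the C⋆-algebra. Freeness of the words is
not needed. -/
theorem exists_isUniversalPOVM_freeGroup {ι : Type} {i₀ i₁ : ι} (hi : i₀ ≠ i₁) (k n : ℕ) [NeZero k]
    [NeZero n] : ∃ P : Fin k → Fin n → GroupCStar (FreeGroup ι), IsUniversalPOVM P := by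
  classical
  obtain ⟨P, hP, hPu⟩ := exists_freeGroup_povm k n
  let e : Fin k × Fin n ≃ ZMod (k * n) := finProdFinEquiv.trans (ZMod.finEquiv (k * n)).toEquiv
  let f : FreeGroup (Fin k × Fin n) →* FreeGroup ι := FreeGroup.lift fun l =>
    (FreeGroup.of i₀ ^ (e l).val)⁻¹ * FreeGroup.of i₁ * FreeGroup.of i₀ ^ (e l).val
  refine ⟨fun x a => GroupCStar.map f (P x a), fun x => (hP x).map _, fun A _ _ _ Q hQ => ?_⟩
  obtain ⟨V, hV, hc⟩ := hPu A Q hQ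
  let s := permUnitary (ZMod (k * n)) A (Equiv.addRight 1)
  let d := diagUnitary fun z : ZMod (k * n) => V (e.symm z)
  let θ : FreeGroup ι →* unitary (CStarMatrix (ZMod (k * n)) (ZMod (k * n)) A) :=
    FreeGroup.lift fun i => if i = i₀ then s else if i = i₁ then d else 1
  have hθ : ∀ l, (θ (f (FreeGroup.of l)) : CStarMatrix (ZMod (k * n)) (ZMod (k * n)) A) 0 0
      = V l := fun l => by
    have h : θ (f (FreeGroup.of l)) = (permUnitary _ A (Equiv.addRight 1 ^ (e l).val))⁻¹ * d *
        permUnitary _ A (Equiv.addRight 1 ^ (e l).val) := by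
      simp only [f, θ, FreeGroup.lift_apply_of, map_mul, map_inv, map_pow, if_pos, if_neg hi.symm]
      rfl
    have h0 : ∀ r : ℕ, (Equiv.addRight (1 : ZMod (k * n)) ^ r) 0 = r := fun r => by
      induction r with
      | zero => simp
      | succ r ih => rw [pow_succ', Equiv.Perm.mul_apply, ih]; simp
    rw [h, permUnitary_conj_diagUnitary, h0, ZMod.natCast_zmod_val, Equiv.symm_apply_apply]
  refine ⟨ZMod (k * n), inferInstance, inferInstance, 0, θ, fun x a => ?_, fun c h g => ?_⟩
  · rw [GroupCStar.lift_map, ← hV]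
    refine lift_corner_eq (θ.comp f) (FreeGroup.lift V) 0 _ (FreeGroup.closure_range_of _) ?_ _
    rintro _ ⟨l, rfl⟩
    rw [FreeGroup.lift_apply_of]
    exact hθ l
  · refine commute_freeGroup_lift (c := diagHom _ A c) (fun i => ?_) g
    split_ifs
    · rw [commute_diagHom_iff]
      intro i j
      rw [permUnitary_apply]
      split_ifs
      · exact Commute.one_right _
      · exact Commute.zero_right _
    · rw [commute_diagHom_iff]
      intro i j
      rw [diagUnitary_apply]
      split_ifs
      · exact hc c h _
      · exact Commute.zero_right _
    · exact Commute.one_right _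

/-! ### The set of quantum correlations -/

section Adjoint

variable {E E' F F' : Type*} [NormedAddCommGroup E] [InnerProductSpace ℂ E] [CompleteSpace E]
  [NormedAddCommGroup E'] [InnerProductSpace ℂ E'] [CompleteSpace E']
  [NormedAddCommGroup F] [InnerProductSpace ℂ F] [CompleteSpace F]
  [NormedAddCommGroup F'] [InnerProductSpace ℂ F'] [CompleteSpace F']

theorem inner_map_adjoint (T : E →L[ℂ] E') (S : F →L[ℂ] F') (ξ : E ⊗[ℂ] F) (η : E' ⊗[ℂ] F') :
    inner ℂ (TensorProduct.map (T : E →ₗ[ℂ] E') (S : F →ₗ[ℂ] F') ξ) η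
      = inner ℂ ξ (TensorProduct.map (ContinuousLinearMap.adjoint T : E' →ₗ[ℂ] E)
          (ContinuousLinearMap.adjoint S : F' →ₗ[ℂ] F) η) := by
  induction ξ using TensorProduct.induction_on with
  | zero => simp
  | add x y hx hy => rw [map_add, inner_add_left, inner_add_left, hx, hy]
  | tmul x y =>
    induction η using TensorProduct.induction_on with
    | zero => simp
    | add x y hx hy => rw [map_add, inner_add_right, inner_add_right, hx, hy]
    | tmul z w =>
      simp [TensorProduct.inner_tmul, ContinuousLinearMap.adjoint_inner_right]

end Adjoint

theorem IsPOVM.compress {n : ℕ} {H K : Type*} [NormedAddCommGroup H] [InnerProductSpace ℂ H]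
    [CompleteSpace H] [NormedAddCommGroup K] [InnerProductSpace ℂ K] [CompleteSpace K]
    {P : Fin n → H →L[ℂ] H} (hP : IsPOVM P) (V : K →ₗᵢ[ℂ] H) :
    IsPOVM fun a => ContinuousLinearMap.adjoint V.toContinuousLinearMap ∘L P a ∘L
      V.toContinuousLinearMap := by
  refine ⟨fun a => (hP.isPositive a).adjoint_conj _, ?_⟩
  have h : ∑ a, ContinuousLinearMap.adjoint V.toContinuousLinearMap ∘L P a ∘L
      V.toContinuousLinearMap = ContinuousLinearMap.adjoint V.toContinuousLinearMap ∘L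
        (∑ a, P a) ∘L V.toContinuousLinearMap := by
    ext x
    simp [sum_apply]
  rw [h, hP.sum_eq_one]
  refine ContinuousLinearMap.ext fun x => ext_inner_left ℂ fun y => ?_
  simp [ContinuousLinearMap.adjoint_inner_right]

theorem IsPOVM.isSelfAdjoint {n : ℕ} {H : Type*} [NormedAddCommGroup H] [InnerProductSpace ℂ H]
    [CompleteSpace H] {P : Fin n → H →L[ℂ] H} (hP : IsPOVM P) (a : Fin n) : star (P a) = P a :=
  (hP.isPositive a).isSelfAdjoint

section Hilbert

variable {k n : ℕ} {HA HB : Type} [NormedAddCommGroup HA] [InnerProductSpace ℂ HA]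
  [CompleteSpace HA] [NormedAddCommGroup HB] [InnerProductSpace ℂ HB] [CompleteSpace HB]

/-- The correlation of a pair of families of POVMs and a vector in the algebraic tensor product. -/
def tensorCorrelation (A : Fin k → Fin n → HA →L[ℂ] HA) (B : Fin k → Fin n → HB →L[ℂ] HB)
    (ψ : HA ⊗[ℂ] HB) : Correlation k n := fun a b x y =>
  (inner ℂ ψ (TensorProduct.map (A x a : HA →ₗ[ℂ] HA) (B y b : HB →ₗ[ℂ] HB) ψ)).re

theorem coe_tensorCorrelation {A : Fin k → Fin n → HA →L[ℂ] HA} {B : Fin k → Fin n → HB →L[ℂ] HB}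
    (hA : ∀ x, IsPOVM (A x)) (hB : ∀ y, IsPOVM (B y)) (ψ : HA ⊗[ℂ] HB) (a b : Fin n)
    (x y : Fin k) : (tensorCorrelation A B ψ a b x y : ℂ)
      = inner ℂ ψ (TensorProduct.map (A x a : HA →ₗ[ℂ] HA) (B y b : HB →ₗ[ℂ] HB) ψ) := by
  refine Complex.conj_eq_iff_re.1 ?_
  refine (inner_conj_symm (𝕜 := ℂ) (E := HA ⊗[ℂ] HB) _ _).trans ?_
  rw [inner_tensorMap, (hA x).isSelfAdjoint, (hB y).isSelfAdjoint]

/-- Correlations of vectors in the algebraic tensor product of arbitrary Hilbert spaces are quantum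
correlations. -/
theorem tensorCorrelation_mem_Cq {A : Fin k → Fin n → HA →L[ℂ] HA}
    {B : Fin k → Fin n → HB →L[ℂ] HB} (hA : ∀ x, IsPOVM (A x)) (hB : ∀ y, IsPOVM (B y))
    {ψ : HA ⊗[ℂ] HB} (hψ : ‖ψ‖ = 1) : tensorCorrelation A B ψ ∈ Cq k n := by
  -- An algebraic tensor involves finitely many vectors on each side, so the strategy compresses to
  -- finite-dimensional subspaces; compressions of POVMs are POVMs.
  obtain ⟨E, F, hE, hF, h⟩ :=
    TensorProduct.exists_finite_submodule_of_setFinite {ψ} (Set.finite_singleton ψ)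
  obtain ⟨φ, rfl⟩ := h rfl
  have : FiniteDimensional ℂ E := hE
  have : FiniteDimensional ℂ F := hF
  have : CompleteSpace E := FiniteDimensional.complete ℂ E
  have : CompleteSpace F := FiniteDimensional.complete ℂ F
  refine ⟨E, inferInstance, inferInstance, inferInstance, inferInstance, F, inferInstance,
    inferInstance, inferInstance, inferInstance, _, _, φ,
    fun x => (hA x).compress E.subtypeₗᵢ, fun y => (hB y).compress F.subtypeₗᵢ, ?_, ?_⟩
  · rw [← hψ]
    exact (TensorProduct.norm_map E.subtypeₗᵢ F.subtypeₗᵢ φ).symm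
  · intro a b x y
    rw [coe_tensorCorrelation hA hB]
    change inner ℂ (TensorProduct.map (E.subtypeₗᵢ.toContinuousLinearMap : E →ₗ[ℂ] HA)
      (F.subtypeₗᵢ.toContinuousLinearMap : F →ₗ[ℂ] HB) φ) _ = _
    rw [inner_map_adjoint]
    change inner ℂ φ ((TensorProduct.map _ _ ∘ₗ TensorProduct.map _ _ ∘ₗ TensorProduct.map _ _) φ) = _
    rw [← TensorProduct.map_comp, ← TensorProduct.map_comp]
    rfl

end Hilbert

/-! ### Direct sums of strategies and convexity of `C_q` -/

section DirectSum

variable {H K : Type} [NormedAddCommGroup H] [InnerProductSpace ℂ H] [CompleteSpace H]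
  [NormedAddCommGroup K] [InnerProductSpace ℂ K] [CompleteSpace K]

/-- The direct sum of two operators. -/
def directSumOp (T : H →L[ℂ] H) (S : K →L[ℂ] K) : WithLp 2 (H × K) →L[ℂ] WithLp 2 (H × K) :=
  ((WithLp.prodContinuousLinearEquiv 2 ℂ H K).symm : _ →L[ℂ] _) ∘L T.prodMap S ∘L
    (WithLp.prodContinuousLinearEquiv 2 ℂ H K : _ →L[ℂ] _)

theorem directSumOp_apply (T : H →L[ℂ] H) (S : K →L[ℂ] K) (v : WithLp 2 (H × K)) :
    directSumOp T S v = WithLp.toLp 2 (T v.fst, S v.snd) := rfl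

theorem IsPOVM.directSum {n : ℕ} {P : Fin n → H →L[ℂ] H} {Q : Fin n → K →L[ℂ] K} (hP : IsPOVM P)
    (hQ : IsPOVM Q) : IsPOVM fun a => directSumOp (P a) (Q a) := by
  refine ⟨fun a => ?_, ?_⟩
  · rw [ContinuousLinearMap.isPositive_def']
    refine ⟨?_, fun v => ?_⟩
    · rw [ContinuousLinearMap.isSelfAdjoint_iff_isSymmetric]
      intro v w
      change inner ℂ (directSumOp _ _ v) w = inner ℂ v (directSumOp _ _ w)
      rw [directSumOp_apply, directSumOp_apply, WithLp.prod_inner_apply, WithLp.prod_inner_apply]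
      exact congrArg₂ _ ((hP.isPositive a).isSymmetric _ _) ((hQ.isPositive a).isSymmetric _ _)
    · rw [ContinuousLinearMap.reApplyInnerSelf_apply, directSumOp_apply, WithLp.prod_inner_apply,
        map_add]
      exact add_nonneg ((hP.isPositive a).re_inner_nonneg_left _)
        ((hQ.isPositive a).re_inner_nonneg_left _)
  · refine ContinuousLinearMap.ext fun v => ?_
    have h1 := DFunLike.congr_fun hP.sum_eq_one v.fst
    have h2 := DFunLike.congr_fun hQ.sum_eq_one v.snd
    rw [sum_apply] at h1 h2 ⊢
    simp_rw [directSumOp_apply]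
    rw [← WithLp.toLp_sum, ← prod_mk_sum, h1, h2]
    rfl

variable (H K) in
/-- The inclusion of the first summand. -/
def inlL : H →ₗᵢ[ℂ] WithLp 2 (H × K) :=
  LinearMap.isometryOfInner
    ((WithLp.linearEquiv 2 ℂ (H × K)).symm.toLinearMap ∘ₗ LinearMap.inl ℂ H K) fun x y => by
      rw [WithLp.prod_inner_apply]; simp

variable (H K) in
/-- The inclusion of the second summand. -/
def inrL : K →ₗᵢ[ℂ] WithLp 2 (H × K) :=
  LinearMap.isometryOfInner
    ((WithLp.linearEquiv 2 ℂ (H × K)).symm.toLinearMap ∘ₗ LinearMap.inr ℂ H K) fun x y => by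
      rw [WithLp.prod_inner_apply]; simp

theorem directSumOp_inlL (T : H →L[ℂ] H) (S : K →L[ℂ] K) :
    (directSumOp T S : _ →ₗ[ℂ] _) ∘ₗ (inlL H K).toLinearMap = (inlL H K).toLinearMap ∘ₗ T := by
  refine LinearMap.ext fun x => ?_
  change WithLp.toLp 2 (T x, S 0) = WithLp.toLp 2 (T x, 0)
  rw [map_zero]

theorem directSumOp_inrL (T : H →L[ℂ] H) (S : K →L[ℂ] K) :
    (directSumOp T S : _ →ₗ[ℂ] _) ∘ₗ (inrL H K).toLinearMap = (inrL H K).toLinearMap ∘ₗ S := by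
  refine LinearMap.ext fun x => ?_
  change WithLp.toLp 2 (T 0, S x) = WithLp.toLp 2 (0, S x)
  rw [map_zero]

theorem inner_inlL_inrL (x : H) (y : K) : inner ℂ (inlL H K x) (inrL H K y) = 0 := by
  rw [WithLp.prod_inner_apply]
  simp [inlL, inrL]

variable {H' K' : Type} [NormedAddCommGroup H'] [InnerProductSpace ℂ H'] [CompleteSpace H']
  [NormedAddCommGroup K'] [InnerProductSpace ℂ K'] [CompleteSpace K']

theorem inner_map_inlL_map_inrL (ξ : H ⊗[ℂ] H') (η : K ⊗[ℂ] K') :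
    inner ℂ (TensorProduct.map (inlL H K).toLinearMap (inlL H' K').toLinearMap ξ)
      (TensorProduct.map (inrL H K).toLinearMap (inrL H' K').toLinearMap η) = 0 := by
  induction ξ using TensorProduct.induction_on with
  | zero => simp
  | add x y hx hy => rw [map_add, inner_add_left, hx, hy, add_zero]
  | tmul x y =>
    induction η using TensorProduct.induction_on with
    | zero => simp
    | add x y hx hy => rw [map_add, inner_add_right, hx, hy, add_zero]
    | tmul z w =>
      rw [TensorProduct.map_tmul, TensorProduct.map_tmul, TensorProduct.inner_tmul]
      change inner ℂ (inlL H K x) (inrL H K z) * _ = 0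
      rw [inner_inlL_inrL, zero_mul]

theorem inner_smul_add_smul {V : Type*} [NormedAddCommGroup V] [InnerProductSpace ℂ V] (r s : ℝ)
    (u u' v v' : V) (h : inner ℂ u v' = 0) (h' : inner ℂ v u' = 0) :
    inner ℂ ((r : ℂ) • u + (s : ℂ) • v) ((r : ℂ) • u' + (s : ℂ) • v')
      = (r ^ 2 : ℝ) * inner ℂ u u' + (s ^ 2 : ℝ) * inner ℂ v v' := by
  simp only [inner_add_left, inner_add_right, inner_smul_left, inner_smul_right, h, h',
    Complex.conj_ofReal]
  push_cast
  ring

theorem inner_smul_map_add (r s : ℝ) (ξ ξ' : H ⊗[ℂ] H') (η η' : K ⊗[ℂ] K') :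
    inner ℂ ((r : ℂ) • TensorProduct.map (inlL H K).toLinearMap (inlL H' K').toLinearMap ξ
        + (s : ℂ) • TensorProduct.map (inrL H K).toLinearMap (inrL H' K').toLinearMap η)
      ((r : ℂ) • TensorProduct.map (inlL H K).toLinearMap (inlL H' K').toLinearMap ξ'
        + (s : ℂ) • TensorProduct.map (inrL H K).toLinearMap (inrL H' K').toLinearMap η')
      = (r ^ 2 : ℝ) * inner ℂ ξ ξ' + (s ^ 2 : ℝ) * inner ℂ η η' := by
  refine (inner_smul_add_smul r s _ _ _ _ (inner_map_inlL_map_inrL _ _) ?_).trans ?_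
  · refine (inner_conj_symm (𝕜 := ℂ) (E := WithLp 2 (H × K) ⊗[ℂ] WithLp 2 (H' × K')) _ _).symm.trans ?_
    rw [inner_map_inlL_map_inrL, map_zero]
  · rw [TensorProduct.inner_map_map, TensorProduct.inner_map_map]

end DirectSum

/-- Direct sums of the operators, with the vector `√t ψ ⊕ √t' ψ'` supported in the two diagonal
blocks; the cross terms vanish because the blocks are orthogonal and invariant. -/
theorem convex_Cq (k n : ℕ) : Convex ℝ (Cq k n) := by
  rintro p ⟨HA, _, _, _, _, HB, _, _, _, _, A, B, ψ, hA, hB, hψ, hp⟩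
    p' ⟨HA', _, _, _, _, HB', _, _, _, _, A', B', ψ', hA', hB', hψ', hp'⟩ t t' ht ht' htt
  let φ := ((√t : ℝ) : ℂ) • TensorProduct.map (inlL HA HA').toLinearMap (inlL HB HB').toLinearMap ψ
    + ((√t' : ℝ) : ℂ) • TensorProduct.map (inrL HA HA').toLinearMap (inrL HB HB').toLinearMap ψ'
  have hφ : ‖φ‖ = 1 := by
    have h : ((‖φ‖ : ℂ)) ^ 2 = 1 := by
      have h1 := inner_self_eq_norm_sq_to_K (𝕜 := ℂ) φ
      rw [inner_smul_map_add, Real.sq_sqrt ht, Real.sq_sqrt ht'] at h1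
      have h2 := inner_self_eq_norm_sq_to_K (𝕜 := ℂ) ψ
      have h3 := inner_self_eq_norm_sq_to_K (𝕜 := ℂ) ψ'
      rw [hψ] at h2
      rw [hψ'] at h3
      refine h1.symm.trans ?_
      refine (congrArg₂ (fun u v => (t : ℂ) * u + (t' : ℂ) * v) h2 h3).trans ?_
      simp only [RCLike.ofReal_one, one_pow, mul_one]
      exact_mod_cast htt
    have h' : ‖φ‖ ^ 2 = 1 := by exact_mod_cast h
    exact (pow_eq_one_iff_of_nonneg (norm_nonneg _) two_ne_zero).1 h'
  have hS := fun x => (hA x).directSum (hA' x)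
  have hT := fun y => (hB y).directSum (hB' y)
  convert tensorCorrelation_mem_Cq hS hT hφ using 1
  funext a b x y
  have h := coe_tensorCorrelation hS hT φ a b x y
  have e : TensorProduct.map (directSumOp (A x a) (A' x a) : _ →ₗ[ℂ] _)
      (directSumOp (B y b) (B' y b) : _ →ₗ[ℂ] _) φ
      = ((√t : ℝ) : ℂ) • TensorProduct.map (inlL HA HA').toLinearMap (inlL HB HB').toLinearMap
          (TensorProduct.map (A x a : HA →ₗ[ℂ] HA) (B y b : HB →ₗ[ℂ] HB) ψ)
        + ((√t' : ℝ) : ℂ) • TensorProduct.map (inrL HA HA').toLinearMap (inrL HB HB').toLinearMap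
          (TensorProduct.map (A' x a : HA' →ₗ[ℂ] HA') (B' y b : HB' →ₗ[ℂ] HB') ψ') := by
    rw [map_add, map_smul, map_smul]
    simp only [← LinearMap.comp_apply, ← TensorProduct.map_comp, directSumOp_inlL,
      directSumOp_inrL]
  rw [e, inner_smul_map_add, Real.sq_sqrt ht, Real.sq_sqrt ht', ← hp, ← hp'] at h
  exact_mod_cast h.symm

/-! ### Linear functionals on correlations and separation from `C_qa` -/

theorem apply_eq_sum_single {ι M : Type*} [Fintype ι] [DecidableEq ι] [AddCommGroup M] [Module ℝ M]
    (f : (ι → M) →ₗ[ℝ] ℝ) (v : ι → M) : f v = ∑ i, f (Pi.single i (v i)) := by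
  conv_lhs => rw [← Finset.univ_sum_single v]
  exact map_sum f _ _

/-- The linear functional on correlations with the coefficients `c`. -/
def Correlation.pairing {k n : ℕ} (c p : Correlation k n) : ℝ :=
  ∑ a, ∑ b, ∑ x, ∑ y, c a b x y * p a b x y

theorem exists_pairing {k n : ℕ} (f : Correlation k n →ₗ[ℝ] ℝ) :
    ∃ c : Correlation k n, ∀ p, f p = c.pairing p := by
  refine ⟨fun a b x y => f (Pi.single a (Pi.single b (Pi.single x (Pi.single y 1)))), fun p => ?_⟩
  rw [apply_eq_sum_single f]
  refine Finset.sum_congr rfl fun a _ => ?_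
  rw [← LinearMap.coe_single ℝ, ← LinearMap.comp_apply, apply_eq_sum_single]
  refine Finset.sum_congr rfl fun b _ => ?_
  rw [← LinearMap.coe_single ℝ, ← LinearMap.comp_apply, apply_eq_sum_single]
  refine Finset.sum_congr rfl fun x _ => ?_
  rw [← LinearMap.coe_single ℝ, ← LinearMap.comp_apply, apply_eq_sum_single]
  refine Finset.sum_congr rfl fun y _ => ?_
  rw [mul_comm, ← smul_eq_mul, ← map_smul, ← Pi.single_smul', ← Pi.single_smul', ← Pi.single_smul',
    ← Pi.single_smul', smul_eq_mul, mul_one]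
  rfl

/-- Hahn–Banach for the closed convex set `C_qa`: membership is tested by the linear (Bell)
inequalities valid on `C_q`. -/
theorem mem_Cqa_of_pairing_le {k n : ℕ} {p : Correlation k n}
    (h : ∀ (c : Correlation k n) (s : ℝ), (∀ q ∈ Cq k n, c.pairing q ≤ s) → c.pairing p ≤ s) :
    p ∈ Cqa k n := by
  by_contra hp
  obtain ⟨f, s, hf, hs⟩ := geometric_hahn_banach_closed_point (convex_Cq k n).closure
    isClosed_closure hp
  obtain ⟨c, hc⟩ := exists_pairing (f : Correlation k n →ₗ[ℝ] ℝ)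
  have h1 := h c s fun q hq => by
    rw [← hc]; exact (hf q (subset_closure hq)).le
  rw [← hc] at h1
  exact absurd h1 (not_le.2 hs)

/-! ### Quantum commuting correlations -/

/-- A quantum commuting correlation arises from commuting representations of any two group
C⋆-algebras with universal families of POVMs. -/
theorem exists_dilation_of_mem_Cqc {G₁ G₂ : Type} [Group G₁] [Group G₂] {k n : ℕ}
    {P : Fin k → Fin n → GroupCStar G₁} {Q : Fin k → Fin n → GroupCStar G₂}
    (hP : IsUniversalPOVM P) (hQ : IsUniversalPOVM Q) {p : Correlation k n} (hp : p ∈ Cqc k n) :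
    ∃ (K : Type) (_ : NormedAddCommGroup K) (_ : InnerProductSpace ℂ K) (_ : CompleteSpace K)
      (π : G₁ →* unitary (K →L[ℂ] K)) (ρ : G₂ →* unitary (K →L[ℂ] K)) (η : K),
      (∀ g h, Commute (π g) (ρ h)) ∧ ‖η‖ = 1 ∧ ∀ a b x y, (p a b x y : ℂ)
        = inner ℂ η ((GroupCStar.lift π (P x a) * GroupCStar.lift ρ (Q y b)) η) := by
  obtain ⟨H, _, _, _, A, B, ξ, hA, hB, hAB, hξ, hp⟩ := hp
  -- First the family `A` is dilated over `B(H)`; then `B`, placed diagonally, is dilated over the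
  -- resulting matrix algebra.
  obtain ⟨m, _, _, o, θ, hθ, hθc⟩ := hP.2 _ A fun x => isPOVM_iff.1 (hA x)
  let D : Fin k → Fin n → CStarMatrix m m (H →L[ℂ] H) := fun y b => diagHom m _ (B y b)
  obtain ⟨m', _, _, o', θ', hθ', hθc'⟩ := hQ.2 _ D fun y => (isPOVM_iff.1 (hB y)).map _
  let τ := (matOp m' (PiLp 2 fun _ : m => H)).comp (matHom m' (matOp m H))
  let π := ((unitaryMap τ).comp (unitaryMap (diagHom m' (CStarMatrix m m (H →L[ℂ] H))))).comp θ
  let ρ := (unitaryMap τ).comp θ'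
  have hπ : ∀ z, GroupCStar.lift π z = τ (diagHom m' _ (GroupCStar.lift θ z)) := by
    have h : GroupCStar.lift π = (τ.comp (diagHom m' _)).comp (GroupCStar.lift θ) :=
      GroupCStar.hom_ext fun g => by
        rw [StarAlgHom.comp_apply, GroupCStar.lift_of, GroupCStar.lift_of]; rfl
    exact DFunLike.congr_fun h
  have hρ : ∀ z, GroupCStar.lift ρ z = τ (GroupCStar.lift θ' z) := by
    have h : GroupCStar.lift ρ = τ.comp (GroupCStar.lift θ') :=
      GroupCStar.hom_ext fun g => by
        rw [StarAlgHom.comp_apply, GroupCStar.lift_of, GroupCStar.lift_of]; rfl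
    exact DFunLike.congr_fun h
  refine ⟨_, inferInstance, inferInstance, inferInstance, π, ρ,
    inclL (PiLp 2 fun _ : m => H) o' (inclL H o ξ), fun g h => ?_, ?_, fun a b x y => ?_⟩
  · refine Subtype.ext ?_
    -- Both commutation clauses are used in turn: `B y b` commutes with `A`, so its diagonal
    -- commutes with `θ g`; thus `θ g` commutes with `D`, so its diagonal commutes with `θ' h`.
    have h1 : Commute (diagHom m' _ (θ g : CStarMatrix m m (H →L[ℂ] H)))
        (θ' h : CStarMatrix m' m' (CStarMatrix m m (H →L[ℂ] H))) :=
      hθc' _ (fun y b => (hθc (B y b) (fun x a => (hAB x y a b).symm) g).symm) h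
    exact h1.map τ
  · rw [LinearIsometry.norm_map, LinearIsometry.norm_map, hξ]
  · rw [hp, hπ, hρ, ← map_mul]
    have hτ : ∀ M, τ M = matOp m' (PiLp 2 fun _ : m => H) (matHom m' (matOp m H) M) := fun _ => rfl
    rw [hτ, inner_inclL_matOp, matHom_apply, inner_inclL_matOp, diagHom_mul_apply, hθ',
      mul_diagHom_apply, hθ]

/-- A vector state on operators, restricted along a ⋆-homomorphism. -/
def vectorFunctional {A : Type*} [CStarAlgebra A] [PartialOrder A] [StarOrderedRing A] {K : Type*}
    [NormedAddCommGroup K] [InnerProductSpace ℂ K] [CompleteSpace K] (π : A →⋆ₐ[ℂ] (K →L[ℂ] K))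
    (η : K) : A →ₚ[ℂ] ℂ :=
  PositiveLinearMap.mk₀
    { toFun := fun a => inner ℂ η (π a η)
      map_add' := fun a b => by rw [map_add, add_apply, inner_add_right]
      map_smul' := fun c a => by rw [map_smul, smul_apply, inner_smul_right]; rfl }
    fun a ha => by
      have h := (ContinuousLinearMap.nonneg_iff_isPositive _).1 (map_nonneg π ha)
      exact h.inner_nonneg_right η

theorem vectorFunctional_apply {A : Type*} [CStarAlgebra A] [PartialOrder A] [StarOrderedRing A]
    {K : Type*} [NormedAddCommGroup K] [InnerProductSpace ℂ K] [CompleteSpace K]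
    (π : A →⋆ₐ[ℂ] (K →L[ℂ] K)) (η : K) (a : A) :
    vectorFunctional π η a = inner ℂ η (π a η) := rfl

theorem norm_vectorFunctional_le {A : Type*} [CStarAlgebra A] [PartialOrder A] [StarOrderedRing A]
    {K : Type*} [NormedAddCommGroup K] [InnerProductSpace ℂ K] [CompleteSpace K]
    (π : A →⋆ₐ[ℂ] (K →L[ℂ] K)) {η : K} (hη : ‖η‖ = 1) (a : A) :
    ‖vectorFunctional π η a‖ ≤ ‖a‖ := by
  rw [vectorFunctional_apply]
  refine (norm_inner_le_norm _ _).trans ?_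
  rw [hη, one_mul]
  refine ((π a).le_opNorm η).trans ?_
  rw [hη, mul_one]
  exact NonUnitalStarAlgHom.norm_apply_le π a

/-- Correlations given by a state and commuting families of POVMs are quantum commuting. -/
theorem mem_Cqc_of_state {A : Type} [CStarAlgebra A] [PartialOrder A] [StarOrderedRing A] {k n : ℕ}
    {P Q : Fin k → Fin n → A} (hP : ∀ x, IsCStarPOVM (P x)) (hQ : ∀ y, IsCStarPOVM (Q y))
    (hPQ : ∀ x y a b, Commute (P x a) (Q y b)) {φ : A →ₚ[ℂ] ℂ} (hφ : φ 1 = 1)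
    {p : Correlation k n} (hp : ∀ a b x y, (p a b x y : ℂ) = φ (P x a * Q y b)) :
    p ∈ Cqc k n := by
  refine ⟨φ.GNS, inferInstance, inferInstance, inferInstance, fun x a => φ.gnsStarAlgHom (P x a),
    fun y b => φ.gnsStarAlgHom (Q y b), gnsVector φ 1, fun x => isPOVM_iff.2 ((hP x).map _),
    fun y => isPOVM_iff.2 ((hQ y).map _), fun x y a b => (hPQ x y a b).map _, ?_,
    fun a b x y => ?_⟩
  · have h := inner_self_eq_norm_sq_to_K (𝕜 := ℂ) (gnsVector φ 1)
    rw [inner_gnsVector, star_one, mul_one, hφ] at h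
    have h' : ‖gnsVector φ 1‖ ^ 2 = 1 := Complex.ofReal_injective (by push_cast; exact h.symm)
    exact (pow_eq_one_iff_of_nonneg (norm_nonneg _) two_ne_zero).1 h'
  · rw [hp, ← map_mul, gnsStarAlgHom_gnsVector, inner_gnsVector, star_one, one_mul, mul_one]

/-! ### Commuting correlations as images of states of `C⋆(G₁ × G₂)` -/

section Product

variable {G₁ G₂ : Type} [Group G₁] [Group G₂] {k n : ℕ}

theorem GroupCStar.commute_map_inl_map_inr (z : GroupCStar G₁) (w : GroupCStar G₂) :
    Commute (GroupCStar.map (MonoidHom.inl G₁ G₂) z) (GroupCStar.map (MonoidHom.inr G₁ G₂) w) := by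
  refine GroupCStar.commute_lift (fun h => Commute.symm (GroupCStar.commute_lift (fun g => ?_) z)) w
  have h1 : Commute (MonoidHom.inl G₁ G₂ g) (MonoidHom.inr G₁ G₂ h) := MonoidHom.commute_inl_inr g h
  exact ((h1.map GroupCStar.unitaryOf).map (unitary _).subtype).symm

/-- The states of `A`, as bounded functions. -/
def stateFunctions (A : Type*) [CStarAlgebra A] [PartialOrder A] : Set (A → ℂ) :=
  {φ | (∀ z, ‖φ z‖ ≤ ‖z‖) ∧ (∀ z w, φ (z + w) = φ z + φ w) ∧ (∀ (c : ℂ) z, φ (c • z) = c * φ z) ∧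
    φ 1 = 1 ∧ ∀ z, 0 ≤ z → 0 ≤ φ z}

/-- The Banach–Alaoglu argument: a closed subset of a product of discs, compact by Tychonoff. -/
theorem isCompact_stateFunctions (A : Type*) [CStarAlgebra A] [PartialOrder A] :
    IsCompact (stateFunctions A) := by
  have h : IsCompact (Set.univ.pi fun z : A => Metric.closedBall (0 : ℂ) ‖z‖) :=
    isCompact_univ_pi fun z => isCompact_closedBall 0 ‖z‖
  refine h.of_isClosed_subset ?_ fun φ hφ z _ => by
    rw [mem_closedBall_zero_iff]; exact hφ.1 z
  have e : ∀ z : A, Continuous fun φ : A → ℂ => φ z := fun z => continuous_apply z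
  have hc : IsClosed {c : ℂ | 0 ≤ c} := isClosed_Ici
  simp only [stateFunctions, Set.ofPred_and, Set.ofPred_forall]
  refine IsClosed.inter ?_ (IsClosed.inter ?_ (IsClosed.inter ?_ (IsClosed.inter ?_ ?_)))
  · exact isClosed_iInter fun z => isClosed_le (e z).norm continuous_const
  · exact isClosed_iInter fun z => isClosed_iInter fun w =>
      isClosed_eq (e _) ((e z).add (e w))
  · exact isClosed_iInter fun c => isClosed_iInter fun z =>
      isClosed_eq (e _) (continuous_const.mul (e z))
  · exact isClosed_eq (e 1) continuous_const
  · exact isClosed_iInter fun z => isClosed_iInter fun _ => hc.preimage (e z)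

/-- Commuting representations of `G₁` and `G₂` are a representation of `G₁ × G₂`, so one C⋆-algebra
accounts for the strategies on all Hilbert spaces, and compactness of `C_qc` reduces to that of its
states. -/
theorem Cqc_eq_image {P : Fin k → Fin n → GroupCStar G₁} {Q : Fin k → Fin n → GroupCStar G₂}
    (hP : IsUniversalPOVM P) (hQ : IsUniversalPOVM Q) :
    Cqc k n = (fun (φ : GroupCStar (G₁ × G₂) → ℂ) a b x y =>
      (φ (GroupCStar.map (MonoidHom.inl G₁ G₂) (P x a) *
        GroupCStar.map (MonoidHom.inr G₁ G₂) (Q y b))).re) '' stateFunctions _ := by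
  refine Set.Subset.antisymm (fun p hp => ?_) ?_
  · obtain ⟨K, _, _, _, π, ρ, η, hc, hη, hp⟩ := exists_dilation_of_mem_Cqc hP hQ hp
    let σ := MonoidHom.noncommCoprod π ρ hc
    refine ⟨vectorFunctional (GroupCStar.lift σ) η, ⟨norm_vectorFunctional_le _ hη,
      fun z w => map_add _ z w, fun c z => map_smul _ c z, ?_, fun z hz => map_nonneg _ hz⟩, ?_⟩
    · rw [vectorFunctional_apply, map_one]
      have h := inner_self_eq_norm_sq_to_K (𝕜 := ℂ) η
      rw [hη] at h
      simpa using h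
    · funext a b x y
      change Complex.re (vectorFunctional (GroupCStar.lift σ) η _) = _
      rw [vectorFunctional_apply, map_mul, GroupCStar.lift_map, GroupCStar.lift_map,
        MonoidHom.noncommCoprod_comp_inl, MonoidHom.noncommCoprod_comp_inr, ← hp,
        Complex.ofReal_re]
  · rintro _ ⟨φ, ⟨-, hadd, hsmul, h1, hpos⟩, rfl⟩
    let ψ : GroupCStar (G₁ × G₂) →ₚ[ℂ] ℂ := PositiveLinearMap.mk₀
      { toFun := φ, map_add' := hadd, map_smul' := hsmul } hpos
    refine mem_Cqc_of_state (φ := ψ) (fun x => (hP.1 x).map _) (fun y => (hQ.1 y).map _)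
      (fun x y a b => GroupCStar.commute_map_inl_map_inr _ _) h1 fun a b x y => ?_
    -- A product of commuting positive elements is positive, so the value is real and taking the
    -- real part loses nothing.
    have hnn : 0 ≤ ψ (GroupCStar.map (MonoidHom.inl G₁ G₂) (P x a) *
        GroupCStar.map (MonoidHom.inr G₁ G₂) (Q y b)) :=
      map_nonneg ψ ((GroupCStar.commute_map_inl_map_inr _ _).mul_nonneg
        (map_nonneg _ ((hP.1 x).1 a)) (map_nonneg _ ((hQ.1 y).1 b)))
    exact (Complex.eq_re_of_ofReal_le hnn).symm

end Product

/-- The ⋆-homomorphism `a ↦ a ⊗ 1`. -/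
def includeLeftHom (A B : Type*) [CStarAlgebra A] [CStarAlgebra B] : A →⋆ₐ[ℂ] A ⊗[ℂ] B :=
  { Algebra.TensorProduct.includeLeft with
    map_star' := fun a => by
      change star a ⊗ₜ[ℂ] (1 : B) = star (a ⊗ₜ[ℂ] (1 : B))
      rw [TensorProduct.star_tmul, star_one] }

/-- The ⋆-homomorphism `b ↦ 1 ⊗ b`. -/
def includeRightHom (A B : Type*) [CStarAlgebra A] [CStarAlgebra B] : B →⋆ₐ[ℂ] A ⊗[ℂ] B :=
  { Algebra.TensorProduct.includeRight with
    map_star' := fun b => by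
      change (1 : A) ⊗ₜ[ℂ] star b = star ((1 : A) ⊗ₜ[ℂ] b)
      rw [TensorProduct.star_tmul, star_one] }

theorem includeLeftHom_mul_includeRightHom {A B : Type*} [CStarAlgebra A] [CStarAlgebra B] (a : A)
    (b : B) : includeLeftHom A B a * includeRightHom A B b = a ⊗ₜ b := by
  change a ⊗ₜ[ℂ] (1 : B) * (1 : A) ⊗ₜ[ℂ] b = _
  rw [Algebra.TensorProduct.tmul_mul_tmul, mul_one, one_mul]

theorem commute_includeLeftHom_includeRightHom {A B : Type*} [CStarAlgebra A] [CStarAlgebra B]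
    (a : A) (b : B) : Commute (includeLeftHom A B a) (includeRightHom A B b) := by
  change a ⊗ₜ[ℂ] (1 : B) * (1 : A) ⊗ₜ[ℂ] b = (1 : A) ⊗ₜ[ℂ] b * a ⊗ₜ[ℂ] (1 : B)
  rw [Algebra.TensorProduct.tmul_mul_tmul, Algebra.TensorProduct.tmul_mul_tmul, mul_one, one_mul,
    mul_one, one_mul]

theorem Cq_subset_Cqc (k n : ℕ) : Cq k n ⊆ Cqc k n := by
  rintro p ⟨HA, _, _, _, _, HB, _, _, _, _, A, B, ψ, hA, hB, hψ, hp⟩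
  let τ := tensorStarHom (StarAlgHom.id ℂ (HA →L[ℂ] HA)) (StarAlgHom.id ℂ (HB →L[ℂ] HB))
  refine ⟨HilbertTensor HA HB, inferInstance, inferInstance, inferInstance,
    fun x a => (τ.comp (includeLeftHom _ _)) (A x a),
    fun y b => (τ.comp (includeRightHom _ _)) (B y b), ψ,
    fun x => isPOVM_iff.2 ((isPOVM_iff.1 (hA x)).map _),
    fun y => isPOVM_iff.2 ((isPOVM_iff.1 (hB y)).map _),
    fun x y a b => (commute_includeLeftHom_includeRightHom _ _).map τ, ?_, fun a b x y => ?_⟩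
  · rw [UniformSpace.Completion.norm_coe, hψ]
  · simp only [StarAlgHom.comp_apply]
    rw [hp, ← map_mul,
      includeLeftHom_mul_includeRightHom, tensorStarHom_apply, tensorRep_tmul, tensorOp_coe,
      UniformSpace.Completion.inner_coe]
    rfl

/-! ### Nuclear pairs and correlations -/

/-- The numerical range of `T` lies in `[-r, s]`, so the shift by `r` is positive and its norm is
bounded by the top of the shifted interval. Unit vectors of the dense subspace suffice. -/
theorem norm_add_smul_one_le {V : Type*} [NormedAddCommGroup V] [InnerProductSpace ℂ V]
    {T : UniformSpace.Completion V →L[ℂ] UniformSpace.Completion V} (hT : IsSelfAdjoint T)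
    {s r : ℝ} (hsr : 0 ≤ s + r) (h : ∀ v : V, ‖v‖ = 1 →
      (inner ℂ (v : UniformSpace.Completion V) (T v)).re ≤ s ∧
        -r ≤ (inner ℂ (v : UniformSpace.Completion V) (T v)).re) :
    ‖T + (r : ℂ) • 1‖ ≤ s + r := by
  have h' : ∀ v : UniformSpace.Completion V, (inner ℂ v (T v)).re ≤ s * ‖v‖ ^ 2 ∧
      -r * ‖v‖ ^ 2 ≤ (inner ℂ v (T v)).re := by
    intro v
    induction v using UniformSpace.Completion.induction_on with
    | hp =>
      refine IsClosed.inter ?_ ?_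
      · exact isClosed_le (Complex.continuous_re.comp (by fun_prop)) (by fun_prop)
      · exact isClosed_le (by fun_prop) (Complex.continuous_re.comp (by fun_prop))
    | ih v =>
      by_cases hv : v = 0
      · subst hv; simp [UniformSpace.Completion.coe_zero]
      · have hn : ‖v‖ ≠ 0 := norm_ne_zero_iff.2 hv
        obtain ⟨h1, h2⟩ := h (((‖v‖⁻¹ : ℝ) : ℂ) • v) (by
          rw [norm_smul, Complex.norm_real, norm_inv, norm_norm, inv_mul_cancel₀ hn])
        have e : (inner ℂ ((((‖v‖⁻¹ : ℝ) : ℂ) • v : V) : UniformSpace.Completion V)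
            (T ((((‖v‖⁻¹ : ℝ) : ℂ) • v : V) : UniformSpace.Completion V))).re
            = ‖v‖⁻¹ * (‖v‖⁻¹ * (inner ℂ (v : UniformSpace.Completion V) (T v)).re) := by
          rw [UniformSpace.Completion.coe_smul, map_smul, inner_smul_left, inner_smul_right,
            Complex.conj_ofReal, Complex.re_ofReal_mul, Complex.re_ofReal_mul]
        rw [e] at h1 h2
        rw [UniformSpace.Completion.norm_coe]
        have hp : 0 < ‖v‖ ^ 2 := by positivity
        have e2 : ∀ t : ℝ, ‖v‖⁻¹ * (‖v‖⁻¹ * t) * ‖v‖ ^ 2 = t := fun t => by field_simp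
        constructor
        · have := mul_le_mul_of_nonneg_right h1 hp.le
          rwa [e2] at this
        · have := mul_le_mul_of_nonneg_right h2 hp.le
          rwa [e2] at this
  have hsa : IsSelfAdjoint (T + (r : ℂ) • (1 : UniformSpace.Completion V →L[ℂ] _)) :=
    hT.add (IsSelfAdjoint.smul (Complex.conj_ofReal r) (IsSelfAdjoint.one _))
  have hin : ∀ v : UniformSpace.Completion V, (inner ℂ v ((T + (r : ℂ) • 1) v)).re
      = (inner ℂ v (T v)).re + r * ‖v‖ ^ 2 := fun v => by
    have := inner_self_eq_norm_sq_to_K (𝕜 := ℂ) v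
    rw [add_apply, inner_add_right, Complex.add_re, smul_apply, inner_smul_right, one_apply_eq_self,
      this, Complex.re_ofReal_mul]
    congr 2
    rw [← RCLike.ofReal_pow]
    exact Complex.ofReal_re (‖v‖ ^ 2)
  have hpos : 0 ≤ T + (r : ℂ) • (1 : UniformSpace.Completion V →L[ℂ] _) := by
    rw [ContinuousLinearMap.nonneg_iff_isPositive, ContinuousLinearMap.isPositive_def']
    refine ⟨hsa, fun v => ?_⟩
    rw [ContinuousLinearMap.reApplyInnerSelf_apply, ← inner_conj_symm, RCLike.conj_re]
    refine (?_ : (0 : ℝ) ≤ _).trans_eq (hin v).symm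
    linarith [(h' v).2]
  rw [CStarAlgebra.norm_le_iff_le_algebraMap _ hsr hpos, ContinuousLinearMap.le_def,
    ContinuousLinearMap.isPositive_def']
  refine ⟨(IsSelfAdjoint.algebraMap _ (IsSelfAdjoint.all _)).sub hsa, fun v => ?_⟩
  rw [ContinuousLinearMap.reApplyInnerSelf_apply, ← inner_conj_symm, RCLike.conj_re, sub_apply,
    inner_sub_right, map_sub, Algebra.algebraMap_eq_smul_one, smul_apply, one_apply_eq_self,
    ← Complex.coe_smul, inner_smul_right, inner_self_eq_norm_sq_to_K]
  have h1 := hin v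
  have h2 := (h' v).1
  have h3 : RCLike.re (((s + r : ℝ) : ℂ) * ((‖v‖ : ℂ)) ^ 2) = (s + r) * ‖v‖ ^ 2 := by
    rw [← Complex.ofReal_pow, ← Complex.ofReal_mul]
    exact Complex.ofReal_re _
  refine h3.symm ▸ sub_nonneg.2 ?_
  refine h1.trans_le ?_
  linarith

/-- If a pair of group C⋆-algebras with universal families of POVMs is nuclear, then quantum
commuting correlations are limits of quantum correlations. -/
theorem Cqc_subset_Cqa_of_isNuclearPair {G₁ G₂ : Type} [Group G₁] [Group G₂] {k n : ℕ}
    {P : Fin k → Fin n → GroupCStar G₁} {Q : Fin k → Fin n → GroupCStar G₂}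
    (hP : IsUniversalPOVM P) (hQ : IsUniversalPOVM Q)
    (hN : IsNuclearPair (GroupCStar G₁) (GroupCStar G₂)) : Cqc k n ⊆ Cqa k n := by
  refine fun p hp => mem_Cqa_of_pairing_le fun c s hs => ?_
  obtain ⟨K, _, _, _, π, ρ, η, hc, hη, hp⟩ := exists_dilation_of_mem_Cqc hP hQ hp
  have hcc : ∀ z w, Commute (GroupCStar.lift π z) (GroupCStar.lift ρ w) := fun z w =>
    GroupCStar.commute_lift (fun h => (GroupCStar.commute_lift (fun g =>
      ((hc g h).map (unitary _).subtype).symm) z).symm) w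
  let Θ := commStarHom (GroupCStar.lift π) (GroupCStar.lift ρ) hcc
  let z : GroupCStar G₁ ⊗[ℂ] GroupCStar G₂ :=
    ∑ a, ∑ b, ∑ x, ∑ y, (c a b x y : ℂ) • (P x a ⊗ₜ Q y b)
  have hz : IsSelfAdjoint z := by
    refine isSelfAdjoint_sum _ fun a _ => isSelfAdjoint_sum _ fun b _ => isSelfAdjoint_sum _
      fun x _ => isSelfAdjoint_sum _ fun y _ => IsSelfAdjoint.smul (Complex.conj_ofReal _) ?_
    rw [IsSelfAdjoint, TensorProduct.star_tmul, (((hP.1 x).1 a).isSelfAdjoint).star_eq,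
      (((hQ.1 y).1 b).isSelfAdjoint).star_eq]
  have hpz : (c.pairing p : ℂ) = inner ℂ η (Θ z η) := by
    simp only [Correlation.pairing, z, map_sum, map_smul, sum_apply, smul_apply, inner_sum,
      inner_smul_right, Complex.ofReal_sum, Complex.ofReal_mul, hp]
    rfl
  -- Large enough that `z + r` is positive in every spatial representation and that `s + r ≥ 0`.
  let r := maxNorm z + |s|
  have hr : 0 ≤ s + r := by
    have := neg_abs_le s
    have := maxNorm_nonneg z
    change 0 ≤ s + (maxNorm z + |s|)
    linarith
  have h1 : c.pairing p + r ≤ ‖Θ (z + (r : ℂ) • 1)‖ := by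
    have e : ((c.pairing p + r : ℝ) : ℂ) = inner ℂ η (Θ (z + (r : ℂ) • 1) η) := by
      have := inner_self_eq_norm_sq_to_K (𝕜 := ℂ) η
      rw [map_add, map_smul, map_one, add_apply, inner_add_right, ← hpz, smul_apply,
        inner_smul_right, one_apply_eq_self, this, hη]
      push_cast
      simp
    calc c.pairing p + r ≤ ‖((c.pairing p + r : ℝ) : ℂ)‖ := by
          rw [Complex.norm_real]; exact le_abs_self _
      _ ≤ ‖η‖ * (‖Θ (z + (r : ℂ) • 1)‖ * ‖η‖) := by
          rw [e]
          exact (norm_inner_le_norm _ _).trans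
            (mul_le_mul_of_nonneg_left (ContinuousLinearMap.le_opNorm _ _) (norm_nonneg _))
      _ = _ := by rw [hη, one_mul, mul_one]
  have h2 : minNorm (z + (r : ℂ) • 1) ≤ s + r := by
    refine minNorm_le hr fun H _ _ _ L _ _ _ σ τ => ?_
    have e : tensorRep σ τ (z + (r : ℂ) • 1) = tensorStarHom σ τ z + (r : ℂ) • 1 := by
      rw [← tensorStarHom_apply, map_add, map_smul, map_one]
    rw [e]
    refine norm_add_smul_one_le (hz.map _) hr fun v hv => ?_
    have hσ := fun x => isPOVM_iff.2 ((hP.1 x).map σ)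
    have hτ := fun y => isPOVM_iff.2 ((hQ.1 y).map τ)
    have h3 := hs _ (tensorCorrelation_mem_Cq hσ hτ hv)
    have h4 : (c.pairing (tensorCorrelation (fun x a => σ (P x a)) (fun y b => τ (Q y b)) v) : ℂ)
        = inner ℂ (v : HilbertTensor H L) (tensorStarHom σ τ z v) := by
      simp only [Correlation.pairing, z, map_sum, map_smul, sum_apply, smul_apply, inner_sum,
        inner_smul_right, Complex.ofReal_sum, Complex.ofReal_mul, coe_tensorCorrelation hσ hτ]
      simp only [tensorStarHom_apply, tensorRep_tmul, tensorOp_coe,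
        UniformSpace.Completion.inner_coe]
    rw [← h4, Complex.ofReal_re]
    refine ⟨h3, neg_le_of_abs_le ?_⟩
    rw [← Real.norm_eq_abs, ← Complex.norm_real, h4]
    refine (norm_inner_le_norm _ _).trans ?_
    have h5 := (tensorStarHom σ τ z).le_opNorm (v : HilbertTensor H L)
    rw [UniformSpace.Completion.norm_coe, hv, one_mul]
    rw [UniformSpace.Completion.norm_coe, hv, mul_one] at h5
    exact (h5.trans (norm_tensorRep_le_maxNorm σ τ z)).trans (le_add_of_nonneg_right (abs_nonneg s))
  -- Nuclearity enters here: the maximal norm, which controls the commuting representation `Θ`, is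
  -- replaced by the minimal one, which the quantum correlations control.
  have h3 := norm_le_maxNorm Θ (z + (r : ℂ) • 1)
  rw [← hN] at h3
  linarith

/-! ### From correlation sets to game values -/

theorem Cqc_eq_empty {k : ℕ} [NeZero k] : Cqc k 0 = ∅ := by
  refine Set.eq_empty_of_forall_notMem ?_
  rintro p ⟨H, _, _, _, A, B, ξ, hA, -, -, hξ, -⟩
  have h := DFunLike.congr_fun (hA 0).sum_eq_one ξ
  rw [Finset.univ_eq_empty, Finset.sum_empty] at h
  have h' : ξ = 0 := h.symm
  rw [h', norm_zero] at hξ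
  exact zero_ne_one hξ

theorem Cq_zero (n : ℕ) : Cq 0 n = Set.univ := by
  refine Set.eq_univ_of_forall fun p => ?_
  exact ⟨ℂ, inferInstance, inferInstance, inferInstance, inferInstance, ℂ, inferInstance,
    inferInstance, inferInstance, inferInstance, fun x => x.elim0, fun y => y.elim0, 1 ⊗ₜ 1,
    fun x => x.elim0, fun y => y.elim0, by rw [TensorProduct.norm_tmul]; simp,
    fun a b x => x.elim0⟩

theorem isCompact_Cqc (k n : ℕ) : IsCompact (Cqc k n) := by
  rcases Nat.eq_zero_or_pos k with rfl | hk
  · exact (Set.subsingleton_of_subsingleton).isCompact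
  have : NeZero k := ⟨hk.ne'⟩
  rcases Nat.eq_zero_or_pos n with rfl | hn
  · rw [Cqc_eq_empty]; exact isCompact_empty
  have : NeZero n := ⟨hn.ne'⟩
  rw [Cqc_eq_image (isUniversalPOVM_freeCycProj k n) (isUniversalPOVM_freeCycProj k n)]
  refine (isCompact_stateFunctions _).image ?_
  exact continuous_pi fun a => continuous_pi fun b => continuous_pi fun x => continuous_pi fun y =>
    Complex.continuous_re.comp (continuous_apply _)

theorem NonlocalGame.continuous_val {k n : ℕ} (G : NonlocalGame k n) : Continuous G.val := by
  unfold NonlocalGame.val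
  fun_prop

theorem sSup_image_closure {X : Type*} [TopologicalSpace X] {S : Set X} (hS : IsCompact (closure S))
    {f : X → ℝ} (hf : Continuous f) : sSup (f '' closure S) = sSup (f '' S) := by
  rcases S.eq_empty_or_nonempty with rfl | hne
  · rw [closure_empty]
  have hb : BddAbove (f '' closure S) := (hS.image hf).bddAbove
  refine le_antisymm (csSup_le (hne.closure.image f) ?_)
    (csSup_le_csSup hb (hne.image f) (Set.image_mono subset_closure))
  rintro _ ⟨x, hx, rfl⟩
  have hsub : closure S ⊆ {x | f x ≤ sSup (f '' S)} := closure_minimal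
    (fun y hy => le_csSup (hb.mono (Set.image_mono subset_closure)) ⟨y, hy, rfl⟩)
    (isClosed_le hf continuous_const)
  exact hsub hx

/-- The inclusion `C_qa ⊆ C_qc` is unconditional, as `C_qc` is compact and contains `C_q`. A
continuous function has the same supremum on `C_q` and on its compact closure. -/
theorem tsirelsonPositive_of_subset {k n : ℕ} (h : Cqc k n ⊆ Cqa k n) : TsirelsonPositive k n := by
  have e : Cqa k n = Cqc k n := Set.Subset.antisymm
    (closure_minimal (Cq_subset_Cqc k n) (isCompact_Cqc k n).isClosed) h
  refine ⟨e, fun G => ?_⟩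
  unfold NonlocalGame.entangledValue NonlocalGame.commutingValue
  rw [← e]
  have hc : IsCompact (closure (Cq k n)) := by
    rw [show closure (Cq k n) = Cqc k n from e]
    exact isCompact_Cqc k n
  exact (sSup_image_closure hc G.continuous_val).symm

/-- The degenerate cases: without questions there is only one correlation, and with a question but
no answers a POVM would give `0 = 1` on a nonzero space. -/
theorem tsirelsonPositive_of_forall_neZero
    (h : ∀ (k n : ℕ) [NeZero k] [NeZero n], Cqc k n ⊆ Cqa k n) (k n : ℕ) :
    TsirelsonPositive k n := by
  refine tsirelsonPositive_of_subset ?_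
  rcases Nat.eq_zero_or_pos k with rfl | hk
  · rw [Cqa, Cq_zero, closure_univ]
    exact Set.subset_univ _
  have : NeZero k := ⟨hk.ne'⟩
  rcases Nat.eq_zero_or_pos n with rfl | hn
  · rw [Cqc_eq_empty]; exact Set.empty_subset _
  have : NeZero n := ⟨hn.ne'⟩
  exact h k n

theorem Cqc_subset_Cqa_of_isNuclearPair_freeGroup {ι : Type} {i₀ i₁ : ι} (hi : i₀ ≠ i₁)
    (hN : IsNuclearPair (GroupCStar (FreeGroup ι)) (GroupCStar (FreeGroup ι))) (k n : ℕ) [NeZero k]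
    [NeZero n] : Cqc k n ⊆ Cqa k n := by
  obtain ⟨P, hP⟩ := exists_isUniversalPOVM_freeGroup hi k n
  exact Cqc_subset_Cqa_of_isNuclearPair hP hP hN

/-! ### Convex duality in C⋆-algebras -/

section Duality

variable {A : Type*} [CStarAlgebra A] [PartialOrder A] [StarOrderedRing A] {k n : ℕ}

/-- Families of self-adjoint elements which become strictly positive after the addition of
elements `D y` with sum zero. -/
def balancedPositive (A : Type*) [CStarAlgebra A] [PartialOrder A] (k n : ℕ) :
    Set (Fin k → Fin n → selfAdjoint A) :=
  {V | ∃ D : Fin k → selfAdjoint A, ∑ y, D y = 0 ∧ ∃ δ : ℝ, 0 < δ ∧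
    ∀ y b, algebraMap ℝ A δ ≤ (V y b + D y : selfAdjoint A)}

theorem convex_balancedPositive : Convex ℝ (balancedPositive A k n) := by
  rintro V ⟨D, hD, δ, hδ, h⟩ V' ⟨D', hD', δ', hδ', h'⟩ s t hs ht hst
  refine ⟨fun y => s • D y + t • D' y, ?_, s * δ + t * δ', ?_, fun y b => ?_⟩
  · rw [Finset.sum_add_distrib, ← Finset.smul_sum, ← Finset.smul_sum, hD, hD', smul_zero,
      smul_zero, add_zero]
  · rcases hs.eq_or_lt with rfl | hs
    · rw [zero_add] at hst
      subst hst
      simpa using hδ'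
    · positivity
  · have e : ((s • V + t • V') y b + (s • D y + t • D' y) : selfAdjoint A)
        = s • (V y b + D y) + t • (V' y b + D' y) := by
      simp only [Pi.add_apply, Pi.smul_apply, smul_add]
      abel
    rw [e, map_add]
    have e2 : ∀ r ε : ℝ, algebraMap ℝ A (r * ε) = r • algebraMap ℝ A ε := fun r ε => by
      rw [Algebra.algebraMap_eq_smul_one, Algebra.algebraMap_eq_smul_one, mul_smul]
    rw [e2, e2]
    exact add_le_add (smul_le_smul_of_nonneg_left (h y b) hs)
      (smul_le_smul_of_nonneg_left (h' y b) ht)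

theorem isOpen_balancedPositive : IsOpen (balancedPositive A k n) := by
  rw [Metric.isOpen_iff]
  rintro V ⟨D, hD, δ, hδ, h⟩
  refine ⟨δ / 2, half_pos hδ, fun V' hV' => ⟨D, hD, δ / 2, half_pos hδ, fun y b => ?_⟩⟩
  rw [mem_ball_iff_norm'] at hV'
  have h1 : ‖((V y b - V' y b : selfAdjoint A) : A)‖ ≤ δ / 2 :=
    ((norm_le_pi_norm ((V - V') y) b).trans (norm_le_pi_norm (V - V') y)).trans hV'.le
  have h2 : ((V y b - V' y b : selfAdjoint A) : A) ≤ algebraMap ℝ A (δ / 2) :=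
    (IsSelfAdjoint.le_algebraMap_norm_self (V y b - V' y b).2).trans
      (algebraMap_mono A h1)
  have h3 := sub_le_sub (h y b) h2
  rw [← map_sub, sub_half] at h3
  refine h3.trans_eq ?_
  push_cast
  abel

/-- Strong duality for minimizing `λ` subject to `W y b ≤ Z y` and `∑ Z y ≤ λ`. The dual variables
are positive functionals whose sum over `b` is independent of `y`. With `Z y = (s + ε)/k + D y` and
`∑ D y = 0`, feasibility follows once `V` lies in the open convex cone `balancedPositive`; otherwise
a separating functional yields dual variables violating the hypothesis. -/
theorem exists_dominating [NeZero k] (W : Fin k → Fin n → A) (hW : ∀ y b, IsSelfAdjoint (W y b))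
    {s : ℝ} (h : ∀ φ : Fin k → Fin n → A →ₚ[ℂ] ℂ,
      (∀ y y' x, ∑ b, φ y b x = ∑ b, φ y' b x) →
      ∑ y, ∑ b, (φ y b (W y b)).re ≤ s * (∑ b, φ 0 b 1).re)
    {ε : ℝ} (hε : 0 < ε) :
    ∃ Z : Fin k → A, (∀ y b, W y b ≤ Z y) ∧ ∑ y, Z y ≤ algebraMap ℝ A (s + ε) := by
  have hk : (k : ℝ) ≠ 0 := Nat.cast_ne_zero.2 (NeZero.ne k)
  let W' : Fin k → Fin n → selfAdjoint A := fun y b => ⟨W y b, hW y b⟩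
  let r : ℝ := (s + ε) / k
  let V : Fin k → Fin n → selfAdjoint A := fun y b => r • 1 - W' y b
  by_cases hV : V ∈ balancedPositive A k n
  · obtain ⟨D, hD, δ, hδ, hVD⟩ := hV
    refine ⟨fun y => algebraMap ℝ A r + D y, fun y b => ?_, ?_⟩
    · have h1 := (map_zero (algebraMap ℝ A)).symm.le.trans
        ((algebraMap_mono A hδ.le).trans (hVD y b))
      have e : ((V y b + D y : selfAdjoint A) : A) = (algebraMap ℝ A r + D y) - W y b := by
        rw [Algebra.algebraMap_eq_smul_one]
        change r • (1 : A) - W y b + D y = _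
        abel
      rw [e] at h1
      exact sub_nonneg.1 h1
    · have hD' : ∑ y, (D y : A) = 0 := by
        have := congrArg (Subtype.val : selfAdjoint A → A) hD
        rwa [AddSubgroup.val_finsetSum] at this
      rw [Finset.sum_add_distrib, hD', add_zero, Finset.sum_const, Finset.card_univ,
        Fintype.card_fin, ← map_nsmul, nsmul_eq_mul, mul_div_cancel₀ _ hk]
  exfalso
  obtain ⟨f, hf⟩ := geometric_hahn_banach_point_open convex_balancedPositive
    isOpen_balancedPositive hV
  have hcone : ∀ (t : ℝ), 0 < t → ∀ U ∈ balancedPositive A k n, t • U ∈ balancedPositive A k n := by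
    rintro t ht U ⟨D, hD, δ, hδ, hU⟩
    refine ⟨fun y => t • D y, ?_, t * δ, by positivity, fun y b => ?_⟩
    · rw [← Finset.smul_sum, hD, smul_zero]
    · have e : ((t • U) y b + t • D y : selfAdjoint A) = t • (U y b + D y) := by
        rw [smul_add]; rfl
      rw [e, Algebra.algebraMap_eq_smul_one, mul_smul, ← Algebra.algebraMap_eq_smul_one]
      exact smul_le_smul_of_nonneg_left (hU y b) ht.le
  have hC0 : ∀ U ∈ balancedPositive A k n, 0 ≤ f U := by
    intro U hU
    by_contra! hneg
    have h1 := hf _ (hcone ((|f V| + 1) / -f U) (div_pos (by positivity) (by linarith)) U hU)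
    rw [map_smul, smul_eq_mul, div_mul_eq_mul_div, lt_div_iff₀ (by linarith)] at h1
    have h2 := neg_abs_le (f V)
    nlinarith
  have hone : (1 : Fin k → Fin n → selfAdjoint A) ∈ balancedPositive A k n :=
    ⟨0, by simp, 1, one_pos, fun y b => by simp⟩
  have hV0 : f V ≤ 0 := by
    by_contra! hpos
    have h1 := hf _ (hcone (f V / (f 1 + 1)) (div_pos hpos (by linarith [hC0 1 hone])) 1 hone)
    rw [map_smul, smul_eq_mul, div_mul_eq_mul_div, lt_div_iff₀ (by linarith [hC0 1 hone])] at h1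
    nlinarith
  have hge : ∀ U : Fin k → Fin n → selfAdjoint A, (∃ D : Fin k → selfAdjoint A, ∑ y, D y = 0 ∧
      ∀ y b, (0 : A) ≤ (U y b + D y : selfAdjoint A)) → 0 ≤ f U := by
    rintro U ⟨D, hD, hU⟩
    by_contra! hneg
    -- Adding `t · 1` makes `U` strictly positive, while `t` is so small that `f (U + t · 1)` would
    -- still be negative.
    let t : ℝ := -f U / (2 * (f 1 + 1))
    have ht : 0 < t := div_pos (by linarith) (by linarith [hC0 1 hone])
    have h1 := hC0 (U + t • 1) ⟨D, hD, t, ht, fun y b => by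
      have e : (((U + t • (1 : Fin k → Fin n → selfAdjoint A)) y b + D y : selfAdjoint A) : A)
          = (U y b + D y : selfAdjoint A) + algebraMap ℝ A t := by
        rw [Algebra.algebraMap_eq_smul_one]
        change (U y b : A) + t • (1 : A) + D y = (U y b : A) + D y + t • (1 : A)
        abel
      rw [e]
      exact le_add_of_nonneg_left (hU y b)⟩
    rw [map_add, map_smul, smul_eq_mul, div_mul_eq_mul_div] at h1
    have h2 : -f U * f 1 / (2 * (f 1 + 1)) < -f U := by
      rw [div_lt_iff₀ (by linarith [hC0 1 hone])]
      nlinarith [hC0 1 hone]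
    linarith
  let g : Fin k → Fin n → selfAdjoint A →ₗ[ℝ] ℝ := fun y b =>
    f.toLinearMap ∘ₗ LinearMap.single ℝ (fun _ : Fin k => Fin n → selfAdjoint A) y ∘ₗ
      LinearMap.single ℝ (fun _ : Fin n => selfAdjoint A) b
  have hg : ∀ U, f U = ∑ y, ∑ b, g y b (U y b) := fun U => by
    change f.toLinearMap U = _
    rw [apply_eq_sum_single f.toLinearMap]
    refine Finset.sum_congr rfl fun y _ => ?_
    rw [← LinearMap.coe_single ℝ, ← LinearMap.comp_apply, apply_eq_sum_single]
    rfl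
  have hgpos : ∀ y b (x : selfAdjoint A), (0 : A) ≤ x → 0 ≤ g y b x := by
    intro y b x hx
    refine hge _ ⟨0, by simp, fun y' b' => ?_⟩
    rw [Pi.zero_apply, add_zero]
    change (0 : A) ≤ ((Pi.single y (Pi.single b x : Fin n → selfAdjoint A) :
      Fin k → Fin n → selfAdjoint A) y' b' : selfAdjoint A)
    rcases eq_or_ne y' y with rfl | hy
    · rw [Pi.single_eq_same]
      rcases eq_or_ne b' b with rfl | hb
      · rwa [Pi.single_eq_same]
      · rw [Pi.single_eq_of_ne hb]; rfl
    · rw [Pi.single_eq_of_ne hy]; rfl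
  have hgsum : ∀ y y' (x : selfAdjoint A), ∑ b, g y b x = ∑ b, g y' b x := by
    intro y y' x
    -- The families `±D y`, constant in `b`, are balanced to zero by `∓D`, so the functional
    -- vanishes on them. Taking `x` at `y` and `-x` at `y'` equates the two sums.
    have key : ∀ D : Fin k → selfAdjoint A, ∑ y, D y = 0 → ∑ y, ∑ b, g y b (D y) = 0 := by
      intro D hD
      refine le_antisymm ?_ ?_
      · have := hge (fun y _ => -D y) ⟨D, hD, fun y b => by simp⟩
        rw [hg] at this
        simp only [map_neg, Finset.sum_neg_distrib] at this
        linarith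
      · have := hge (fun y _ => D y) ⟨fun y => -D y, by rw [Finset.sum_neg_distrib, hD, neg_zero],
          fun y b => by simp⟩
        rwa [hg] at this
    have h1 := key (Pi.single y x - Pi.single y' x) (by simp)
    simp only [Pi.sub_apply, map_sub, Finset.sum_sub_distrib] at h1
    have h2 : ∀ y, ∑ z, ∑ b, g z b ((Pi.single y x : Fin k → selfAdjoint A) z) = ∑ b, g y b x :=
      fun y => by
        rw [Finset.sum_eq_single y]
        · simp
        · intro z _ hz
          simp [hz]
        · simp
    rw [h2, h2] at h1
    linarith
  let φ : Fin k → Fin n → A →ₚ[ℂ] ℂ := fun y b =>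
    PositiveLinearMap.mk₀ (complexify (g y b ∘ₗ realPart)) fun x hx => by
      rw [complexify_apply_of_isSelfAdjoint _ (IsSelfAdjoint.of_nonneg hx)]
      have : (0 : A) ≤ (realPart x : A) := by rwa [(IsSelfAdjoint.of_nonneg hx).coe_realPart]
      exact_mod_cast hgpos y b _ this
  have hφ : ∀ y b (x : selfAdjoint A), φ y b x = g y b x := fun y b x => by
    change complexify (g y b ∘ₗ realPart) (x : A) = _
    rw [complexify_apply_of_isSelfAdjoint _ x.2]
    have : realPart (x : A) = x := Subtype.ext x.2.coe_realPart
    rw [LinearMap.comp_apply, this]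
  have hφsum : ∀ y y' x, ∑ b, φ y b x = ∑ b, φ y' b x := fun y y' x => by
    have h1 := hgsum y y' (realPart x)
    have h2 := hgsum y y' (imaginaryPart x)
    rw [← realPart_add_I_smul_imaginaryPart x]
    simp only [map_add, map_smul, hφ, Finset.sum_add_distrib, ← Finset.smul_sum,
      ← Complex.ofReal_sum, h1, h2]
  let m : ℝ := ∑ b, g 0 b 1
  have hm : ∀ y, ∑ b, g y b 1 = m := fun y => hgsum y 0 1
  have hm0 : 0 ≤ m := Finset.sum_nonneg fun b _ => hgpos 0 b 1 zero_le_one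
  have h1 : ∑ y, ∑ b, g y b (W' y b) ≤ s * m := by
    have h2 := h φ hφsum
    have h3 : ∀ y b, φ y b (W y b) = g y b (W' y b) := fun y b => hφ y b (W' y b)
    have h4 : ∑ b, φ 0 b 1 = m := by
      rw [Complex.ofReal_sum]
      exact Finset.sum_congr rfl fun b _ => hφ 0 b 1
    simp only [h3, h4, Complex.ofReal_re] at h2
    exact h2
  have h2 : f V = (s + ε) * m - ∑ y, ∑ b, g y b (W' y b) := by
    rw [hg]
    simp only [V, map_sub, map_smul, Finset.sum_sub_distrib, smul_eq_mul, ← Finset.mul_sum, hm,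
      Finset.sum_const, Finset.card_univ, Fintype.card_fin, nsmul_eq_mul, r]
    field_simp
  have h3 : f 1 = k * m := by
    rw [hg]
    simp only [Pi.one_apply, hm, Finset.sum_const, Finset.card_univ, Fintype.card_fin,
      nsmul_eq_mul]
  -- The hypothesis gives `f V ≥ ε m`, while `f V ≤ 0`, so `m = 0`. Then `f 1 = 0 ≤ f V`, against
  -- the strict separation `f V < f 1`.
  have h4 := hf 1 hone
  have h5 : m ≤ 0 := by
    by_contra! hpos
    nlinarith
  have h6 : m = 0 := le_antisymm h5 hm0
  rw [h6] at h1 h2 h3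
  linarith

end Duality

/-! ### Positive functionals on matrix algebras and quantum correlations -/

/-- Positive elements with invertible sum are turned into a POVM by the inverse square root of the
sum. -/
theorem exists_povm_of_isStrictlyPositive {D : Type*} [CStarAlgebra D] [PartialOrder D]
    [StarOrderedRing D] {k n : ℕ} {N : D} (hN : IsStrictlyPositive N) {M : Fin k → Fin n → D}
    (hM : ∀ y b, 0 ≤ M y b) (hsum : ∀ y, ∑ b, M y b = N) :
    ∃ (R : D) (B : Fin k → Fin n → D), IsSelfAdjoint R ∧ (∀ y, IsCStarPOVM (B y)) ∧
      ∀ y b, R * B y b * R = M y b := by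
  let S : D := N ^ (-(1 / 2) : ℝ)
  have hS : IsSelfAdjoint S := (CFC.rpow_nonneg (a := N) (y := -(1 / 2))).isSelfAdjoint
  have h1 : N ^ (1 / 2 : ℝ) * S = 1 := by
    rw [← CFC.rpow_add hN.isUnit, add_neg_cancel, CFC.rpow_zero N hN.nonneg]
  have h2 : S * N ^ (1 / 2 : ℝ) = 1 := by
    rw [← CFC.rpow_add hN.isUnit, neg_add_cancel, CFC.rpow_zero N hN.nonneg]
  refine ⟨N ^ (1 / 2 : ℝ), fun y b => S * M y b * S, (CFC.rpow_nonneg).isSelfAdjoint,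
    fun y => ⟨fun b => ?_, ?_⟩, fun y b => ?_⟩
  · exact hS.conjugate_nonneg (hM y b)
  · rw [← Finset.sum_mul, ← Finset.mul_sum, hsum]
    exact CFC.conjugate_rpow_neg_one_half N hN
  · calc N ^ (1 / 2 : ℝ) * (S * M y b * S) * N ^ (1 / 2 : ℝ)
        = (N ^ (1 / 2 : ℝ) * S) * M y b * (S * N ^ (1 / 2 : ℝ)) := by noncomm_ring
      _ = M y b := by rw [h1, h2, one_mul, mul_one]

theorem pairing_tensorCorrelation_le {k n : ℕ} {c : Correlation k n} {s : ℝ}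
    (hs : ∀ q ∈ Cq k n, c.pairing q ≤ s) {HA HB : Type} [NormedAddCommGroup HA]
    [InnerProductSpace ℂ HA] [CompleteSpace HA] [NormedAddCommGroup HB] [InnerProductSpace ℂ HB]
    [CompleteSpace HB] {A : Fin k → Fin n → HA →L[ℂ] HA} {B : Fin k → Fin n → HB →L[ℂ] HB}
    (hA : ∀ x, IsPOVM (A x)) (hB : ∀ y, IsPOVM (B y)) (v : HA ⊗[ℂ] HB) :
    c.pairing (tensorCorrelation A B v) ≤ s * ‖v‖ ^ 2 := by
  by_cases hv : v = 0
  · subst hv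
    simp [Correlation.pairing, tensorCorrelation]
  have hn : ‖v‖ ≠ 0 := norm_ne_zero_iff.2 hv
  have h1 := hs _ (tensorCorrelation_mem_Cq hA hB (ψ := ((‖v‖⁻¹ : ℝ) : ℂ) • v) (by
    rw [norm_smul, Complex.norm_real, norm_inv, norm_norm, inv_mul_cancel₀ hn]))
  have h2 : ∀ a b x y, tensorCorrelation A B (((‖v‖⁻¹ : ℝ) : ℂ) • v) a b x y
      = (‖v‖ ^ 2)⁻¹ * tensorCorrelation A B v a b x y := fun a b x y => by
    unfold tensorCorrelation
    rw [map_smul]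
    have h3 : inner ℂ (((‖v‖⁻¹ : ℝ) : ℂ) • v) (((‖v‖⁻¹ : ℝ) : ℂ) •
        (TensorProduct.map (A x a : HA →ₗ[ℂ] HA) (B y b : HB →ₗ[ℂ] HB) v))
        = ((‖v‖⁻¹ : ℝ) : ℂ) * (((‖v‖⁻¹ : ℝ) : ℂ) * inner ℂ v
          (TensorProduct.map (A x a : HA →ₗ[ℂ] HA) (B y b : HB →ₗ[ℂ] HB) v)) := by
      refine (inner_smul_left (𝕜 := ℂ) (E := HA ⊗[ℂ] HB) _ _ _).trans ?_
      rw [Complex.conj_ofReal]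
      exact congrArg _ (inner_smul_right (𝕜 := ℂ) (E := HA ⊗[ℂ] HB) _ _ _)
    rw [h3, Complex.re_ofReal_mul, Complex.re_ofReal_mul, ← mul_assoc, sq, mul_inv]
  have h3 : c.pairing (tensorCorrelation A B (((‖v‖⁻¹ : ℝ) : ℂ) • v))
      = (‖v‖ ^ 2)⁻¹ * c.pairing (tensorCorrelation A B v) := by
    simp only [Correlation.pairing, h2, Finset.mul_sum, mul_left_comm]
  rw [h3, inv_mul_le_iff₀ (by positivity), mul_comm] at h1
  exact h1

/-! ### Density operators and steering in finite dimensions -/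

section Density

variable {E : Type} [NormedAddCommGroup E] [InnerProductSpace ℂ E] [FiniteDimensional ℂ E]
  [CompleteSpace E] {ι : Type} [Fintype ι]

/-- The bilinear pairing `∑ ⟨e_i, T e_j⟩ ⟨e_i, S e_j⟩` of operators. -/
def entryPairing (e : ι → E) (T S : E →L[ℂ] E) : ℂ :=
  ∑ i, ∑ j, inner ℂ (e i) (T (e j)) * inner ℂ (e i) (S (e j))

theorem entryPairing_add_right (e : ι → E) (T S S' : E →L[ℂ] E) :
    entryPairing e T (S + S') = entryPairing e T S + entryPairing e T S' := by
  simp only [entryPairing, add_apply, inner_add_right, mul_add, Finset.sum_add_distrib]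

theorem entryPairing_smul_right (e : ι → E) (T S : E →L[ℂ] E) (c : ℂ) :
    entryPairing e T (c • S) = c * entryPairing e T S := by
  simp only [entryPairing, smul_apply, inner_smul_right, Finset.mul_sum, mul_left_comm]

theorem entryPairing_sum_right (e : ι → E) (T : E →L[ℂ] E) {κ : Type*} (I : Finset κ)
    (S : κ → E →L[ℂ] E) : entryPairing e T (∑ i ∈ I, S i) = ∑ i ∈ I, entryPairing e T (S i) := by
  classical
  induction I using Finset.induction_on with
  | empty => simp [entryPairing]
  | insert i I hi ih => rw [Finset.sum_insert hi, Finset.sum_insert hi, entryPairing_add_right, ih]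

theorem entryPairing_comm (e : ι → E) (T S : E →L[ℂ] E) :
    entryPairing e T S = entryPairing e S T := by
  simp only [entryPairing, mul_comm]

/-- The operator with the matrix entries `φ(e_{ij})`. -/
def densityOp (e : ι → E) (φ : (E →L[ℂ] E) →ₚ[ℂ] ℂ) : E →L[ℂ] E :=
  ∑ i, ∑ j, φ (InnerProductSpace.rankOne ℂ (e i) (e j)) • InnerProductSpace.rankOne ℂ (e i) (e j)

/-- The quadratic form at `u` is `φ` of the rank-one operator of the vector `w'` whose coordinates
are the conjugates of those of `u`. -/
theorem densityOp_nonneg (e : ι → E) (φ : (E →L[ℂ] E) →ₚ[ℂ] ℂ) : 0 ≤ densityOp e φ := by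
  rw [ContinuousLinearMap.nonneg_iff_isPositive, ContinuousLinearMap.isPositive_iff_complex]
  intro u
  let w : E := ∑ i, inner ℂ (e i) u • e i
  let w' : E := ∑ i, inner ℂ u (e i) • e i
  have h1 : inner ℂ u (densityOp e φ u) = φ (InnerProductSpace.rankOne ℂ w' w') := by
    simp only [densityOp, w', sum_apply, smul_apply, InnerProductSpace.rankOne_apply, inner_sum,
      inner_smul_right, map_sum, map_smul, map_smulₛₗ, smul_apply, sum_apply, smul_eq_mul,
      inner_conj_symm]
    rw [Finset.sum_comm]
    refine Finset.sum_congr rfl fun i _ => ?_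
    rw [Finset.mul_sum]
    exact Finset.sum_congr rfl fun j _ => by ring
  have h2 : 0 ≤ inner ℂ u (densityOp e φ u) := by
    rw [h1]
    exact map_nonneg φ ((ContinuousLinearMap.nonneg_iff_isPositive _).2
      (InnerProductSpace.isPositive_rankOne_self _))
  have h3 : inner ℂ (densityOp e φ u) u = inner ℂ u (densityOp e φ u) := by
    rw [← inner_conj_symm]
    exact Complex.conj_eq_iff_im.2 (Complex.nonneg_iff.1 h2).2.symm
  rw [h3]
  exact ⟨(Complex.eq_re_of_ofReal_le h2).symm, (Complex.nonneg_iff.1 h2).1⟩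

variable [DecidableEq ι]

theorem inner_densityOp (e : OrthonormalBasis ι ℂ E) (φ : (E →L[ℂ] E) →ₚ[ℂ] ℂ) (i j : ι) :
    inner ℂ (e i) (densityOp e φ (e j)) = φ (InnerProductSpace.rankOne ℂ (e i) (e j)) := by
  simp only [densityOp, sum_apply, smul_apply, InnerProductSpace.rankOne_apply, inner_sum,
    inner_smul_right, OrthonormalBasis.inner_eq_ite]
  simp

theorem eq_sum_rankOne (e : OrthonormalBasis ι ℂ E) (T : E →L[ℂ] E) :
    T = ∑ i, ∑ j, inner ℂ (e i) (T (e j)) • InnerProductSpace.rankOne ℂ (e i) (e j) := by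
  refine ContinuousLinearMap.coe_injective (e.toBasis.ext fun j => ?_)
  simp only [OrthonormalBasis.coe_toBasis, ContinuousLinearMap.coe_coe, sum_apply, smul_apply,
    InnerProductSpace.rankOne_apply, OrthonormalBasis.inner_eq_ite]
  simp only [ite_smul, one_smul, zero_smul, smul_ite, smul_zero, Finset.sum_ite_eq', Finset.mem_univ,
    if_true]
  exact (e.sum_repr' (T (e j))).symm

theorem entryPairing_densityOp (e : OrthonormalBasis ι ℂ E) (φ : (E →L[ℂ] E) →ₚ[ℂ] ℂ)
    (T : E →L[ℂ] E) : entryPairing e T (densityOp e φ) = φ T := by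
  conv_rhs => rw [eq_sum_rankOne e T]
  simp only [entryPairing, inner_densityOp, map_sum, map_smul, smul_eq_mul]

/-- The vector `∑ e_j ⊗ R e_j`. -/
def diagonalVector (e : ι → E) (R : E →L[ℂ] E) : E ⊗[ℂ] E := ∑ j, e j ⊗ₜ R (e j)

/-- The steering identity: measuring `B` on the second leg of `∑ e_j ⊗ R e_j` induces on the first
leg the functional with density `R B R`. -/
theorem inner_diagonalVector (e : ι → E) {R : E →L[ℂ] E} (hR : IsSelfAdjoint R)
    (T B : E →L[ℂ] E) :
    inner ℂ (diagonalVector e R)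
      (TensorProduct.map (T : E →ₗ[ℂ] E) (B : E →ₗ[ℂ] E) (diagonalVector e R))
      = entryPairing e T (R * B * R) := by
  unfold diagonalVector entryPairing
  rw [map_sum]
  refine (sum_inner (𝕜 := ℂ) (E := E ⊗[ℂ] E) _ _ _).trans (Finset.sum_congr rfl fun i _ => ?_)
  refine (inner_sum (𝕜 := ℂ) (E := E ⊗[ℂ] E) _ _ _).trans (Finset.sum_congr rfl fun j _ => ?_)
  rw [TensorProduct.map_tmul, TensorProduct.inner_tmul]
  refine congrArg _ ?_
  have h := ContinuousLinearMap.adjoint_inner_right R (e i) (B (R (e j)))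
  rw [← ContinuousLinearMap.star_eq_adjoint, hR.star_eq] at h
  exact h.symm

/-- Positive `M y b` with common invertible sum `N` have the form `R B R` with `R = N^{1/2}` and
POVMs `B y`. The left side is then the pairing with an unnormalized quantum correlation, and
`entryPairing e 1 N` is the squared norm of its vector. -/
theorem sum_entryPairing_le {k n : ℕ} [NeZero k] {c : Correlation k n} {s : ℝ}
    (hs : ∀ q ∈ Cq k n, c.pairing q ≤ s) (e : OrthonormalBasis ι ℂ E)
    {T : Fin k → Fin n → E →L[ℂ] E} (hT : ∀ x, IsPOVM (T x)) {N : E →L[ℂ] E}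
    (hN : IsStrictlyPositive N) {M : Fin k → Fin n → E →L[ℂ] E} (hM : ∀ y b, 0 ≤ M y b)
    (hsum : ∀ y, ∑ b, M y b = N) :
    ∑ y, ∑ b, (entryPairing e (∑ a, ∑ x, (c a b x y : ℂ) • T x a) (M y b)).re
      ≤ s * (entryPairing e 1 N).re := by
  obtain ⟨R, B, hR, hB, hRB⟩ := exists_povm_of_isStrictlyPositive hN hM hsum
  have h1 := pairing_tensorCorrelation_le hs hT (fun y => isPOVM_iff.2 (hB y)) (diagonalVector e R)
  have h2 : ‖diagonalVector e R‖ ^ 2 = (entryPairing e 1 N).re := by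
    have h3 := inner_self_eq_norm_sq_to_K (𝕜 := ℂ) (diagonalVector e R)
    have h4 := inner_diagonalVector e hR 1 1
    have h5 : TensorProduct.map ((1 : E →L[ℂ] E) : E →ₗ[ℂ] E) ((1 : E →L[ℂ] E) : E →ₗ[ℂ] E)
        (diagonalVector e R) = diagonalVector e R :=
      LinearMap.congr_fun (TensorProduct.map_id (R := ℂ) (M := E) (N := E)) _
    have h6 : R * 1 * R = N := by
      rw [← hsum 0, ← Finset.sum_congr rfl fun b _ => hRB 0 b, ← Finset.sum_mul, ← Finset.mul_sum,
        (hB 0).2]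
    rw [h5, h6] at h4
    rw [← h4]
    refine Eq.trans ?_ (congrArg Complex.re h3).symm
    rw [← RCLike.ofReal_pow]
    exact (Complex.ofReal_re _).symm
  rw [h2] at h1
  refine Eq.trans_le ?_ h1
  have h7 : ∀ a b x y, tensorCorrelation T B (diagonalVector e R) a b x y
      = (entryPairing e (T x a) (M y b)).re := fun a b x y => by
    rw [← hRB y b, ← inner_diagonalVector e hR]
    rfl
  have h8 : ∀ y b, (entryPairing e (∑ a, ∑ x, (c a b x y : ℂ) • T x a) (M y b)).re
      = ∑ a, ∑ x, c a b x y * (entryPairing e (T x a) (M y b)).re := fun y b => by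
    rw [entryPairing_comm]
    simp only [entryPairing_sum_right, entryPairing_smul_right, Complex.re_sum,
      Complex.re_ofReal_mul]
    simp only [fun T => entryPairing_comm e T (M y b)]
  simp only [Correlation.pairing, h7, h8]
  rw [Finset.sum_comm]
  refine Eq.trans ?_ Finset.sum_comm
  refine Finset.sum_congr rfl fun b _ => ?_
  rw [Finset.sum_comm]
  refine Finset.sum_congr rfl fun a _ => ?_
  exact Finset.sum_comm

/-- In finite dimensions every positive functional has a density operator, so functionals with a
common sum arise by steering. This is the hypothesis that `exists_dominating` asks for. -/
theorem sum_apply_le_of_forall_mem_Cq {k n : ℕ} [NeZero k] [NeZero n] {c : Correlation k n} {s : ℝ}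
    (hs : ∀ q ∈ Cq k n, c.pairing q ≤ s) {T : Fin k → Fin n → E →L[ℂ] E}
    (hT : ∀ x, IsPOVM (T x)) (φ : Fin k → Fin n → (E →L[ℂ] E) →ₚ[ℂ] ℂ)
    (hφ : ∀ y y' x, ∑ b, φ y b x = ∑ b, φ y' b x) :
    ∑ y, ∑ b, (φ y b (∑ a, ∑ x, (c a b x y : ℂ) • T x a)).re ≤ s * (∑ b, φ 0 b 1).re := by
  let e := stdOrthonormalBasis ℂ E
  let W : Fin k → Fin n → E →L[ℂ] E := fun y b => ∑ a, ∑ x, (c a b x y : ℂ) • T x a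
  have key : ∀ ε : ℝ, 0 < ε →
      ∑ y, ∑ b, (φ y b (W y b)).re + ε * ∑ y, (entryPairing e (W y 0) 1).re
        ≤ s * (∑ b, φ 0 b 1).re + ε * (s * (entryPairing e 1 1).re) := by
    intro ε hε
    -- Adding `ε · 1` to outcome `0` for every `y` keeps the sums equal and makes them invertible;
    -- `ε` then tends to `0`.
    let M : Fin k → Fin n → E →L[ℂ] E := fun y b =>
      densityOp e (φ y b) + if b = 0 then (ε : ℂ) • 1 else 0
    let N : E →L[ℂ] E := ∑ b, M 0 b
    have hε1 : 0 ≤ (ε : ℂ) • (1 : E →L[ℂ] E) := by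
      rw [Complex.coe_smul]; exact smul_nonneg hε.le zero_le_one
    have hM : ∀ y b, 0 ≤ M y b := fun y b => by
      refine add_nonneg (densityOp_nonneg e _) ?_
      split_ifs
      · exact hε1
      · exact le_rfl
    have hsum' : ∀ y, ∑ b, M y b = ∑ b, densityOp e (φ y b) + (ε : ℂ) • 1 := fun y => by
      simp [M, Finset.sum_add_distrib]
    have hsum : ∀ y, ∑ b, M y b = N := fun y => by
      change _ = ∑ b, M 0 b
      rw [hsum', hsum']
      refine congrArg (· + _) ?_
      simp only [densityOp]
      rw [Finset.sum_comm, Finset.sum_comm (s := Finset.univ (α := Fin n))]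
      refine Finset.sum_congr rfl fun i _ => ?_
      rw [Finset.sum_comm, Finset.sum_comm (s := Finset.univ (α := Fin n))]
      refine Finset.sum_congr rfl fun j _ => ?_
      rw [← Finset.sum_smul, ← Finset.sum_smul, hφ y 0]
    have hN : IsStrictlyPositive N := by
      rw [← hsum 0, hsum']
      refine IsStrictlyPositive.of_le (a := (ε : ℂ) • 1) ?_
        (le_add_of_nonneg_left (Finset.sum_nonneg fun b _ => densityOp_nonneg e _))
      exact ⟨hε1, IsUnit.smul (Units.mk0 (ε : ℂ) (Complex.ofReal_ne_zero.2 hε.ne')) isUnit_one⟩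
    have h := sum_entryPairing_le hs e hT hN hM hsum
    have h1 : ∀ y b, (entryPairing e (W y b) (M y b)).re = (φ y b (W y b)).re
        + if b = 0 then ε * (entryPairing e (W y b) 1).re else 0 := fun y b => by
      simp only [M]
      rw [entryPairing_add_right, entryPairing_densityOp, Complex.add_re]
      split_ifs
      · rw [entryPairing_smul_right, Complex.re_ofReal_mul]
      · simp [entryPairing]
    have h2 : (entryPairing e 1 N).re = (∑ b, φ 0 b 1).re + ε * (entryPairing e 1 1).re := by
      rw [← hsum 0, hsum', entryPairing_add_right, entryPairing_sum_right, entryPairing_smul_right,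
        Complex.add_re, Complex.re_ofReal_mul]
      simp only [entryPairing_densityOp]
    rw [h2] at h
    have h3 : ∑ y, ∑ b, (entryPairing e (W y b) (M y b)).re
        = ∑ y, ∑ b, (φ y b (W y b)).re + ε * ∑ y, (entryPairing e (W y 0) 1).re := by
      simp only [h1, Finset.sum_add_distrib, Finset.sum_ite_eq', Finset.mem_univ, if_true,
        Finset.mul_sum]
    have h4 := h3.symm.trans_le h
    linarith
  by_contra! hlt
  let u := ∑ y, ∑ b, (φ y b (W y b)).re - s * (∑ b, φ 0 b 1).re
  have hu : 0 < u := sub_pos.2 hlt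
  let d := s * (entryPairing e 1 1).re - ∑ y, (entryPairing e (W y 0) 1).re
  have h1 : ∀ ε : ℝ, 0 < ε → u ≤ ε * d := fun ε hε => by
    have := key ε hε
    simp only [u, d, mul_sub]
    linarith
  -- This `ε` makes `ε d` smaller than `u`.
  have h2 := h1 (u / (2 * (|d| + 1))) (by positivity)
  rw [div_mul_eq_mul_div, le_div_iff₀ (by positivity)] at h2
  have h3 := le_abs_self d
  have h4 := abs_nonneg d
  nlinarith

end Density

section

open Filter Topology

/-! ### Limits in the weak operator topology -/

section Limit

variable {K : Type*} [NormedAddCommGroup K] [InnerProductSpace ℂ K] [CompleteSpace K]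

/-- Weak operator compactness of balls: the matrix coefficients converge along the ultrafilter by
compactness of discs, and the limiting bounded sesquilinear form is an operator by Riesz. -/
theorem exists_tendsto_inner {ι : Type*} (U : Ultrafilter ι) {Z : ι → K →L[ℂ] K} {C : ℝ}
    (hZ : ∀ i, ‖Z i‖ ≤ C) :
    ∃ T : K →L[ℂ] K, ∀ u v, Tendsto (fun i => inner ℂ u (Z i v)) U (𝓝 (inner ℂ u (T v))) := by
  have hb : ∀ i u v, ‖inner ℂ (Z i v) u‖ ≤ C * ‖v‖ * ‖u‖ := fun i u v =>
    (norm_inner_le_norm _ _).trans (mul_le_mul_of_nonneg_right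
      (((Z i).le_opNorm v).trans (mul_le_mul_of_nonneg_right (hZ i) (norm_nonneg v)))
      (norm_nonneg u))
  have hlim : ∀ u v, ∃ l : ℂ, Tendsto (fun i => inner ℂ (Z i v) u) U (𝓝 l) := fun u v => by
    obtain ⟨l, -, hl⟩ := (isCompact_closedBall (0 : ℂ) (C * ‖v‖ * ‖u‖)).ultrafilter_le_nhds
      (U.map fun i => inner ℂ (Z i v) u) (by
        rw [le_principal_iff]
        exact Ultrafilter.mem_map.2 (Filter.univ_mem' fun i => mem_closedBall_zero_iff.2 (hb i u v)))
    exact ⟨l, hl⟩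
  choose l hl using hlim
  have hlb : ∀ u v, ‖l u v‖ ≤ C * ‖v‖ * ‖u‖ := fun u v =>
    le_of_tendsto (hl u v).norm (Eventually.of_forall fun i => hb i u v)
  let f : K → StrongDual ℂ K := fun v => LinearMap.mkContinuous
    { toFun := fun u => l u v
      map_add' := fun u u' => tendsto_nhds_unique (hl (u + u') v) (by
        simp only [inner_add_right]
        exact (hl u v).add (hl u' v))
      map_smul' := fun c u => tendsto_nhds_unique (hl (c • u) v) (by
        simp only [inner_smul_right]
        exact (hl u v).const_mul c) } (C * ‖v‖) fun u => hlb u v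
  let w : K → K := fun v => (InnerProductSpace.toDual ℂ K).symm (f v)
  have hw : ∀ u v, inner ℂ (w v) u = l u v := fun u v =>
    InnerProductSpace.toDual_symm_apply
  have hwb : ∀ v, ‖w v‖ ≤ |C| * ‖v‖ := fun v => by
    rw [LinearIsometryEquiv.norm_map]
    refine ContinuousLinearMap.opNorm_le_bound _ (by positivity) fun u => ?_
    refine (hlb u v).trans ?_
    gcongr
    exact le_abs_self C
  let T : K →L[ℂ] K := LinearMap.mkContinuous
    { toFun := w
      map_add' := fun v v' => ext_inner_right ℂ fun u => by
        rw [inner_add_left, hw, hw, hw]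
        refine tendsto_nhds_unique (hl u (v + v')) ?_
        simp only [map_add, inner_add_left]
        exact (hl u v).add (hl u v')
      map_smul' := fun c v => ext_inner_right ℂ fun u => by
        rw [inner_smul_left, hw, hw]
        refine tendsto_nhds_unique (hl u (c • v)) ?_
        simp only [map_smul, inner_smul_left]
        exact (hl u v).const_mul _ } |C| hwb
  refine ⟨T, fun u v => ?_⟩
  have h := (Complex.continuous_conj.tendsto _).comp (hl u v)
  rw [← hw] at h
  change Tendsto _ _ (𝓝 (inner ℂ u (w v)))
  rw [← inner_conj_symm]
  refine h.congr fun i => ?_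
  exact inner_conj_symm _ _

end Limit

theorem nonneg_of_forall_inner {K : Type*} [NormedAddCommGroup K] [InnerProductSpace ℂ K]
    [CompleteSpace K] {T : K →L[ℂ] K} (h : ∀ u, 0 ≤ inner ℂ u (T u)) : 0 ≤ T := by
  rw [ContinuousLinearMap.nonneg_iff_isPositive, ContinuousLinearMap.isPositive_iff_complex]
  intro u
  have h3 : inner ℂ (T u) u = inner ℂ u (T u) := by
    rw [← inner_conj_symm]
    exact Complex.conj_eq_iff_im.2 (Complex.nonneg_iff.1 (h u)).2.symm
  rw [h3]
  exact ⟨(Complex.eq_re_of_ofReal_le (h u)).symm, (Complex.nonneg_iff.1 (h u)).1⟩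

theorem inner_nonneg_of_nonneg {K : Type*} [NormedAddCommGroup K] [InnerProductSpace ℂ K]
    [CompleteSpace K] {T : K →L[ℂ] K} (h : 0 ≤ T) (u : K) : 0 ≤ inner ℂ u (T u) :=
  ((ContinuousLinearMap.nonneg_iff_isPositive _).1 h).inner_nonneg_right u

theorem algebraMap_le_algebraMap (A : Type*) [CStarAlgebra A] [PartialOrder A] [StarOrderedRing A]
    {r s : ℝ} (h : r ≤ s) : algebraMap ℝ A r ≤ algebraMap ℝ A s :=
  algebraMap_mono A h

/-- The factor `3` is not sharp; it comes from shifting `a` to a positive element and back. Only a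
uniform bound is needed. -/
theorem norm_le_of_neg_le_of_le {A : Type*} [CStarAlgebra A] [PartialOrder A] [StarOrderedRing A]
    {a : A} {C : ℝ} (hC : 0 ≤ C) (h1 : -algebraMap ℝ A C ≤ a) (h2 : a ≤ algebraMap ℝ A C) :
    ‖a‖ ≤ 3 * C := by
  have h3 : 0 ≤ a + algebraMap ℝ A C := by rwa [← neg_le_iff_add_nonneg]
  have h4 : ‖a + algebraMap ℝ A C‖ ≤ 2 * C := by
    rw [CStarAlgebra.norm_le_iff_le_algebraMap _ (by positivity) h3, two_mul, map_add]
    exact add_le_add_left h2 _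
  have h5 : ‖algebraMap ℝ A C‖ ≤ C := by
    rw [CStarAlgebra.norm_le_iff_le_algebraMap _ hC
      ((map_zero (algebraMap ℝ A)).symm.le.trans (algebraMap_mono A hC))]
  calc ‖a‖ = ‖(a + algebraMap ℝ A C) - algebraMap ℝ A C‖ := by rw [add_sub_cancel_right]
    _ ≤ ‖a + algebraMap ℝ A C‖ + ‖algebraMap ℝ A C‖ := norm_sub_le _ _
    _ ≤ 3 * C := by linarith

/-! ### Correlations of POVMs and positive functionals -/

section Kirchberg

variable {K : Type} [NormedAddCommGroup K] [InnerProductSpace ℂ K] [CompleteSpace K] {k n : ℕ}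

/-- The weights `∑ c(a,b,x,y) T^x_a`. -/
def weight {A : Type*} [CStarAlgebra A] (c : Correlation k n) (T : Fin k → Fin n → A) (y : Fin k)
    (b : Fin n) : A := ∑ a, ∑ x, (c a b x y : ℂ) • T x a

theorem isSelfAdjoint_weight {A : Type*} [CStarAlgebra A] [PartialOrder A] [StarOrderedRing A]
    (c : Correlation k n) {T : Fin k → Fin n → A} (hT : ∀ x, IsCStarPOVM (T x)) (y : Fin k)
    (b : Fin n) : IsSelfAdjoint (weight c T y b) :=
  isSelfAdjoint_sum _ fun a _ => isSelfAdjoint_sum _ fun x _ =>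
    IsSelfAdjoint.smul (Complex.conj_ofReal _) ((hT x).1 a).isSelfAdjoint

theorem norm_weight_le {A : Type*} [CStarAlgebra A] [PartialOrder A] [StarOrderedRing A]
    (c : Correlation k n) {T : Fin k → Fin n → A} (hT : ∀ x, IsCStarPOVM (T x)) (y : Fin k)
    (b : Fin n) : ‖weight c T y b‖ ≤ ∑ y, ∑ b, ∑ a, ∑ x, |c a b x y| := by
  have h1 : ‖weight c T y b‖ ≤ ∑ a, ∑ x, |c a b x y| := by
    refine (norm_sum_le _ _).trans (Finset.sum_le_sum fun a _ => (norm_sum_le _ _).trans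
      (Finset.sum_le_sum fun x _ => ?_))
    rw [norm_smul, Complex.norm_real, Real.norm_eq_abs]
    exact mul_le_of_le_one_right (abs_nonneg _) ((hT x).norm_le_one a)
  refine h1.trans ?_
  have h2 : ∀ y b, 0 ≤ ∑ a, ∑ x, |c a b x y| := fun y b => by positivity
  refine (Finset.single_le_sum (f := fun b => ∑ a, ∑ x, |c a b x y|) (fun b _ => h2 y b)
    (Finset.mem_univ b)).trans ?_
  exact Finset.single_le_sum (f := fun y => ∑ b, ∑ a, ∑ x, |c a b x y|)
    (fun y _ => Finset.sum_nonneg fun b _ => h2 y b) (Finset.mem_univ y)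

/-- The bound must not depend on `E`, since weak limits follow. Below, `Z y ≥ W y 0 ≥ -w`; above,
all `Z y' + w` are positive, so `Z y + w` is at most their sum, which is at most `s + ε + k w`. -/
theorem exists_dominating_norm_le [NeZero k] [NeZero n] {c : Correlation k n} {s : ℝ}
    (hs : ∀ q ∈ Cq k n, c.pairing q ≤ s) {E : Type} [NormedAddCommGroup E] [InnerProductSpace ℂ E]
    [FiniteDimensional ℂ E] [CompleteSpace E] {T : Fin k → Fin n → E →L[ℂ] E}
    (hT : ∀ x, IsPOVM (T x)) {ε : ℝ} (hε : 0 < ε) :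
    ∃ Z : Fin k → E →L[ℂ] E, (∀ y b, weight c T y b ≤ Z y) ∧
      ∑ y, Z y ≤ algebraMap ℝ (E →L[ℂ] E) (s + ε) ∧
      ∀ y, ‖Z y‖ ≤ 3 * (|s| + ε + (k + 1) * ∑ y, ∑ b, ∑ a, ∑ x, |c a b x y|) := by
  have hT' := fun x => isPOVM_iff.1 (hT x)
  obtain ⟨Z, hZ, hZs⟩ := exists_dominating (weight c T) (isSelfAdjoint_weight c hT')
    (sum_apply_le_of_forall_mem_Cq hs hT) hε
  let w := ∑ y, ∑ b, ∑ a, ∑ x, |c a b x y|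
  have hw0 : 0 ≤ w := by positivity
  let C : ℝ := |s| + ε + (k + 1) * w
  have hwC : w ≤ C := by
    have := abs_nonneg s
    have hk : (0 : ℝ) ≤ k := Nat.cast_nonneg k
    simp only [C]
    nlinarith
  have hlow : ∀ y, -algebraMap ℝ (E →L[ℂ] E) w ≤ Z y := fun y => by
    refine (neg_le_neg (algebraMap_le_algebraMap (E →L[ℂ] E) (norm_weight_le c hT' y 0))).trans ?_
    exact (IsSelfAdjoint.neg_algebraMap_norm_le_self (isSelfAdjoint_weight c hT' y 0)).trans
      (hZ y 0)
  have hup : ∀ y, Z y ≤ algebraMap ℝ (E →L[ℂ] E) C := fun y => by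
    have h1 : Z y + algebraMap ℝ (E →L[ℂ] E) w ≤ ∑ y, (Z y + algebraMap ℝ (E →L[ℂ] E) w) :=
      Finset.single_le_sum (f := fun y => Z y + algebraMap ℝ (E →L[ℂ] E) w)
        (fun y _ => by rw [← neg_le_iff_add_nonneg]; exact hlow y) (Finset.mem_univ y)
    rw [Finset.sum_add_distrib, Finset.sum_const, Finset.card_univ, Fintype.card_fin,
      ← map_nsmul] at h1
    have h2 := h1.trans (add_le_add_left hZs _)
    rw [← map_add] at h2
    have h3 : Z y ≤ algebraMap ℝ (E →L[ℂ] E) (s + ε + k • w) :=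
      (le_add_of_nonneg_right ((map_zero (algebraMap ℝ (E →L[ℂ] E))).symm.le.trans
        (algebraMap_le_algebraMap (E →L[ℂ] E) hw0))).trans h2
    refine h3.trans (algebraMap_le_algebraMap (E →L[ℂ] E) ?_)
    rw [nsmul_eq_mul]
    have := le_abs_self s
    simp only [C]
    nlinarith
  have hn : ∀ y, ‖Z y‖ ≤ 3 * C := fun y =>
    norm_le_of_neg_le_of_le (A := E →L[ℂ] E) (hw0.trans hwC) ((neg_le_neg (algebraMap_le_algebraMap (E →L[ℂ] E) hwC)).trans (hlow y))
      (hup y)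
  exact ⟨Z, hZ, hZs, hn⟩

theorem inner_weight_compress (c : Correlation k n) (T : Fin k → Fin n → K →L[ℂ] K) {E : Type}
    [NormedAddCommGroup E] [InnerProductSpace ℂ E] [CompleteSpace E] (ι : E →ₗᵢ[ℂ] K) (y : Fin k)
    (b : Fin n) (u : E) :
    inner ℂ u (weight c (fun x a => ContinuousLinearMap.adjoint ι.toContinuousLinearMap ∘L T x a ∘L
      ι.toContinuousLinearMap) y b u) = inner ℂ (ι u) (weight c T y b (ι u)) := by
  simp only [weight, sum_apply, smul_apply, inner_sum, inner_smul_right,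
    ContinuousLinearMap.comp_apply, ContinuousLinearMap.adjoint_inner_right,
    LinearIsometry.coe_toContinuousLinearMap]

/-- The dominating operators on a finite-dimensional subspace, extended by zero. -/
theorem exists_dominating_on_submodule [NeZero k] [NeZero n] {c : Correlation k n} {s : ℝ}
    (hs : ∀ q ∈ Cq k n, c.pairing q ≤ s) {T : Fin k → Fin n → K →L[ℂ] K}
    (hT : ∀ x, IsPOVM (T x)) {ε : ℝ} (hε : 0 < ε) (E : Submodule ℂ K) [FiniteDimensional ℂ E] :
    ∃ Z : Fin k → K →L[ℂ] K,
      (∀ y, ‖Z y‖ ≤ 3 * (|s| + ε + (k + 1) * ∑ y, ∑ b, ∑ a, ∑ x, |c a b x y|)) ∧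
      ∀ u ∈ E, (∀ y b, 0 ≤ inner ℂ u ((Z y - weight c T y b) u)) ∧
        0 ≤ inner ℂ u ((algebraMap ℝ (K →L[ℂ] K) (s + ε) - ∑ y, Z y) u) := by
  have : CompleteSpace E := FiniteDimensional.complete ℂ E
  let ι := E.subtypeₗᵢ
  obtain ⟨Z, hZ, hZs, hn⟩ := exists_dominating_norm_le hs (fun x => (hT x).compress ι) hε
  refine ⟨fun y => ι.toContinuousLinearMap ∘L Z y ∘L
    ContinuousLinearMap.adjoint ι.toContinuousLinearMap, fun y => ?_, fun u hu => ?_⟩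
  · have hι : ‖ι.toContinuousLinearMap‖ ≤ 1 := ι.norm_toContinuousLinearMap_le
    refine (ContinuousLinearMap.opNorm_comp_le _ _).trans ?_
    refine (mul_le_mul hι (ContinuousLinearMap.opNorm_comp_le _ _) (norm_nonneg _)
      zero_le_one).trans ?_
    rw [one_mul, LinearIsometryEquiv.norm_map]
    exact (mul_le_of_le_one_right (norm_nonneg _) hι).trans (hn y)
  · obtain ⟨u, rfl⟩ : ∃ u' : E, ι u' = u := ⟨⟨u, hu⟩, rfl⟩
    have had : ContinuousLinearMap.adjoint ι.toContinuousLinearMap (ι u) = u :=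
      ext_inner_left ℂ fun v => by
        rw [ContinuousLinearMap.adjoint_inner_right]
        exact ι.inner_map_map v u
    have hZ' : ∀ y, inner ℂ (ι u) ((ι.toContinuousLinearMap ∘L Z y ∘L
        ContinuousLinearMap.adjoint ι.toContinuousLinearMap) (ι u)) = inner ℂ u (Z y u) :=
      fun y => by
        rw [ContinuousLinearMap.comp_apply, ContinuousLinearMap.comp_apply, had]
        exact ι.inner_map_map u (Z y u)
    constructor
    · intro y b
      have h1 := inner_nonneg_of_nonneg (sub_nonneg.2 (hZ y b)) u
      rw [sub_apply, inner_sub_right] at h1 ⊢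
      rwa [hZ', ← inner_weight_compress]
    · have h1 := inner_nonneg_of_nonneg (sub_nonneg.2 hZs) u
      rw [sub_apply, inner_sub_right, sum_apply, inner_sum] at h1 ⊢
      simp only [hZ']
      have h2 : inner ℂ (ι u) (algebraMap ℝ (K →L[ℂ] K) (s + ε) (ι u))
          = inner ℂ u (algebraMap ℝ (E →L[ℂ] E) (s + ε) u) := by
        rw [Algebra.algebraMap_eq_smul_one, Algebra.algebraMap_eq_smul_one, smul_apply, smul_apply,
          one_apply_eq_self, one_apply_eq_self, ← Complex.coe_smul, ← Complex.coe_smul,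
          inner_smul_right, inner_smul_right, ι.inner_map_map]
      rw [h2]
      exact h1

/-- Solutions on the finite-dimensional subspaces are uniformly bounded and have a weak limit along
an ultrafilter. Each inequality is tested on one vector `u` at a time, and `u` eventually lies in
the subspace. -/
theorem exists_dominating_of_forall_mem_Cq [NeZero k] [NeZero n] {c : Correlation k n} {s : ℝ}
    (hs : ∀ q ∈ Cq k n, c.pairing q ≤ s) {T : Fin k → Fin n → K →L[ℂ] K}
    (hT : ∀ x, IsPOVM (T x)) {ε : ℝ} (hε : 0 < ε) :
    ∃ Z : Fin k → K →L[ℂ] K, (∀ y b, weight c T y b ≤ Z y) ∧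
      ∑ y, Z y ≤ algebraMap ℝ (K →L[ℂ] K) (s + ε) := by
  choose Z hZn hZ using fun F : Finset K =>
    exists_dominating_on_submodule hs hT hε (Submodule.span ℂ (F : Set K))
  let U : Ultrafilter (Finset K) := Ultrafilter.of atTop
  choose Z' hZ' using fun y => exists_tendsto_inner U (fun F => hZn F y)
  have hev : ∀ u : K, ∀ᶠ F : Finset K in U, u ∈ Submodule.span ℂ (F : Set K) := fun u =>
    Ultrafilter.of_le atTop ((eventually_ge_atTop {u}).mono fun F hF =>
      Submodule.subset_span (hF (Finset.mem_singleton_self u)))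
  have hcl : IsClosed {z : ℂ | 0 ≤ z} := isClosed_Ici
  refine ⟨Z', fun y b => sub_nonneg.1 (nonneg_of_forall_inner fun u => ?_),
    sub_nonneg.1 (nonneg_of_forall_inner fun u => ?_)⟩
  · have h1 : Tendsto (fun F => inner ℂ u ((Z F y - weight c T y b) u)) U
        (𝓝 (inner ℂ u ((Z' y - weight c T y b) u))) := by
      simp only [sub_apply, inner_sub_right]
      exact (hZ' y u u).sub tendsto_const_nhds
    exact hcl.mem_of_tendsto h1 ((hev u).mono fun F hF => (hZ F u hF).1 y b)
  · have h1 : Tendsto (fun F => inner ℂ u ((algebraMap ℝ (K →L[ℂ] K) (s + ε) - ∑ y, Z F y) u)) U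
        (𝓝 (inner ℂ u ((algebraMap ℝ (K →L[ℂ] K) (s + ε) - ∑ y, Z' y) u))) := by
      simp only [sub_apply, inner_sub_right, sum_apply, inner_sum]
      exact tendsto_const_nhds.sub (tendsto_finsetSum _ fun y _ => hZ' y u u)
    exact hcl.mem_of_tendsto h1 ((hev u).mono fun F hF => (hZ F u hF).2)

/-- The correlations of POVMs on a Hilbert space `K` with families of positive functionals on
`B(K)` which sum up to one state are limits of quantum correlations. -/
theorem mem_Cqa_of_functionals [NeZero k] [NeZero n] {T : Fin k → Fin n → K →L[ℂ] K}
    (hT : ∀ x, IsPOVM (T x)) (ψ : Fin k → Fin n → (K →L[ℂ] K) →ₚ[ℂ] ℂ) (Ψ : (K →L[ℂ] K) → ℂ)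
    (hψ : ∀ y S, ∑ b, ψ y b S = Ψ S) (h1 : Ψ 1 = 1) {p : Correlation k n}
    (hp : ∀ a b x y, (p a b x y : ℂ) = ψ y b (T x a)) : p ∈ Cqa k n := by
  refine mem_Cqa_of_pairing_le fun c s hs => le_of_forall_pos_le_add fun ε hε => ?_
  obtain ⟨Z, hZ, hZs⟩ := exists_dominating_of_forall_mem_Cq hs hT hε
  have e1 : (c.pairing p : ℂ) = ∑ y, ∑ b, ψ y b (weight c T y b) := by
    simp only [Correlation.pairing, Complex.ofReal_sum, Complex.ofReal_mul, hp, weight, map_sum,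
      map_smul, smul_eq_mul]
    symm
    rw [Finset.sum_comm]
    refine Eq.trans ?_ Finset.sum_comm
    refine Finset.sum_congr rfl fun b _ => ?_
    rw [Finset.sum_comm]
    refine Finset.sum_congr rfl fun a _ => ?_
    exact Finset.sum_comm
  have e2 : ∑ y, Ψ (Z y) = ∑ b, ψ 0 b (∑ y, Z y) := by
    simp only [← hψ 0, map_sum]
    exact Finset.sum_comm
  have e3 : ∑ b, ψ 0 b (algebraMap ℝ (K →L[ℂ] K) (s + ε)) = ((s + ε : ℝ) : ℂ) := by
    rw [hψ, ← mul_one ((s + ε : ℝ) : ℂ), ← h1, ← hψ 0, ← hψ 0, Finset.mul_sum]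
    refine Finset.sum_congr rfl fun b _ => ?_
    rw [Algebra.algebraMap_eq_smul_one, ← Complex.coe_smul, map_smul, smul_eq_mul]
  have h2 : (c.pairing p : ℂ) ≤ ((s + ε : ℝ) : ℂ) := by
    rw [e1, ← e3]
    -- Weak duality: domination by `Z y` is independent of `b`, so only the common sum `Ψ` remains,
    -- and it is evaluated on `∑ Z y ≤ s + ε`.
    calc ∑ y, ∑ b, ψ y b (weight c T y b) ≤ ∑ y, ∑ b, ψ y b (Z y) :=
          Finset.sum_le_sum fun y _ => Finset.sum_le_sum fun b _ =>
            OrderHomClass.mono (ψ y b) (hZ y b)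
      _ = ∑ b, ψ 0 b (∑ y, Z y) := by rw [← e2]; simp only [hψ]
      _ ≤ _ := Finset.sum_le_sum fun b _ => OrderHomClass.mono (ψ 0 b) hZs
  exact Complex.real_le_real.1 h2

end Kirchberg

end

/-! ### Correlations from the weak expectation property -/

section Intertwiner

variable {A : Type*} [CStarAlgebra A] [PartialOrder A] [StarOrderedRing A]
  {H : Type*} [NormedAddCommGroup H] [InnerProductSpace ℂ H] [CompleteSpace H]

/-- The GNS space of a vector state is the cyclic subspace of the vector. -/
theorem exists_gns_intertwiner (q : A →⋆ₐ[ℂ] (H →L[ℂ] H)) (ξ : H) (φ : A →ₚ[ℂ] ℂ)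
    (hφ : ∀ a, φ a = inner ℂ ξ (q a ξ)) :
    ∃ Y : φ.GNS →L[ℂ] H, Y (gnsVector φ 1) = ξ ∧
      ∀ b v, Y (φ.gnsStarAlgHom b v) = q b (Y v) := by
  have hs : ∀ v : H, (‖v‖ : ℂ) ^ 2 = inner ℂ v v := fun v =>
    (inner_self_eq_norm_sq_to_K v).symm
  have hn : ∀ a : φ.PreGNS, ‖q (φ.ofPreGNS a) ξ‖ = ‖a‖ := fun a => by
    have h1 := hs (q (φ.ofPreGNS a) ξ)
    have h2 := φ.preGNS_norm_sq a
    rw [hφ, map_mul, map_star, mul_apply_eq_comp, ContinuousLinearMap.star_eq_adjoint,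
      ContinuousLinearMap.adjoint_inner_right] at h2
    have h3 : ‖q (φ.ofPreGNS a) ξ‖ ^ 2 = ‖a‖ ^ 2 := by exact_mod_cast h1.trans h2.symm
    exact (pow_left_inj₀ (norm_nonneg _) (norm_nonneg _) two_ne_zero).1 h3
  let f : φ.PreGNS →ₗ[ℂ] H :=
    { toFun := fun a => q (φ.ofPreGNS a) ξ
      map_add' := fun a b => by rw [map_add, map_add, add_apply]
      map_smul' := fun c a => by rw [map_smul, map_smul, smul_apply]; rfl }
  let Y₀ : φ.PreGNS →L[ℂ] H := f.mkContinuous 1 fun a => by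
    rw [one_mul]
    exact (hn a).le
  let Y : φ.GNS →L[ℂ] H :=
    Y₀.extend (UniformSpace.Completion.toComplL : φ.PreGNS →L[ℂ] φ.GNS)
  have hY : ∀ a, Y (gnsVector φ a) = q a ξ := fun a =>
    Y₀.extend_eq UniformSpace.Completion.denseRange_coe
      (UniformSpace.Completion.isUniformInducing_coe _) (φ.toPreGNS a)
  refine ⟨Y, ?_, fun b v => ?_⟩
  · rw [hY, map_one]; rfl
  · refine UniformSpace.Completion.induction_on v (isClosed_eq (by fun_prop) (by fun_prop))
      fun a => ?_
    have h : Y (φ.gnsStarAlgHom b (gnsVector φ (φ.ofPreGNS a)))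
        = q b (Y (gnsVector φ (φ.ofPreGNS a))) := by
      rw [gnsStarAlgHom_gnsVector, hY, hY, map_mul]; rfl
    exact h

end Intertwiner

/-- Every cyclic representation is a quotient of the universal representation. -/
theorem exists_universal_intertwiner {A : Type u} [CStarAlgebra A] [PartialOrder A]
    [StarOrderedRing A] {H : Type*} [NormedAddCommGroup H] [InnerProductSpace ℂ H] [CompleteSpace H]
    (q : A →⋆ₐ[ℂ] (H →L[ℂ] H)) {ξ : H} (hξ : ‖ξ‖ = 1) :
    ∃ (X : UniversalSpace A →L[ℂ] H) (Ω : UniversalSpace A), X Ω = ξ ∧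
      ∀ b, X ∘L universalRep b = q b ∘L X := by
  classical
  obtain ⟨Y, h1, hY⟩ := exists_gns_intertwiner q ξ (vectorFunctional q ξ) fun _ => rfl
  let φ : StateSpace A := ⟨vectorFunctional q ξ, by
    rw [vectorFunctional_apply, map_one]
    refine (inner_self_eq_norm_sq_to_K (𝕜 := ℂ) ξ).trans ?_
    rw [hξ]; simp⟩
  have : Fact ((1 : ENNReal) ≤ 2) := ⟨one_le_two⟩
  refine ⟨Y ∘L lp.evalCLM ℂ (fun φ : StateSpace A => φ.1.GNS) 2 φ,
    lp.single 2 φ (gnsVector φ.1 1), ?_, fun b => ?_⟩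
  · refine Eq.trans ?_ h1
    exact congrArg Y (lp.single_apply_self 2 φ _)
  · ext v
    exact hY b (v φ)

/-- The correlations of POVMs in a C⋆-algebra `A` with POVMs in the commutant of a representation
`q` are limits of quantum correlations, if `q` is intertwined with a representation `π` which has a
ucp map `Φ : B(K) → π(A)''` fixing `π(A)`. -/
theorem mem_Cqa_of_weakExpectation {A : Type*} [CStarAlgebra A] [PartialOrder A]
    [StarOrderedRing A] {K : Type} [NormedAddCommGroup K] [InnerProductSpace ℂ K] [CompleteSpace K]
    {H : Type*} [NormedAddCommGroup H] [InnerProductSpace ℂ H] [CompleteSpace H]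
    {π : A →⋆ₐ[ℂ] (K →L[ℂ] K)} {Φ : (K →L[ℂ] K) →CP (K →L[ℂ] K)}
    (hΦ : ∀ S, Φ S ∈ Set.centralizer (Set.centralizer (Set.range π)))
    (hΦπ : ∀ z, Φ (π z) = π z) {q : A →⋆ₐ[ℂ] (H →L[ℂ] H)} {X : K →L[ℂ] H} {Ω : K}
    (hX : ‖X Ω‖ = 1) (hXq : ∀ z, X ∘L π z = q z ∘L X) {k n : ℕ} [NeZero k] [NeZero n]
    {P : Fin k → Fin n → A} (hP : ∀ x, IsCStarPOVM (P x)) {Q : Fin k → Fin n → H →L[ℂ] H}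
    (hQ : ∀ y, IsPOVM (Q y)) (hqQ : ∀ z y b, Commute (q z) (Q y b)) {p : Correlation k n}
    (hp : ∀ a b x y, (p a b x y : ℂ) = inner ℂ (X Ω) ((q (P x a) * Q y b) (X Ω))) :
    p ∈ Cqa k n := by
  have hXq' : ∀ z, π z ∘L X.adjoint = X.adjoint ∘L q z := fun z => by
    have h := congrArg ContinuousLinearMap.adjoint (hXq (star z))
    rw [ContinuousLinearMap.adjoint_comp, ContinuousLinearMap.adjoint_comp, map_star π, map_star q,
      ContinuousLinearMap.star_eq_adjoint, ContinuousLinearMap.star_eq_adjoint,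
      ContinuousLinearMap.adjoint_adjoint, ContinuousLinearMap.adjoint_adjoint] at h
    exact h
  -- Pulled back by the intertwiner, the operators `Q y b` lie in the commutant of `π(A)` and so
  -- commute with the range of `Φ`. Hence `S ↦ ⟨Ω, Φ(S) D Ω⟩` is positive on all of `B(K)`, and the
  -- sum over `b` involves only `X⋆X`, whatever `y` is.
  let D : Fin k → Fin n → K →L[ℂ] K := fun y b => X.adjoint ∘L Q y b ∘L X
  have hD0 : ∀ y b, 0 ≤ D y b := fun y b =>
    (ContinuousLinearMap.nonneg_iff_isPositive _).2 (((hQ y).isPositive b).adjoint_conj X)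
  have hDc : ∀ y b, D y b ∈ Set.centralizer (Set.range π) := by
    rintro y b _ ⟨z, rfl⟩
    change (π z ∘L X.adjoint) ∘L Q y b ∘L X = X.adjoint ∘L Q y b ∘L (X ∘L π z)
    rw [hXq, hXq']
    have h := hqQ z y b
    change q z ∘L Q y b = Q y b ∘L q z at h
    rw [← ContinuousLinearMap.comp_assoc (Q y b), ← h]; rfl
  have hc : ∀ S y b, Commute (Φ S) (D y b) := fun S y b => ((hΦ S) _ (hDc y b)).symm
  let ψ : Fin k → Fin n → (K →L[ℂ] K) →ₚ[ℂ] ℂ := fun y b =>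
    PositiveLinearMap.mk₀
      { toFun := fun S => inner ℂ Ω ((Φ S * D y b) Ω)
        map_add' := fun S T => by rw [map_add, add_mul, add_apply, inner_add_right]
        map_smul' := fun c S => by
          rw [map_smul, smul_mul_assoc, smul_apply, inner_smul_right]; rfl }
      fun S hS => inner_nonneg_of_nonneg
        ((hc S y b).mul_nonneg (map_nonneg Φ hS) (hD0 y b)) Ω
  have hψ : ∀ y b S, ψ y b S = inner ℂ Ω ((Φ S * D y b) Ω) := fun y b S => rfl
  have hsum : ∀ y, ∑ b, D y b = X.adjoint ∘L X := fun y => by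
    ext v
    have h := DFunLike.congr_fun (hQ y).sum_eq_one (X v)
    rw [sum_apply] at h ⊢
    change ∑ b, X.adjoint (Q y b (X v)) = X.adjoint (X v)
    rw [← map_sum, h]; rfl
  refine mem_Cqa_of_functionals (T := fun x a => π (P x a))
    (fun x => isPOVM_iff.2 ((hP x).map _)) ψ
    (fun S => inner ℂ Ω ((Φ S * (X.adjoint ∘L X)) Ω)) (fun y S => ?_) ?_ fun a b x y => ?_
  · simp only [hψ]
    rw [← inner_sum, ← sum_apply, ← Finset.mul_sum, hsum]
  · have h : Φ 1 = 1 := by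
      have h := hΦπ 1
      rwa [map_one] at h
    rw [h, one_mul]
    change inner ℂ Ω (X.adjoint (X Ω)) = 1
    rw [ContinuousLinearMap.adjoint_inner_right]
    refine (inner_self_eq_norm_sq_to_K (𝕜 := ℂ) (X Ω)).trans ?_
    rw [hX]; simp
  · rw [hp, hψ, hΦπ]
    change _ = inner ℂ Ω ((π (P x a) ∘L X.adjoint) (Q y b (X Ω)))
    rw [hXq']
    change _ = inner ℂ Ω (X.adjoint _)
    rw [ContinuousLinearMap.adjoint_inner_right]; rfl

/-- The correlations of POVMs in a C⋆-algebra with the weak expectation property with POVMs in the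
commutant of a representation are limits of quantum correlations. -/
theorem HasWEP.mem_Cqa {A : Type} [CStarAlgebra A] [PartialOrder A] [StarOrderedRing A]
    (hA : HasWEP A) {H : Type*} [NormedAddCommGroup H] [InnerProductSpace ℂ H] [CompleteSpace H]
    (q : A →⋆ₐ[ℂ] (H →L[ℂ] H)) {k n : ℕ} [NeZero k] [NeZero n] {P : Fin k → Fin n → A}
    (hP : ∀ x, IsCStarPOVM (P x)) {Q : Fin k → Fin n → H →L[ℂ] H} (hQ : ∀ y, IsPOVM (Q y))
    (hqQ : ∀ z y b, Commute (q z) (Q y b)) {ξ : H} (hξ : ‖ξ‖ = 1) {p : Correlation k n}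
    (hp : ∀ a b x y, (p a b x y : ℂ) = inner ℂ ξ ((q (P x a) * Q y b) ξ)) : p ∈ Cqa k n := by
  -- The WEP is needed for one inclusion only, that of `A` in the operators on its universal space.
  obtain ⟨Φ, hΦ, hΦι⟩ :=
    hA (UniversalSpace A →L[ℂ] UniversalSpace A) universalRep universalRep_injective
  obtain ⟨X, Ω, rfl, hXq⟩ := exists_universal_intertwiner q hξ
  exact mem_Cqa_of_weakExpectation hΦ hΦι hξ hXq hP hQ hqQ hp

/-- The `k n` generators that parametrize the POVMs are placed among those of `𝔽_∞`, the remaining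
ones acting as `1`. Only the family `A` is encoded; `B` stays in the commutant. -/
theorem Cqc_subset_Cqa_of_hasWEP (h : HasWEP (GroupCStar (FreeGroup ℕ))) (k n : ℕ) [NeZero k]
    [NeZero n] : Cqc k n ⊆ Cqa k n := by
  rintro p ⟨H, _, _, _, A, B, ξ, hA, hB, hAB, hξ, hp⟩
  obtain ⟨P, hP, hPu⟩ := exists_freeGroup_povm k n
  obtain ⟨V, hV, hc⟩ := hPu _ A fun x => isPOVM_iff.1 (hA x)
  let e : Fin k × Fin n → ℕ := fun l => finProdFinEquiv l
  have he : Function.Injective e := Fin.val_injective.comp finProdFinEquiv.injective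
  let W : ℕ → unitary (H →L[ℂ] H) := Function.extend e V 1
  have hW : (FreeGroup.lift W).comp (FreeGroup.map e) = FreeGroup.lift V :=
    FreeGroup.ext_hom _ _ fun l => by
      rw [MonoidHom.comp_apply, FreeGroup.map.of, FreeGroup.lift_apply_of, FreeGroup.lift_apply_of]
      exact he.extend_apply _ _ _
  refine h.mem_Cqa (GroupCStar.lift (FreeGroup.lift W))
    (P := fun x a => GroupCStar.map (FreeGroup.map e) (P x a)) (fun x => (hP x).map _) hB
    (fun z y b => ?_) hξ fun a b x y => ?_
  · refine (GroupCStar.commute_lift (commute_freeGroup_lift fun i => ?_) z).symm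
    by_cases hi : ∃ l, e l = i
    · obtain ⟨l, rfl⟩ := hi
      rw [show W (e l) = V l from he.extend_apply _ _ _]
      exact hc _ (fun x a => (hAB x y a b).symm) l
    · rw [show W i = 1 from Function.extend_apply' _ _ _ hi]
      exact Commute.one_right _
  · rw [hp, GroupCStar.lift_map, hW, hV]

open TopologicalSpace in
instance GroupCStar.separableSpace {G : Type u} [Group G] [Countable G] :
    SeparableSpace (GroupCStar G) := by
  have h : IsSeparable (Submodule.span ℂ (Set.range (GroupCStar.of : G → GroupCStar G)) :
      Set (GroupCStar G)) := (Set.countable_range _).isSeparable.span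
  rw [← isSeparable_univ_iff]
  refine h.closure.mono fun x _ => ?_
  let M := (Submodule.span ℂ (Set.range (GroupCStar.of : G → GroupCStar G))).topologicalClosure
  exact GroupCStar.induction_of (P := fun x => x ∈ M) (Submodule.isClosed_topologicalClosure _)
    (fun _ _ => M.add_mem) (fun c _ => M.smul_mem c)
    (fun g => Submodule.le_topologicalClosure _ (Submodule.subset_span ⟨g, rfl⟩)) x

/-- POVMs lift along the quotient map `r` to the algebra with the WEP, which is then represented
through `r`. The commutant of the representation is unchanged, so no linear lift of `r` is required.
-/
theorem Cqc_subset_Cqa_of_hasQWEP {k n : ℕ} [NeZero k] [NeZero n]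
    (h : HasQWEP (GroupCStar (FreeGroup (Fin k × Fin n)))) : Cqc k n ⊆ Cqa k n := by
  rintro p ⟨H, _, _, _, A, B, ξ, hA, hB, hAB, hξ, hp⟩
  obtain ⟨P, hP, hPu⟩ := exists_freeGroup_povm k n
  obtain ⟨V, hV, hc⟩ := hPu _ A fun x => isPOVM_iff.1 (hA x)
  obtain ⟨C, _, _, _, r, hC, hr⟩ := h
  choose f hf using fun x a => hr (P x a)
  choose R hR hRq using fun x => exists_povm_lift.{0, 0} (f x)
  have hRP : ∀ x a, r (R x a) = P x a := fun x a => by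
    rw [hRq x _ r (by simp_rw [hf]; exact hP x), hf]
  refine hC.mem_Cqa ((GroupCStar.lift (FreeGroup.lift V)).comp r) hR hB (fun z y b => ?_) hξ
    fun a b x y => ?_
  · exact (GroupCStar.commute_lift (commute_freeGroup_lift fun l =>
      hc _ (fun x a => (hAB x y a b).symm) l) (r z)).symm
  · rw [hp, StarAlgHom.comp_apply, hRP, hV]

end QWEPTsirelson

end

theorem mainTheorem6 :
    (∀ k n : ℕ, 2 ≤ k → 2 ≤ n →
      IsNuclearPair (GroupCStar (FreeCyc k n)) (GroupCStar (FreeCyc k n)) →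
      TsirelsonPositive k n) ∧
    (∀ k n : ℕ, 2 ≤ k → 2 ≤ n →
      (∃ Φ : GroupCStar (FreeCyc k n) →CP GroupCStar (FreeGroup (Fin k)),
        Φ 1 = 1 ∧ ∀ z, GroupCStar.map (freeToFreeCyc k n) (Φ z) = z) ∧
      (IsNuclearPair (GroupCStar (FreeGroup (Fin k))) (GroupCStar (FreeGroup (Fin k))) →
        IsNuclearPair (GroupCStar (FreeCyc k n)) (GroupCStar (FreeCyc k n)))) ∧
    (QWEPPositive → ∀ k n : ℕ, TsirelsonPositive k n) := by
  refine ⟨fun k n _ hn hN => ?_, fun k n _ hn => ?_,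
    fun h => tsirelsonPositive_of_forall_neZero fun k n _ _ => ?_⟩
  · have : NeZero n := ⟨by omega⟩
    exact tsirelsonPositive_of_subset (Cqc_subset_Cqa_of_isNuclearPair
      (isUniversalPOVM_freeCycProj k n) (isUniversalPOVM_freeCycProj k n) hN)
  · have : NeZero n := ⟨by omega⟩
    exact ⟨exists_ucp_lift k n, isNuclearPair_freeCyc k n⟩
  · rcases h with h | (⟨m, hm, h⟩ | h) | h
    · exact Cqc_subset_Cqa_of_hasWEP h k n
    · exact Cqc_subset_Cqa_of_isNuclearPair_freeGroup
        (i₀ := (⟨0, by omega⟩ : Fin m)) (i₁ := ⟨1, by omega⟩) (by simp) h k n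
    · exact Cqc_subset_Cqa_of_isNuclearPair_freeGroup (i₀ := 0) (i₁ := 1) (by simp) h k n
    -- The group algebra of a countable group is separable, so the hypothesis covers `C⋆` of the
    -- free group on `[k] × [n]`.
    · exact Cqc_subset_Cqa_of_hasQWEP (h _)
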